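/- Let $G$ be a finite simple graph with $n$ vertices and $m$ edges, and let $C_0, C_t$ be cliques of $G$ (vertex subsets, possibly empty, in which every two distinct vertices are adjacent). Consider the following symmetric relations between cliques $C, C'$ of $G$: - $\mathsf{TAR}(k)$ (token addition and removal), for an integer $k \ge 0$: $|C| \ge k$, $|C'| \ge k$ and $|C \mathbin{\triangle} C'| = 1$; - $\mathsf{TS}$ (token sliding): $|C| = |C'|$, $C \setminus C' = \{v\}$, $C' \setminus C = \{w\}$ and $vw \in E(G)$; - $\mathsf{TJ}$ (token jumping): $|C| = |C'|$ and $|C \setminus C'| = |C' \setminus C| = 1$. A reconfiguration sequence of length $\ell \ge 0$ from $C_0$ to $C_t$ under a rule is a sequence $\langle D_0, D_1, \ldots, D_\ell\rangle$ of cliques of $G$ with $D_0 = C_0$, $D_\ell = C_t$, in which any two consecutive cliques are related by the rule. Shortest clique reconfiguration under the rule asks for the minimum length of such a sequence, which is defined to be $+\infty$ if there is none. The input consists of $G$, $C_0$, $C_t$ and, for $\mathsf{TAR}$, also of an integer $k$ with $0 \le k \le \min\{|C_0|, |C_t|\}$. A graph is chordal if every induced cycle in it has length three. **Theorem.** Shortest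 clique reconfiguration under each of the rules $\mathsf{TAR}$, $\mathsf{TS}$ and $\mathsf{TJ}$ can be solved in linear time for chordal graphs. That is, for each of the three rules there are a fixed program of a random access machine and a constant $c$ such that, on every input with $G$ chordal, $G$ being given by adjacency lists (in any order) and $C_0, C_t$ by their characteristic vectors, the program halts after at most $c\,(n + m + 1)$ steps with the shortest length (or the answer $+\infty$) as its output. Here each addition, truncated subtraction, indexed load or store and test for zero counts as at least one step, and all values and addresses that occur in the run are at most $c\,(n + m + 1)$, so that words of $O(\log (n + m + 2))$ bits suffice. -/

import Mathlib

open Finset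

namespace CliqueReconf

/-! ### Chordal graphs, reconfiguration rules and distances -/

/-- A graph is chordal if every induced cycle has length three, that is, no cycle on four or more
vertices is an induced subgraph. -/
def IsChordal {V : Type*} (G : SimpleGraph V) : Prop :=
  ∀ j : ℕ, 4 ≤ j → IsEmpty (SimpleGraph.cycleGraph j ↪g G)

section Rules

variable {V : Type*} [DecidableEq V]

/-- One step of token addition and removal with threshold `k`. -/
def TARStep (k : ℕ) (C D : Finset V) : Prop :=
  k ≤ #C ∧ k ≤ #D ∧ #(symmDiff C D) = 1

/-- One step of token jumping. -/
def TJStep (C D : Finset V) : Prop :=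
  #C = #D ∧ #(C \ D) = 1 ∧ #(D \ C) = 1

/-- One step of token sliding along an edge of `G`. -/
def TSStep (G : SimpleGraph V) (C D : Finset V) : Prop :=
  #C = #D ∧ ∃ v w : V, C \ D = {v} ∧ D \ C = {w} ∧ G.Adj v w

end Rules

/-- There is a reconfiguration sequence of length `l` from `C` to `D`: cliques
`S 0 = C, S 1, …, S l = D` of `G`, any two consecutive ones related by `R`. -/
def HasReconfSeq {V : Type*} (G : SimpleGraph V) (R : Finset V → Finset V → Prop)
    (C D : Finset V) (l : ℕ) : Prop :=
  ∃ S : ℕ → Finset V, S 0 = C ∧ S l = D ∧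
    (∀ i, i ≤ l → G.IsClique (S i : Set V)) ∧ ∀ i, i < l → R (S i) (S (i + 1))

/-- The shortest length of a reconfiguration sequence; it is `⊤` if there is none. -/
noncomputable def reconfDist {V : Type*} (G : SimpleGraph V) (R : Finset V → Finset V → Prop)
    (C D : Finset V) : ℕ∞ :=
  ⨅ (l : ℕ) (_ : HasReconfSeq G R C D l), (l : ℕ∞)

/-! ### A random access machine with bounded words

A program is a fixed text with structured control flow. It works on registers and on arrays of
natural numbers (register and array names are literals of the program text, array indices are
computed). The operations are addition, truncated subtraction, indexed load and store, and test
for zero. Every operation costs one step, and a program gets stuck as soon as a value or an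
address exceeds the word bound `W`. -/

/-- A memory state: the contents of the registers and of the arrays. -/
structure State where
  reg : ℕ → ℕ
  arr : ℕ → ℕ → ℕ

/-- Write `x` into register `r`. -/
def State.setReg (s : State) (r x : ℕ) : State :=
  { s with reg := Function.update s.reg r x }

/-- Write `x` into cell `i` of array `a`. -/
def State.setArr (s : State) (a i x : ℕ) : State :=
  { s with arr := Function.update s.arr a (Function.update (s.arr a) i x) }

/-- Expressions; `load a e` reads the cell of array `a` whose index is the value of `e`. -/
inductive Expr where
  | const (x : ℕ)
  | reg (r : ℕ)
  | load (a : ℕ) (e : Expr)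
  | add (e f : Expr)
  | sub (e f : Expr)

/-- The value of an expression. -/
def Expr.eval (s : State) : Expr → ℕ
  | .const x => x
  | .reg r => s.reg r
  | .load a e => s.arr a (e.eval s)
  | .add e f => e.eval s + f.eval s
  | .sub e f => e.eval s - f.eval s

/-- Every value that occurs in the evaluation of the expression is at most `W`. -/
def Expr.Fits (W : ℕ) (s : State) : Expr → Prop
  | .const x => x ≤ W
  | .reg r => s.reg r ≤ W
  | .load a e => e.Fits W s ∧ s.arr a (e.eval s) ≤ W
  | .add e f => e.Fits W s ∧ f.Fits W s ∧ e.eval s + f.eval s ≤ W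
  | .sub e f => e.Fits W s ∧ f.Fits W s

/-- The number of operations in an expression. -/
def Expr.cost : Expr → ℕ
  | .const _ => 1
  | .reg _ => 1
  | .load _ e => e.cost + 1
  | .add e f => e.cost + f.cost + 1
  | .sub e f => e.cost + f.cost + 1

/-- Programs. In `cond e p q` and `loop e p` the test is whether the value of `e` is nonzero. -/
inductive Prog where
  | skip
  | assign (r : ℕ) (e : Expr)
  | store (a : ℕ) (i e : Expr)
  | seq (p q : Prog)
  | cond (e : Expr) (p q : Prog)
  | loop (e : Expr) (p : Prog)

/-- `Exec W p s t s'`: with word bound `W`, the program `p` started in the state `s` halts in the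
state `s'` after exactly `t` steps. -/
inductive Exec (W : ℕ) : Prog → State → ℕ → State → Prop where
  | skip (s : State) : Exec W .skip s 1 s
  | assign (s : State) (r : ℕ) (e : Expr) (he : e.Fits W s) :
      Exec W (.assign r e) s (e.cost + 1) (s.setReg r (e.eval s))
  | store (s : State) (a : ℕ) (i e : Expr) (hi : i.Fits W s) (he : e.Fits W s) :
      Exec W (.store a i e) s (i.cost + e.cost + 1) (s.setArr a (i.eval s) (e.eval s))
  | seq {p q : Prog} {s₁ s₂ s₃ : State} {t u : ℕ}
      (hp : Exec W p s₁ t s₂) (hq : Exec W q s₂ u s₃) :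
      Exec W (.seq p q) s₁ (t + u) s₃
  | cond_true {e : Expr} {p q : Prog} {s₁ s₂ : State} {t : ℕ} (he : e.Fits W s₁)
      (h : e.eval s₁ ≠ 0) (hp : Exec W p s₁ t s₂) :
      Exec W (.cond e p q) s₁ (e.cost + 1 + t) s₂
  | cond_false {e : Expr} {p q : Prog} {s₁ s₂ : State} {t : ℕ} (he : e.Fits W s₁)
      (h : e.eval s₁ = 0) (hq : Exec W q s₁ t s₂) :
      Exec W (.cond e p q) s₁ (e.cost + 1 + t) s₂
  | loop_true {e : Expr} {p : Prog} {s₁ s₂ s₃ : State} {t u : ℕ} (he : e.Fits W s₁)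
      (h : e.eval s₁ ≠ 0) (hp : Exec W p s₁ t s₂) (hl : Exec W (.loop e p) s₂ u s₃) :
      Exec W (.loop e p) s₁ (e.cost + 1 + t + u) s₃
  | loop_false {e : Expr} {p : Prog} {s : State} (he : e.Fits W s) (h : e.eval s = 0) :
      Exec W (.loop e p) s (e.cost + 1) s

/-! ### Input, output and running time -/

/-- `adj` is an adjacency list representation of `G`: `adj v` lists the neighbors of `v`, each
once, in any order. -/
def IsAdjList {n : ℕ} (G : SimpleGraph (Fin n)) (adj : Fin n → List (Fin n)) : Prop :=
  ∀ v, (adj v).Nodup ∧ ∀ w, w ∈ adj v ↔ G.Adj v w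

/-- The initial state. Register 0 holds `n` and register 1 holds `k`. Array 1 holds the
concatenation of the adjacency lists of the vertices `0, …, n - 1`, and for `i ≤ n` cell `i` of
array 0 holds the total length of the lists of the vertices below `i`, so that the list of `v`
occupies the cells of array 1 from the `v`-th up to, but excluding, the `(v + 1)`-th of these
numbers. Arrays 2 and 3 hold the characteristic vectors of `C` and `D`. All else is zero. -/
def initState {n : ℕ} (adj : Fin n → List (Fin n)) (C D : Finset (Fin n)) (k : ℕ) : State where
  reg r := if r = 0 then n else if r = 1 then k else 0
  arr a i :=
    if a = 0 then
      if i ≤ n then ∑ u : Fin n with u.val < i, (adj u).length else 0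
    else if a = 1 then ((List.ofFn adj).flatten.map Fin.val).getD i 0
    else if a = 2 then if ∃ v ∈ C, v.val = i then 1 else 0
    else if a = 3 then if ∃ v ∈ D, v.val = i then 1 else 0
    else 0

/-- The state `s` shows the answer `d`: register 0 is zero if `d` is infinite; otherwise register 0
is one and register 1 holds `d`. -/
def Outputs (s : State) (d : ℕ∞) : Prop :=
  (s.reg 0 = 0 ∧ d = ⊤) ∨ (s.reg 0 = 1 ∧ d = (s.reg 1 : ℕ∞))

/-- The size of a graph: the number of vertices plus the number of edges. -/
noncomputable def graphSize {n : ℕ} (G : SimpleGraph (Fin n)) : ℕ :=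
  n + G.edgeSet.ncard

/-- Started in `s`, with all values and addresses and the number of steps bounded by `B`, the
program `p` halts with the answer `d`. -/
def ComputesWithin (B : ℕ) (p : Prog) (s : State) (d : ℕ∞) : Prop :=
  ∃ (t : ℕ) (s' : State), Exec B p s t s' ∧ t ≤ B ∧ Outputs s' d

end CliqueReconf

namespace CliqueReconf

/-! ### Composition of reconfiguration sequences -/

section Sequences

variable {V : Type*} {G : SimpleGraph V} {R : Finset V → Finset V → Prop}

/-! Maximum cardinality search numbers the vertices of a chordal graph so that the earlier neighbors
of every vertex form a clique (`IsMCS.isPEO`). Joining each vertex to its last earlier neighbor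
gives a forest in which all earlier neighbors of a vertex are ancestors of it, and every neighbor
that the subtree of `v` has outside lies in `earlier v` (`IsPEO.separation`).

Suppose that the subtree of `v` meets exactly one of the cliques `C` and `D`. A sequence for token
addition and removal must then enter or leave this subtree at some step. The smaller of the two
cliques at that step lies in `earlier v` and has at least `k` elements. So if `U` collects the
vertices used outside `C ∪ D`, then `U ∪ C ∪ D` has at least `k` elements in each separator `earlier
v` of this kind. Each vertex of `U` is added and removed, so the length is at least `|C △ D| + 2
|U|` (`IsPEO.exists_suffices`). Conversely, every such `U` gives a sequence of at most this length:
a last vertex `z` that belongs to only one clique is eliminated by passing to the part of `U ∪ C ∪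
D` in `earlier z` (`IsPEO.exists_seq`). The distance is therefore `|C △ D| + 2 min |U|`, and it is
infinite exactly if some separator has fewer than `k` elements.

Minimizing `|U|` is an interval problem. Ordered along the forest from `C` to `D`, the separators
that contain a given vertex are consecutive (`IsPEO.consecutive`). Choosing which vertices outside
`C ∪ D` to drop, so that every separator keeps `k` elements, is a packing of intervals with
capacities. The greedy algorithm that treats the intervals by increasing right end is optimal by an
exchange argument (`Packs.exchange`).

A slide of `k` tokens amounts to two steps of addition and removal with threshold `k`, and a jump of
`k + 1` tokens to two steps with the same threshold `k`. The converse translations (`ts_of_tar`,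
`tj_of_tar`) show that the distances are exactly halved.

For linear time, the search keeps buckets of vertices with lazy deletion and is analyzed by a
potential (`runs_searchStep`). The greedy order needs no sorting: the vertices whose interval ends
at a separator are found by scanning the neighbors of its vertex, and each is processed only once
(`sum_visit_cost_le`). Programs are verified by the judgment `Runs`, which combines a time budget, a
bound on the memory contents, a frame condition and a postcondition. -/

theorem HasReconfSeq.refl {C : Finset V} (h : G.IsClique (C : Set V)) :
    HasReconfSeq G R C C 0 :=
  ⟨fun _ => C, rfl, rfl, fun _ _ => h, fun i hi => by omega⟩

theorem HasReconfSeq.cons {C C' D : Finset V} {l : ℕ} (hC : G.IsClique (C : Set V))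
    (hR : R C C') (h : HasReconfSeq G R C' D l) : HasReconfSeq G R C D (l + 1) := by
  obtain ⟨S, h0, hl, hcl, hst⟩ := h
  refine ⟨fun i => Nat.casesOn i C S, rfl, hl, fun i hi => ?_, fun i hi => ?_⟩
  · cases i with
    | zero => exact hC
    | succ i => exact hcl i (by omega)
  · cases i with
    | zero => simpa [h0] using hR
    | succ i => exact hst i (by omega)

theorem HasReconfSeq.eq_of_zero {C D : Finset V} (h : HasReconfSeq G R C D 0) : C = D := by
  obtain ⟨S, h0, hl, -⟩ := h
  rw [← h0, hl]

theorem HasReconfSeq.left_clique {C D : Finset V} {l : ℕ} (h : HasReconfSeq G R C D l) :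
    G.IsClique (C : Set V) := by
  obtain ⟨S, h0, -, hcl, -⟩ := h
  exact h0 ▸ hcl 0 (by omega)

theorem HasReconfSeq.uncons {C D : Finset V} {l : ℕ} (h : HasReconfSeq G R C D (l + 1)) :
    ∃ C', R C C' ∧ HasReconfSeq G R C' D l := by
  obtain ⟨S, h0, hl, hcl, hst⟩ := h
  refine ⟨S 1, h0 ▸ hst 0 (by omega), fun i => S (i + 1), rfl, hl,
    fun i hi => hcl _ (by omega), fun i hi => hst _ (by omega)⟩

theorem HasReconfSeq.trans {C D E : Finset V} {l m : ℕ} (h : HasReconfSeq G R C D l)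
    (h' : HasReconfSeq G R D E m) : HasReconfSeq G R C E (l + m) := by
  induction l generalizing C with
  | zero => simpa [h.eq_of_zero] using h'
  | succ l ih =>
    obtain ⟨C', hR, h2⟩ := h.uncons
    have := HasReconfSeq.cons h.left_clique hR (ih h2)
    convert this using 1
    omega

theorem HasReconfSeq.symm (hs : ∀ C D, R C D → R D C) {C D : Finset V} {l : ℕ}
    (h : HasReconfSeq G R C D l) : HasReconfSeq G R D C l := by
  obtain ⟨S, h0, hl, hcl, hst⟩ := h
  refine ⟨fun i => S (l - i), by simpa using hl, by simpa using h0,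
    fun i _ => hcl _ (by omega), fun i hi => hs _ _ ?_⟩
  have := hst (l - (i + 1)) (by omega)
  rwa [show l - (i + 1) + 1 = l - i by omega] at this

theorem reconfDist_eq_top {C D : Finset V} (h : ∀ l, ¬ HasReconfSeq G R C D l) :
    reconfDist G R C D = ⊤ := by
  simp [reconfDist, h]

theorem reconfDist_eq {C D : Finset V} {l : ℕ} (h : HasReconfSeq G R C D l)
    (hmin : ∀ l', HasReconfSeq G R C D l' → l ≤ l') : reconfDist G R C D = l := by
  apply le_antisymm
  · exact iInf₂_le l h
  · exact le_iInf₂ fun l' h' => by exact_mod_cast hmin l' h'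

theorem card_eq_of_seq (hR : ∀ C D, R C D → #C = #D)
    {C D : Finset V} {l : ℕ} (h : HasReconfSeq G R C D l) : #C = #D := by
  induction l generalizing C with
  | zero => rw [h.eq_of_zero]
  | succ l ih =>
    obtain ⟨C', h1, h2⟩ := h.uncons
    exact (hR _ _ h1).trans (ih h2)

end Sequences

/-! ### Token addition and removal inside one clique -/

section TAR

variable {V : Type*} [DecidableEq V] {G : SimpleGraph V} {k : ℕ}

theorem TARStep.symm {C D : Finset V} (h : TARStep k C D) : TARStep k D C :=
  ⟨h.2.1, h.1, by rw [symmDiff_comm]; exact h.2.2⟩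

theorem TARStep.cases {C D : Finset V} (h : TARStep k C D) :
    (∃ e ∉ C, D = insert e C) ∨ (∃ e ∉ D, C = insert e D) := by
  obtain ⟨e, he⟩ := card_eq_one.1 h.2.2
  have hx : ∀ x, (x ∈ C ∧ x ∉ D ∨ x ∈ D ∧ x ∉ C) ↔ x = e := fun x => by
    rw [← mem_symmDiff, he, mem_singleton]
  by_cases heC : e ∈ C
  · right
    have := (hx e).2 rfl
    refine ⟨e, by tauto, ?_⟩
    ext x
    have := hx x
    rw [mem_insert]
    by_cases hxe : x = e
    · subst hxe; tauto
    · tauto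
  · left
    have := (hx e).2 rfl
    refine ⟨e, by tauto, ?_⟩
    ext x
    have := hx x
    rw [mem_insert]
    by_cases hxe : x = e
    · subst hxe; tauto
    · tauto

theorem symmDiff_insert_self {C : Finset V} {e : V} (he : e ∉ C) :
    symmDiff C (insert e C) = {e} := by
  ext x
  simp only [mem_symmDiff, mem_insert, mem_singleton]
  by_cases hxe : x = e
  · subst hxe; tauto
  · tauto

theorem tarStep_insert {C : Finset V} {e : V} (he : e ∉ C) (hk : k ≤ #C) :
    TARStep k C (insert e C) :=
  ⟨hk, hk.trans (card_le_card (subset_insert _ _)), by rw [symmDiff_insert_self he]; simp⟩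

theorem tar_add {C : Finset V} (hk : k ≤ #C) (E : Finset V) :
    Disjoint C E → G.IsClique ((C ∪ E : Finset V) : Set V) →
      HasReconfSeq G (TARStep k) C (C ∪ E) #E := by
  induction E using Finset.induction_on with
  | empty =>
    intro _ hcl
    simp only [union_empty, card_empty] at hcl ⊢
    exact HasReconfSeq.refl hcl
  | insert e E he ih =>
    intro hd hcl
    rw [disjoint_insert_right] at hd
    rw [union_insert] at hcl ⊢
    rw [card_insert_of_notMem he]
    have hcl' : G.IsClique ((C ∪ E : Finset V) : Set V) :=
      hcl.subset (by exact_mod_cast subset_insert _ _)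
    have h1 := ih hd.2 hcl'
    exact h1.trans (HasReconfSeq.cons hcl'
      (tarStep_insert (by simp [he, hd.1]) (hk.trans (card_le_card subset_union_left)))
      (HasReconfSeq.refl hcl))

theorem card_symmDiff_eq (C D : Finset V) : #(symmDiff C D) = #(D \ C) + #(C \ D) := by
  rw [symmDiff_comm, symmDiff, sup_eq_union, card_union_of_disjoint]
  rw [Finset.disjoint_left]
  intro x
  simp only [mem_sdiff]
  tauto

/-- Going up to `C ∪ D` and down again never passes below the smaller of the two sizes, so the
threshold is respected. -/
theorem tar_within_clique {C D : Finset V} (hC : k ≤ #C) (hD : k ≤ #D)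
    (hcl : G.IsClique ((C ∪ D : Finset V) : Set V)) :
    HasReconfSeq G (TARStep k) C D #(symmDiff C D) := by
  have h1 := tar_add (G := G) hC (D \ C) disjoint_sdiff (by rwa [union_sdiff_self_eq_union])
  have h2 := tar_add (G := G) hD (C \ D) disjoint_sdiff
    (by rwa [union_sdiff_self_eq_union, union_comm])
  rw [union_sdiff_self_eq_union] at h1 h2
  rw [union_comm] at h2
  rw [card_symmDiff_eq]
  exact h1.trans (h2.symm fun _ _ => TARStep.symm)

/-- This is the bookkeeping for one elimination. Passing from `C` to `C'` removes `z` and adds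
vertices of `D` and of `U`. The removal of `z` and the vertices of `D` are steps already counted in
`C △ D`. A vertex of `U` in `C'` is paid for twice, for its addition now and its removal later, and
is taken out of `U`. -/
theorem card_exchange {C C' D U : Finset V} {z : V} (hzC : z ∈ C) (hzC' : z ∉ C') (hzD : z ∉ D)
    (hCC' : ∀ x ∈ C, x ≠ z → x ∈ C') (hC' : ∀ x ∈ C', x ∈ U ∨ x ∈ C ∨ x ∈ D)
    (hU : ∀ x ∈ U, x ∉ C ∧ x ∉ D) :
    #(symmDiff C C') + #(symmDiff C' D) + 2 * #(U \ C') ≤ #(symmDiff C D) + 2 * #U := by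
  have hzU : z ∉ U := fun h => (hU z h).1 hzC
  have e1 : symmDiff C C' = insert z ((C' ∩ D) \ C ∪ (C' ∩ U)) := by
    ext x
    have h1 := hCC' x
    have h2 := hC' x
    have h3 := hU x
    simp only [mem_symmDiff, mem_insert, mem_union, mem_sdiff, mem_inter]
    by_cases hxz : x = z
    · subst hxz; simp [hzC, hzC']
    · by_cases x ∈ C <;> by_cases x ∈ C' <;> by_cases x ∈ D <;> by_cases x ∈ U <;> simp_all
  have e2 : symmDiff C D ∪ (C' ∩ U) = insert z (symmDiff C' D ∪ (C' ∩ D) \ C) := by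
    ext x
    have h1 := hCC' x
    have h2 := hC' x
    have h3 := hU x
    simp only [mem_symmDiff, mem_insert, mem_union, mem_sdiff, mem_inter]
    by_cases hxz : x = z
    · subst hxz; simp [hzC, hzC', hzD]
    · by_cases x ∈ C <;> by_cases x ∈ C' <;> by_cases x ∈ D <;> by_cases x ∈ U <;> simp_all
  have d1 : Disjoint ((C' ∩ D) \ C) (C' ∩ U) := by
    rw [Finset.disjoint_left]
    intro x
    have := hU x
    simp only [mem_sdiff, mem_inter]
    tauto
  have d2 : Disjoint (symmDiff C D) (C' ∩ U) := by
    rw [Finset.disjoint_left]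
    intro x
    have := hU x
    simp only [mem_symmDiff, mem_inter]
    tauto
  have d3 : Disjoint (symmDiff C' D) ((C' ∩ D) \ C) := by
    rw [Finset.disjoint_left]
    intro x
    simp only [mem_symmDiff, mem_inter, mem_sdiff]
    tauto
  have c1 := congrArg card e1
  have c2 := congrArg card e2
  rw [card_insert_of_notMem (by simp [hzC, hzC']), card_union_of_disjoint d1] at c1
  rw [card_insert_of_notMem (by simp [hzC, hzC', hzD, mem_symmDiff]),
    card_union_of_disjoint d2, card_union_of_disjoint d3] at c2
  have c3 : #(U \ C') + #(C' ∩ U) = #U := by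
    rw [inter_comm, card_sdiff_add_card_inter]
  omega

end TAR

/-! ### Elimination tree, separators and the length of a shortest sequence -/

section Elimination

variable {V : Type*} [Fintype V] {G : SimpleGraph V} {pos : V → ℕ}

open Classical in
/-- The neighbors of `v` that precede `v` in the order given by `pos`. -/
noncomputable def earlier (G : SimpleGraph V) (pos : V → ℕ) (v : V) : Finset V :=
  univ.filter fun x => G.Adj x v ∧ pos x < pos v

theorem mem_earlier {x v : V} : x ∈ earlier G pos v ↔ G.Adj x v ∧ pos x < pos v := by
  simp [earlier]

/-- The reverse of `pos` is a perfect elimination ordering. -/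
structure IsPEO (G : SimpleGraph V) (pos : V → ℕ) : Prop where
  inj : Function.Injective pos
  adj : ∀ v x y, x ∈ earlier G pos v → y ∈ earlier G pos v → x ≠ y → G.Adj x y

/-- `p` is the parent of `v` in the elimination tree: its last earlier neighbor. -/
def IsPar (G : SimpleGraph V) (pos : V → ℕ) (p v : V) : Prop :=
  p ∈ earlier G pos v ∧ ∀ x ∈ earlier G pos v, pos x ≤ pos p

/-- `v` is an ancestor of `u` in the elimination tree, or `u` itself. -/
def Anc (G : SimpleGraph V) (pos : V → ℕ) : V → V → Prop :=
  Relation.ReflTransGen (IsPar G pos)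

/-- Some vertex of `C` lies in the subtree of `v`. -/
def Hits (G : SimpleGraph V) (pos : V → ℕ) (v : V) (C : Finset V) : Prop :=
  ∃ c ∈ C, Anc G pos v c

/-- The subtree of `v` meets exactly one of `C` and `D`, so that the earlier neighbors of `v`
separate them. -/
def Separates (G : SimpleGraph V) (pos : V → ℕ) (v : V) (C D : Finset V) : Prop :=
  ¬ (Hits G pos v C ↔ Hits G pos v D)

theorem Anc.pos_le {u v : V} (h : Anc G pos v u) : pos v ≤ pos u := by
  induction h with
  | refl => rfl
  | tail _ h ih => exact ih.trans (mem_earlier.1 h.1).2.le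

theorem IsPEO.isPar_unique (h : IsPEO G pos) {p q v : V} (hp : IsPar G pos p v)
    (hq : IsPar G pos q v) : p = q :=
  h.inj (le_antisymm (hq.2 _ hp.1) (hp.2 _ hq.1))

theorem exists_isPar {x v : V} (hx : x ∈ earlier G pos v) : ∃ p, IsPar G pos p v := by
  obtain ⟨p, hp, hmax⟩ := exists_max_image (earlier G pos v) pos ⟨x, hx⟩
  exact ⟨p, hp, hmax⟩

theorem IsPEO.mem_earlier_of_isPar (h : IsPEO G pos) {p x v : V} (hp : IsPar G pos p v)
    (hx : x ∈ earlier G pos v) (hne : x ≠ p) : x ∈ earlier G pos p := by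
  rw [mem_earlier]
  exact ⟨h.adj v x p hx hp.1 hne, lt_of_le_of_ne (hp.2 x hx) fun e => hne (h.inj e)⟩

/-- An earlier neighbor of `u` is the parent of `u` or, since earlier neighbors are pairwise
adjacent, an earlier neighbor of that parent; continue upwards. -/
theorem IsPEO.anc_of_mem_earlier (h : IsPEO G pos) {x u : V} (hx : x ∈ earlier G pos u) :
    Anc G pos x u := by
  induction hm : pos u using Nat.strong_induction_on generalizing u with
  | _ m ih =>
    obtain ⟨p, hp⟩ := exists_isPar hx
    by_cases hxp : x = p
    · subst hxp
      exact Relation.ReflTransGen.single hp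
    · have h1 := h.mem_earlier_of_isPar hp hx hxp
      exact Relation.ReflTransGen.tail
        (ih (pos p) (hm ▸ (mem_earlier.1 hp.1).2) h1 rfl) hp

/-- The vertex `w` precedes `u`, for otherwise `u` would be an ancestor of `w`. On the way from `u`
up to `v` it stays an earlier neighbor of the current vertex, because it is never the next parent,
which lies in the subtree of `v`. -/
theorem IsPEO.separation (h : IsPEO G pos) {u v w : V} (hu : Anc G pos v u)
    (hw : ¬ Anc G pos v w) (ha : G.Adj u w) : w ∈ earlier G pos v := by
  have hne : pos w ≠ pos u := fun e => ha.ne (h.inj e.symm)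
  have hwu : w ∈ earlier G pos u := by
    rcases lt_or_gt_of_ne hne with hlt | hgt
    · exact mem_earlier.2 ⟨ha.symm, hlt⟩
    · exact absurd (Relation.ReflTransGen.trans hu
        (h.anc_of_mem_earlier (mem_earlier.2 ⟨ha, hgt⟩))) hw
  clear ha hne
  induction hu with
  | refl => exact hwu
  | tail hvb hbc ih =>
    refine ih (h.mem_earlier_of_isPar hbc hwu ?_)
    rintro rfl
    exact hw hvb

/-- Parents are unique, so the ancestors of a vertex form a chain. -/
theorem IsPEO.anc_total (h : IsPEO G pos) {u v w : V} (hu : Anc G pos u w)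
    (hv : Anc G pos v w) : Anc G pos u v ∨ Anc G pos v u := by
  induction hu with
  | refl => exact Or.inr hv
  | tail hub hbc ih =>
    rcases Relation.ReflTransGen.cases_tail hv with rfl | ⟨c, hvc, hcw⟩
    · exact Or.inl (hub.tail hbc)
    · rw [h.isPar_unique hcw hbc] at hvc
      exact ih hvc

theorem separates_comm {v : V} {C D : Finset V} :
    Separates G pos v C D ↔ Separates G pos v D C := by
  unfold Separates
  tauto

variable [DecidableEq V] {k : ℕ}

/-- `U` is a set of auxiliary vertices that suffices for a reconfiguration from `C` to `D`. -/
def Suffices (G : SimpleGraph V) (pos : V → ℕ) (k : ℕ) (C D U : Finset V) : Prop :=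
  Disjoint U (C ∪ D) ∧ ∀ v, Separates G pos v C D → k ≤ #((U ∪ (C ∪ D)) ∩ earlier G pos v)

theorem Suffices.symm {C D U : Finset V} (h : Suffices G pos k C D U) :
    Suffices G pos k D C U := by
  refine ⟨by rw [union_comm D C]; exact h.1, fun v hv => ?_⟩
  rw [union_comm D C]
  exact h.2 v (separates_comm.1 hv)

/-- The only vertex in the subtree of `v` is the new one, `e`. All others are adjacent to it and
outside, so separation applies to each of them. -/
theorem IsPEO.subset_earlier_of_insert (h : IsPEO G pos) {C : Finset V} {e v : V}
    (hcl : G.IsClique ((insert e C : Finset V) : Set V)) (he : Hits G pos v (insert e C))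
    (hC : ¬ Hits G pos v C) : C ⊆ earlier G pos v := by
  intro x hx
  obtain ⟨c, hc, hvc⟩ := he
  have hcC : c ∉ C := fun h' => hC ⟨c, h', hvc⟩
  have hce : c = e := by
    rw [mem_insert] at hc
    tauto
  subst hce
  refine h.separation hvc (fun hx' => hC ⟨x, hx, hx'⟩) (hcl (by simp) (by simp [hx]) ?_)
  rintro rfl
  exact hcC hx

/-- The lower bound, by induction along the sequence. A separator for `C` and `D` either still
separates `C'` and `D`, or it is crossed by the first step and then contains the smaller clique of
this step. An added vertex outside `C ∪ D` may cost two, once here and once for a later removal;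
that removal is accounted for in `C' △ D`. -/
theorem IsPEO.exists_suffices (h : IsPEO G pos) {C D : Finset V} {l : ℕ}
    (hs : HasReconfSeq G (TARStep k) C D l) :
    ∃ U, Suffices G pos k C D U ∧ #(symmDiff C D) + 2 * #U ≤ l := by
  induction l generalizing C with
  | zero =>
    obtain rfl := hs.eq_of_zero
    exact ⟨∅, ⟨by simp, fun v hv => absurd Iff.rfl hv⟩, by simp⟩
  | succ l ih =>
    obtain ⟨C', hR, hs'⟩ := hs.uncons
    obtain ⟨U', ⟨hd, hU⟩, hl⟩ := ih hs'
    -- `U'` avoids `C' ∪ D`, so the vertices of `C'` have to be put back, and those of `C ∪ D` come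
    -- for free.
    refine ⟨(U' ∪ C') \ (C ∪ D), ⟨sdiff_disjoint, fun v hv => ?_⟩, ?_⟩
    · by_cases hv' : Separates G pos v C' D
      · refine (hU v hv').trans (card_le_card (inter_subset_inter_right ?_))
        intro x
        simp only [mem_union, mem_sdiff]
        tauto
      · have hflip : ¬ (Hits G pos v C ↔ Hits G pos v C') := by
          unfold Separates at hv hv'
          tauto
        rcases hR.cases with ⟨e, he, rfl⟩ | ⟨e, he, rfl⟩
        · have hCv : Hits G pos v C → Hits G pos v (insert e C) :=
            fun ⟨c, hc, hvc⟩ => ⟨c, mem_insert_of_mem hc, hvc⟩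
          have := h.subset_earlier_of_insert hs'.left_clique (v := v) (by tauto) (by tauto)
          refine hR.1.trans (card_le_card fun x hx => ?_)
          simp only [mem_union, mem_inter, hx, this hx]
          tauto
        · have hCv : Hits G pos v C' → Hits G pos v (insert e C') :=
            fun ⟨c, hc, hvc⟩ => ⟨c, mem_insert_of_mem hc, hvc⟩
          have := h.subset_earlier_of_insert hs.left_clique (v := v) (by tauto) (by tauto)
          refine hR.2.1.trans (card_le_card fun x hx => ?_)
          simp only [mem_union, mem_inter, hx, this hx, mem_insert]
          tauto
    · rcases hR.cases with ⟨e, he, rfl⟩ | ⟨e, he, rfl⟩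
      · by_cases heD : e ∈ D
        · have h1 : #((U' ∪ insert e C) \ (C ∪ D)) ≤ #U' := card_le_card fun x => by
            simp only [mem_union, mem_sdiff, mem_insert]
            rintro ⟨_ | rfl | _, _⟩ <;> tauto
          have h2 : symmDiff C D = insert e (symmDiff (insert e C) D) := by
            ext x
            simp only [mem_symmDiff, mem_insert]
            by_cases hxe : x = e
            · subst hxe; tauto
            · tauto
          have h3 := card_insert_le e (symmDiff (insert e C) D)
          rw [h2]
          omega
        · have h1 : #((U' ∪ insert e C) \ (C ∪ D)) ≤ #U' + 1 := by
            refine (card_le_card (t := insert e U') fun x => ?_).trans (card_insert_le _ _)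
            simp only [mem_union, mem_sdiff, mem_insert]
            tauto
          have h2 : symmDiff (insert e C) D = insert e (symmDiff C D) := by
            ext x
            simp only [mem_symmDiff, mem_insert]
            by_cases hxe : x = e
            · subst hxe; tauto
            · tauto
          rw [h2, card_insert_of_notMem (by simp [mem_symmDiff, he, heD])] at hl
          omega
      · have h1 : #((U' ∪ C') \ (insert e C' ∪ D)) ≤ #U' := card_le_card fun x => by
          simp only [mem_union, mem_sdiff, mem_insert]
          tauto
        have h2 : symmDiff (insert e C') D ⊆ insert e (symmDiff C' D) := fun x => by
          simp only [mem_symmDiff, mem_insert]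
          by_cases hxe : x = e
          · subst hxe; tauto
          · tauto
        have h3 := (card_le_card h2).trans (card_insert_le _ _)
        omega

theorem earlier_clique (h : IsPEO G pos) (v : V) :
    G.IsClique ((insert v (earlier G pos v) : Finset V) : Set V) := by
  intro x hx y hy hne
  simp only [coe_insert, Set.mem_insert_iff, mem_coe] at hx hy
  rcases hx with rfl | hx <;> rcases hy with rfl | hy
  · exact absurd rfl hne
  · exact (mem_earlier.1 hy).1.symm
  · exact (mem_earlier.1 hx).1
  · exact h.adj v x y hx hy hne

theorem IsPEO.subset_of_last (h : IsPEO G pos) {C : Finset V} {z : V}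
    (hcl : G.IsClique (C : Set V)) (hz : z ∈ C) (hC : ∀ x ∈ C, pos x ≤ pos z) :
    C ⊆ insert z (earlier G pos z) := by
  intro x hx
  rw [mem_insert, or_iff_not_imp_left, mem_earlier]
  exact fun hne => ⟨hcl hx hz hne, lt_of_le_of_ne (hC x hx) fun e => hne (h.inj e)⟩

/-- Only `z` is lost from `U ∪ C ∪ D`, and `z` is too late to belong to `earlier v` if the subtree
of `v` meets `C'` or `D`. If `v` separates `C'` and `D` but not `C` and `D`, then `v` is an ancestor
of `z` whose subtree misses `C'`; in this case `earlier v` contains all of `C'`, which has at least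
`k` elements. -/
theorem IsPEO.suffices_of_last (h : IsPEO G pos) {C C' D U : Finset V} {z : V}
    (hU : Suffices G pos k C D U) (hCsub : C ⊆ insert z (earlier G pos z)) (hzC : z ∈ C)
    (hDz : ∀ x ∈ D, pos x < pos z) (hUz : ∀ x ∈ U, pos x < pos z) (hk' : k ≤ #C')
    (hmem : ∀ x, x ∈ C' ↔ ((x ∈ U ∨ x ∈ C ∨ x ∈ D) ∧ x ∈ earlier G pos z)) :
    Suffices G pos k C' D (U \ C') := by
  have hCmem : ∀ x ∈ C, x ≠ z → x ∈ C' := fun x hx hne =>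
    (hmem x).2 ⟨Or.inr (Or.inl hx), (mem_insert.1 (hCsub hx)).resolve_left hne⟩
  have hunion : ∀ x, (x ∈ U \ C' ∪ (C' ∪ D)) ↔ x ∈ (U ∪ (C ∪ D)).erase z := by
    intro x
    simp only [mem_union, mem_sdiff, mem_erase]
    by_cases hxz : x = z
    · subst hxz
      have h1 : x ∉ U := fun h' => absurd (hUz x h') (by omega)
      have h2 : x ∉ D := fun h' => absurd (hDz x h') (by omega)
      have h3 : x ∉ C' := fun h' => absurd (mem_earlier.1 ((hmem x).1 h').2).2 (by omega)
      simp [h1, h2, h3]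
    · have := hCmem x
      have := hmem x
      tauto
  constructor
  · rw [Finset.disjoint_left]
    intro x hx hx'
    rw [mem_sdiff] at hx
    rw [mem_union] at hx'
    exact Finset.disjoint_left.1 hU.1 hx.1 (by rw [mem_union]; tauto)
  · intro v hv
    have hzv : ∀ w, w ∈ C' ∪ D → Anc G pos v w → z ∉ earlier G pos v := fun w hw hvw hz => by
      have h1 := (mem_earlier.1 hz).2
      have h2 := hvw.pos_le
      rw [mem_union] at hw
      rcases hw with hw | hw
      · have := (mem_earlier.1 ((hmem w).1 hw).2).2
        omega
      · have := hDz w hw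
        omega
    have hzv' : z ∉ earlier G pos v := by
      by_cases h1 : Hits G pos v C'
      · obtain ⟨w, hw, hvw⟩ := h1
        exact hzv w (mem_union_left _ hw) hvw
      · have h2 : Hits G pos v D := by
          unfold Separates at hv
          tauto
        obtain ⟨w, hw, hvw⟩ := h2
        exact hzv w (mem_union_right _ hw) hvw
    have hsub : (U ∪ (C ∪ D)) ∩ earlier G pos v ⊆
        (U \ C' ∪ (C' ∪ D)) ∩ earlier G pos v := by
      intro x hx
      rw [mem_inter] at hx ⊢
      exact ⟨(hunion x).2 (mem_erase.2 ⟨fun e => hzv' (e ▸ hx.2), hx.1⟩), hx.2⟩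
    by_cases hsep : Separates G pos v C D
    · exact (hU.2 v hsep).trans (card_le_card hsub)
    · by_cases hvz : Anc G pos v z
      · have hCv : Hits G pos v C := ⟨z, hzC, hvz⟩
        have hC'v : ¬ Hits G pos v C' := by
          unfold Separates at hsep hv
          tauto
        refine hk'.trans (card_le_card fun x hx => ?_)
        have hxz := ((hmem x).1 hx).2
        rw [mem_inter]
        exact ⟨by simp [hx], h.separation hvz (fun h' => hC'v ⟨x, hx, h'⟩)
          (mem_earlier.1 hxz).1.symm⟩
      · have hCv : ¬ Hits G pos v C := by
          rintro ⟨c, hc, hvc⟩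
          rcases mem_insert.1 (hCsub hc) with rfl | hc'
          · exact hvz hvc
          · exact hvz (Relation.ReflTransGen.trans hvc (h.anc_of_mem_earlier hc'))
        have hC'v : ¬ Hits G pos v C' := by
          rintro ⟨c, hc, hvc⟩
          exact hvz (Relation.ReflTransGen.trans hvc
            (h.anc_of_mem_earlier ((hmem c).1 hc).2))
        unfold Separates at hsep hv
        tauto

/-- A vertex set `U` that suffices yields a reconfiguration sequence: eliminate the last vertex
`z` of `C` by passing to the vertices of `U ∪ C ∪ D` among its earlier neighbors. -/
theorem IsPEO.exists_seq_of_last (h : IsPEO G pos) {C D U : Finset V} {z : V}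
    (hC : G.IsClique (C : Set V)) (hkC : k ≤ #C)
    (hU : Suffices G pos k C D U) (hzC : z ∈ C) (hzD : z ∉ D)
    (hCz : ∀ x ∈ C, pos x ≤ pos z)
    (hDz : ∀ x ∈ D, pos x < pos z) (hUz : ∀ x ∈ U, pos x < pos z)
    (ih : ∀ C' U' : Finset V, (∀ x ∈ C', pos x < pos z) → (∀ x ∈ U', pos x < pos z) →
      G.IsClique (C' : Set V) → k ≤ #C' → Suffices G pos k C' D U' →
      ∃ l ≤ #(symmDiff C' D) + 2 * #U', HasReconfSeq G (TARStep k) C' D l) :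
    ∃ l ≤ #(symmDiff C D) + 2 * #U, HasReconfSeq G (TARStep k) C D l := by
  set C' := (U ∪ (C ∪ D)) ∩ earlier G pos z with hC'
  have hCsub := h.subset_of_last hC hzC hCz
  -- Descendants of `z` do not precede `z`, whereas all of `D` does; so `D` misses the subtree.
  have hzsep : Separates G pos z C D := by
    intro hiff
    obtain ⟨d, hd, hzd⟩ := hiff.1 ⟨z, hzC, Relation.ReflTransGen.refl⟩
    exact absurd hzd.pos_le (by have := hDz d hd; omega)
  have hk' : k ≤ #C' := hU.2 z hzsep
  have hmem : ∀ x, x ∈ C' ↔ ((x ∈ U ∨ x ∈ C ∨ x ∈ D) ∧ x ∈ earlier G pos z) := by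
    simp [hC']
  have hCmem : ∀ x ∈ C, x ≠ z → x ∈ C' := fun x hx hne =>
    (hmem x).2 ⟨Or.inr (Or.inl hx), (mem_insert.1 (hCsub hx)).resolve_left hne⟩
  have hzC' : z ∉ C' := fun h' => absurd (mem_earlier.1 ((hmem z).1 h').2).2 (by omega)
  have hcl : G.IsClique ((C ∪ C' : Finset V) : Set V) := (earlier_clique h z).subset (by
    intro x hx
    rw [mem_coe, mem_union] at hx
    rcases hx with hx | hx
    · exact hCsub hx
    · exact mem_insert_of_mem ((hmem x).1 hx).2)
  have hC'cl : G.IsClique (C' : Set V) := hcl.subset (by exact_mod_cast subset_union_right)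
  have hsuff := h.suffices_of_last hU hCsub hzC hDz hUz hk' hmem
  obtain ⟨l, hl, hseq⟩ := ih C' (U \ C')
    (fun x hx => (mem_earlier.1 ((hmem x).1 hx).2).2)
    (fun x hx => hUz x (mem_sdiff.1 hx).1) hC'cl hk' hsuff
  refine ⟨_, ?_, (tar_within_clique hkC hk' hcl).trans hseq⟩
  have := card_exchange (C := C) (D := D) (U := U) hzC hzC' hzD hCmem
    (fun x hx => ((hmem x).1 hx).1) fun x hx => by
      have := Finset.disjoint_left.1 hU.1 hx
      rw [mem_union] at this
      tauto
  omega

/-- The upper bound, by induction on a bound `m` for all positions that matter. The vertex at the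
last position may lie in both cliques, in exactly one of them, or in neither. -/
theorem IsPEO.exists_seq (h : IsPEO G pos) {C D U : Finset V}
    (hC : G.IsClique (C : Set V)) (hD : G.IsClique (D : Set V)) (hkC : k ≤ #C) (hkD : k ≤ #D)
    (hU : Suffices G pos k C D U) :
    ∃ l ≤ #(symmDiff C D) + 2 * #U, HasReconfSeq G (TARStep k) C D l := by
  obtain ⟨m, hm⟩ : ∃ m, ∀ x, pos x < m := by
    obtain ⟨m, hm⟩ := (Set.finite_range pos).bddAbove
    exact ⟨m + 1, fun x => Nat.lt_succ_of_le (hm ⟨x, rfl⟩)⟩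
  have hCm : ∀ x ∈ C, pos x < m := fun x _ => hm x
  have hDm : ∀ x ∈ D, pos x < m := fun x _ => hm x
  have hUm : ∀ x ∈ U, pos x < m := fun x _ => hm x
  clear hm
  induction m generalizing C D U with
  | zero =>
    obtain rfl : C = ∅ := eq_empty_of_forall_notMem fun x hx => absurd (hCm x hx) (by omega)
    obtain rfl : D = ∅ := eq_empty_of_forall_notMem fun x hx => absurd (hDm x hx) (by omega)
    exact ⟨0, by omega, HasReconfSeq.refl hC⟩
  | succ m ih =>
    have hlt : ∀ (E : Finset V), (∀ x ∈ E, pos x < m + 1) → (∀ x ∈ E, pos x ≠ m) →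
        ∀ x ∈ E, pos x < m := fun E h1 h2 x hx => by
      have := h1 x hx
      have := h2 x hx
      omega
    by_cases hzC : ∃ z ∈ C, pos z = m
    · obtain ⟨z, hzC, rfl⟩ := hzC
      have hCz : ∀ x ∈ C, pos x ≤ pos z := fun x hx => by have := hCm x hx; omega
      by_cases hzD : z ∈ D
      · have hDz : ∀ x ∈ D, pos x ≤ pos z := fun x hx => by have := hDm x hx; omega
        -- Both cliques lie in the clique formed by `z` and its earlier neighbors, so no vertex of
        -- `U` is needed.
        refine ⟨_, by omega, tar_within_clique hkC hkD ((earlier_clique h z).subset ?_)⟩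
        exact_mod_cast union_subset (h.subset_of_last hC hzC hCz) (h.subset_of_last hD hzD hDz)
      · have hDz := hlt D hDm fun x hx e => hzD (h.inj e ▸ hx)
        have hUz := hlt U hUm fun x hx e =>
          Finset.disjoint_left.1 hU.1 (h.inj e ▸ hx) (mem_union_left _ hzC)
        exact h.exists_seq_of_last hC hkC hU hzC hzD hCz hDz hUz
          fun C' U' h1 h2 h3 h4 h5 => ih h3 hD h4 hkD h5 h1 hDz h2
    · push Not at hzC
      have hCz := hlt C hCm hzC
      by_cases hzD : ∃ z ∈ D, pos z = m
      · obtain ⟨z, hzD, rfl⟩ := hzD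
        have hDz : ∀ x ∈ D, pos x ≤ pos z := fun x hx => by have := hDm x hx; omega
        have hUz := hlt U hUm fun x hx e =>
          Finset.disjoint_left.1 hU.1 (h.inj e ▸ hx) (mem_union_right _ hzD)
        obtain ⟨l, hl, hs⟩ := h.exists_seq_of_last hD hkD hU.symm hzD
          (fun h' => hzC z h' rfl) hDz hCz hUz
          (fun C' U' h1 h2 h3 h4 h5 => by
            obtain ⟨l, hl, hs⟩ := ih hC h3 hkC h4 h5.symm hCz h1 h2
            rw [symmDiff_comm] at hl
            exact ⟨l, hl, hs.symm fun _ _ => TARStep.symm⟩)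
        rw [symmDiff_comm] at hl
        exact ⟨l, hl, hs.symm fun _ _ => TARStep.symm⟩
      · push Not at hzD
        have hDz := hlt D hDm hzD
        -- A vertex `v` that separates is an ancestor of a vertex of `C ∪ D`, so it lies before
        -- position `m`, and so do its earlier neighbors. A vertex of `U` at position `m` is
        -- useless.
        have hsuff : Suffices G pos k C D (U.filter fun x => pos x < m) := by
          refine ⟨Finset.disjoint_of_subset_left (filter_subset _ _) hU.1, fun v hv => ?_⟩
          have hvm : pos v < m := by
            by_cases h1 : Hits G pos v C
            · obtain ⟨w, hw, hvw⟩ := h1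
              exact hvw.pos_le.trans_lt (hCz w hw)
            · have h2 : Hits G pos v D := by
                unfold Separates at hv
                tauto
              obtain ⟨w, hw, hvw⟩ := h2
              exact hvw.pos_le.trans_lt (hDz w hw)
          refine (hU.2 v hv).trans (card_le_card fun x hx => ?_)
          have := (mem_earlier.1 (mem_inter.1 hx).2).2
          have hxm : pos x < m := by omega
          simp only [mem_inter, mem_union, mem_filter, hxm, and_true] at hx ⊢
          exact hx
        obtain ⟨l, hl, hs⟩ := ih hC hD hkC hkD hsuff hCz hDz
          (fun x hx => (mem_filter.1 hx).2)
        have := card_le_card (filter_subset (fun x => pos x < m) U)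
        exact ⟨l, by omega, hs⟩

end Elimination

/-! ### Sliding and jumping as two steps of addition and removal -/

section Tokens

variable {V : Type*} [DecidableEq V] {G : SimpleGraph V} {k : ℕ}

theorem TJStep.exists_swap {C D : Finset V} (h : TJStep C D) :
    ∃ v w, v ∈ C ∧ w ∉ C ∧ D = insert w (C.erase v) := by
  obtain ⟨-, h1, h2⟩ := h
  obtain ⟨v, hv⟩ := card_eq_one.1 h1
  obtain ⟨w, hw⟩ := card_eq_one.1 h2
  have h1' : ∀ x, (x ∈ C ∧ x ∉ D) ↔ x = v := fun x => by rw [← mem_sdiff, hv, mem_singleton]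
  have h2' : ∀ x, (x ∈ D ∧ x ∉ C) ↔ x = w := fun x => by rw [← mem_sdiff, hw, mem_singleton]
  refine ⟨v, w, ((h1' v).2 rfl).1, ((h2' w).2 rfl).2, ?_⟩
  ext x
  have := h1' x
  have := h2' x
  simp only [mem_insert, mem_erase]
  tauto

theorem sdiff_swap {C : Finset V} {v w : V} (hv : v ∈ C) (hw : w ∉ C) :
    C \ insert w (C.erase v) = {v} ∧ insert w (C.erase v) \ C = {w} ∧
      #C = #(insert w (C.erase v)) := by
  have hne : w ≠ v := fun h => hw (h ▸ hv)
  refine ⟨?_, ?_, ?_⟩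
  · ext x
    simp only [mem_sdiff, mem_insert, mem_erase, mem_singleton]
    by_cases hx : x = v
    · subst hx; simp [hv, hne.symm]
    · by_cases x ∈ C <;> simp_all
  · ext x
    simp only [mem_sdiff, mem_insert, mem_erase, mem_singleton]
    by_cases hx : x = w
    · subst hx; simp [hw]
    · by_cases x ∈ C <;> simp_all
  · rw [card_insert_of_notMem (by simp [hw]), card_erase_of_mem hv]
    have := card_pos.2 ⟨v, hv⟩
    omega

theorem tjStep_swap {C : Finset V} {v w : V} (hv : v ∈ C) (hw : w ∉ C) :
    TJStep C (insert w (C.erase v)) := by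
  obtain ⟨h1, h2, h3⟩ := sdiff_swap hv hw
  exact ⟨h3, by rw [h1, card_singleton], by rw [h2, card_singleton]⟩

theorem TSStep.tjStep {C D : Finset V} (h : TSStep G C D) : TJStep C D := by
  obtain ⟨h, v, w, hv, hw, -⟩ := h
  exact ⟨h, by rw [hv, card_singleton], by rw [hw, card_singleton]⟩

/-- Two vertices of the union of consecutive cliques lie in a common one, unless they are the ends
of the slide, which are adjacent. So the union is a clique, and a slide is an addition followed by a
removal, without going below `#C`. -/
theorem tar_of_ts {C D : Finset V} {l : ℕ} (h : HasReconfSeq G (TSStep G) C D l) :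
    HasReconfSeq G (TARStep #C) C D (2 * l) := by
  induction l generalizing C with
  | zero =>
    obtain rfl := h.eq_of_zero
    exact HasReconfSeq.refl h.left_clique
  | succ l ih =>
    obtain ⟨C', h1, h2⟩ := h.uncons
    have h3 := ih h2
    rw [← h1.1] at h3
    have hu : G.IsClique ((C ∪ C' : Finset V) : Set V) := by
      obtain ⟨-, v, w, hv, hw, hvw⟩ := h1
      have h1' : ∀ x, (x ∈ C ∧ x ∉ C') ↔ x = v := fun x => by
        rw [← mem_sdiff, hv, mem_singleton]
      have h2' : ∀ x, (x ∈ C' ∧ x ∉ C) ↔ x = w := fun x => by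
        rw [← mem_sdiff, hw, mem_singleton]
      have hC := h.left_clique
      have hC' := h2.left_clique
      intro x hx y hy hne
      rw [mem_coe, mem_union] at hx hy
      by_cases hxC : x ∈ C
      · by_cases hyC : y ∈ C
        · exact hC hxC hyC hne
        · by_cases hxC' : x ∈ C'
          · exact hC' hxC' (hy.resolve_left hyC) hne
          · rw [(h1' x).1 ⟨hxC, hxC'⟩, (h2' y).1 ⟨hy.resolve_left hyC, hyC⟩]
            exact hvw
      · have hxC' := hx.resolve_left hxC
        by_cases hyC' : y ∈ C'
        · exact hC' hxC' hyC' hne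
        · rw [(h2' x).1 ⟨hxC', hxC⟩, (h1' y).1 ⟨hy.resolve_right hyC', hyC'⟩]
          exact hvw.symm
    have h4 := (tar_within_clique (le_refl #C) h1.1.le hu).trans h3
    have h5 : #(symmDiff C C') = 2 := by
      rw [card_symmDiff_eq, h1.tjStep.2.1, h1.tjStep.2.2]
    rw [h5] at h4
    convert h4 using 1
    ring

/-- The ends of a jump need not be adjacent, so the removal has to come before the addition; this is
why the threshold is one lower. -/
theorem tar_of_tj {C D : Finset V} {l : ℕ} (h : HasReconfSeq G TJStep C D l) :
    HasReconfSeq G (TARStep (#C - 1)) C D (2 * l) := by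
  induction l generalizing C with
  | zero =>
    obtain rfl := h.eq_of_zero
    exact HasReconfSeq.refl h.left_clique
  | succ l ih =>
    obtain ⟨C', h1, h2⟩ := h.uncons
    have h3 := ih h2
    rw [← h1.1] at h3
    obtain ⟨v, w, hv, hw, rfl⟩ := h1.exists_swap
    have hk : #C - 1 ≤ #(C.erase v) := by rw [card_erase_of_mem hv]
    have e1 : TARStep (#C - 1) C (C.erase v) := by
      have := tarStep_insert (notMem_erase v C) hk
      rw [insert_erase hv] at this
      exact this.symm
    exact (h3.cons (h.left_clique.subset (by exact_mod_cast erase_subset v C))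
      (tarStep_insert (by simp [hw]) hk)).cons h.left_clique e1

/-- A subset `K` of size `k` is carried along. It moves only if one of its vertices is removed: the
smaller clique still has `k` elements, hence one outside `K` to slide to, adjacent because both are
in `C`. The quantity `l + (#C - k)` is unchanged by an addition and drops by two at a removal, which
pays for the slide. -/
theorem ts_of_tar {C D K : Finset V} {l : ℕ} (h : HasReconfSeq G (TARStep k) C D l)
    (hKC : K ⊆ C) (hK : #K = k) (hD : #D = k) :
    ∃ l', 2 * l' ≤ l + (#C - k) ∧ HasReconfSeq G (TSStep G) K D l' := by
  induction l generalizing C K with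
  | zero =>
    obtain rfl := h.eq_of_zero
    obtain rfl := eq_of_subset_of_card_le hKC (by omega)
    exact ⟨0, by omega, HasReconfSeq.refl h.left_clique⟩
  | succ l ih =>
    obtain ⟨C', h1, h2⟩ := h.uncons
    rcases h1.cases with ⟨e, he, rfl⟩ | ⟨e, he, rfl⟩
    · obtain ⟨l', hl', hs⟩ := ih h2 (hKC.trans (subset_insert _ _)) hK
      rw [card_insert_of_notMem he] at hl'
      exact ⟨l', by omega, hs⟩
    · have hk := h1.2.1
      rw [card_insert_of_notMem he]
      by_cases heK : e ∈ K
      · obtain ⟨y, hy, hyK⟩ : ∃ y ∈ C', y ∉ K := by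
          by_contra! hcon
          have := card_le_card (insert_subset heK hcon)
          rw [card_insert_of_notMem he] at this
          omega
        have hsub : insert y (K.erase e) ⊆ C' := by
          intro x hx
          rcases mem_insert.1 hx with rfl | hx
          · exact hy
          · exact (mem_insert.1 (hKC (mem_erase.1 hx).2)).resolve_left (mem_erase.1 hx).1
        obtain ⟨g1, g2, g3⟩ := sdiff_swap heK hyK
        obtain ⟨l', hl', hs⟩ := ih h2 hsub (by omega)
        have hcl := h.left_clique
        refine ⟨l' + 1, by omega, hs.cons (hcl.subset (by exact_mod_cast hKC))
          ⟨g3, e, y, g1, g2, hcl (by simp) (by simp [hy]) ?_⟩⟩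
        rintro rfl
        exact he hy
      · obtain ⟨l', hl', hs⟩ := ih h2 ((subset_insert_iff_of_notMem heK).1 hKC) hK
        exact ⟨l', by omega, hs⟩

/-- A clique `K` of size `k + 1` is carried along, below `C` if `C` is large enough and above `C` if
`#C = k`. The potential is `l` plus the distance of `#C` from `k + 1`. It drops by two at a step
towards size `k + 1`, the only kind of step at which a jump may be needed, and is unchanged by a
step away from it. -/
theorem tj_of_tar {C D K : Finset V} {l : ℕ} (h : HasReconfSeq G (TARStep k) C D l)
    (hKcl : G.IsClique (K : Set V)) (hK : #K = k + 1) (hD : #D = k + 1)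
    (hKC : (k + 1 ≤ #C ∧ K ⊆ C) ∨ (#C = k ∧ C ⊆ K)) :
    ∃ l', 2 * l' ≤ l + (#C - (k + 1)) + (k + 1 - #C) ∧ HasReconfSeq G TJStep K D l' := by
  induction l generalizing C K with
  | zero =>
    obtain rfl := h.eq_of_zero
    rcases hKC with ⟨-, hKC⟩ | ⟨hC, -⟩
    · obtain rfl := eq_of_subset_of_card_le hKC (by omega)
      exact ⟨0, by omega, HasReconfSeq.refl h.left_clique⟩
    · omega
  | succ l ih =>
    obtain ⟨C', h1, h2⟩ := h.uncons
    rcases h1.cases with ⟨e, he, rfl⟩ | ⟨e, he, rfl⟩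
    · have hce := card_insert_of_notMem he
      rcases hKC with ⟨hC, hKC⟩ | ⟨hC, hCK⟩
      · obtain ⟨l', hl', hs⟩ := ih h2 hKcl hK
          (Or.inl ⟨by omega, hKC.trans (subset_insert _ _)⟩)
        exact ⟨l', by omega, hs⟩
      · by_cases heK : e ∈ K
        · have heq : insert e C = K := eq_of_subset_of_card_le (insert_subset heK hCK) (by omega)
          obtain ⟨l', hl', hs⟩ := ih h2 hKcl hK (Or.inl ⟨by omega, heq.ge⟩)
          exact ⟨l', by omega, hs⟩
        · obtain ⟨l', hl', hs⟩ := ih h2 h2.left_clique (by omega) (Or.inl ⟨by omega, subset_rfl⟩)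
          obtain ⟨z, hz, hzC⟩ : ∃ z ∈ K, z ∉ C := by
            by_contra! hcon
            have := card_le_card (show K ⊆ C from hcon)
            omega
          have heq : C = K.erase z := eq_of_subset_of_card_le
            (subset_erase.2 ⟨hCK, hzC⟩) (by rw [card_erase_of_mem hz]; omega)
          refine ⟨l' + 1, by omega, hs.cons hKcl ?_⟩
          rw [heq]
          exact tjStep_swap hz heK
    · have hce := card_insert_of_notMem he
      have hk := h1.2.1
      rcases hKC with ⟨hC, hKC⟩ | ⟨hC, hCK⟩
      · by_cases heK : e ∈ K
        · by_cases hC' : k + 1 ≤ #C'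
          · obtain ⟨y, hy, hyK⟩ : ∃ y ∈ C', y ∉ K := by
              by_contra! hcon
              have := card_le_card (insert_subset heK hcon)
              omega
            have hsub : insert y (K.erase e) ⊆ C' := by
              intro x hx
              rcases mem_insert.1 hx with rfl | hx
              · exact hy
              · exact (mem_insert.1 (hKC (mem_erase.1 hx).2)).resolve_left (mem_erase.1 hx).1
            obtain ⟨-, -, g3⟩ := sdiff_swap heK hyK
            obtain ⟨l', hl', hs⟩ := ih h2 (h2.left_clique.subset (by exact_mod_cast hsub))
              (by omega) (Or.inl ⟨hC', hsub⟩)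
            exact ⟨l' + 1, by omega, hs.cons hKcl (tjStep_swap heK hyK)⟩
          · have heq : K = insert e C' := eq_of_subset_of_card_le hKC (by omega)
            obtain ⟨l', hl', hs⟩ := ih h2 hKcl hK
              (Or.inr ⟨by omega, heq ▸ subset_insert _ _⟩)
            exact ⟨l', by omega, hs⟩
        · have hKC' := (subset_insert_iff_of_notMem heK).1 hKC
          have := card_le_card hKC'
          obtain ⟨l', hl', hs⟩ := ih h2 hKcl hK (Or.inl ⟨by omega, hKC'⟩)
          exact ⟨l', by omega, hs⟩
      · omega

end Tokens

/-! ### Maximum cardinality search on chordal graphs -/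

section MaximumCardinality

variable {V : Type*} {G : SimpleGraph V} {pos : V → ℕ}

/-- `p 0, …, p k` is an induced path. -/
def IsInducedPath (G : SimpleGraph V) (p : ℕ → V) (k : ℕ) : Prop :=
  ∀ i j, i ≤ k → j ≤ k → (p i = p j → i = j) ∧ (G.Adj (p i) (p j) ↔ (i + 1 = j ∨ j + 1 = i))

theorem IsInducedPath.reverse {p : ℕ → V} {k : ℕ} (h : IsInducedPath G p k) :
    IsInducedPath G (fun i => p (k - i)) k := by
  intro i j hi hj
  have := h (k - i) (k - j) (by omega) (by omega)
  refine ⟨fun e => ?_, ?_⟩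
  · have := this.1 e
    omega
  · rw [this.2]
    omega

/-- An induced path with an extra vertex that is adjacent to no path vertex but the last. -/
theorem IsInducedPath.snoc {p : ℕ → V} {k : ℕ} (h : IsInducedPath G p k) {x : V}
    (hx : ∀ i ≤ k, G.Adj x (p i) ↔ i = k) (hxk : ∀ i ≤ k, x ≠ p i) :
    IsInducedPath G (fun i => if i ≤ k then p i else x) (k + 1) := by
  intro i j hi hj
  by_cases hik : i ≤ k <;> by_cases hjk : j ≤ k
  · simpa [hik, hjk] using h i j hik hjk
  · simp only [hik, hjk, if_true, if_false]
    refine ⟨fun e => absurd e.symm (hxk i hik), ?_⟩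
    rw [G.adj_comm, hx i hik]
    omega
  · simp only [hik, hjk, if_true, if_false]
    refine ⟨fun e => absurd e (hxk j hjk), ?_⟩
    rw [hx j hjk]
    omega
  · simp only [hik, hjk, if_false, SimpleGraph.irrefl, false_iff]
    omega

theorem IsChordal.not_close {p : ℕ → V} {k : ℕ} (hG : IsChordal G) (h : IsInducedPath G p k)
    (hk : 2 ≤ k) {x : V} (hx : ∀ i ≤ k, G.Adj x (p i) ↔ (i = 0 ∨ i = k))
    (hxk : ∀ i ≤ k, x ≠ p i) : False := by
  refine (hG (k + 2) (by omega)).false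
    ⟨⟨fun i => if i.val ≤ k then p i.val else x, fun i j hij => ?_⟩, fun {i j} => ?_⟩
  · dsimp only at hij
    apply Fin.ext
    split_ifs at hij with h1 h2 h2
    · exact (h _ _ h1 h2).1 hij
    · exact absurd hij.symm (hxk _ h1)
    · exact absurd hij (hxk _ h2)
    · omega
  · change G.Adj (if i.val ≤ k then p i.val else x) (if j.val ≤ k then p j.val else x) ↔ _
    have hadj : (SimpleGraph.cycleGraph (k + 2)).Adj i j ↔
        (i.val + 1 = j.val ∨ j.val + 1 = i.val ∨ (i.val = 0 ∧ j.val = k + 1) ∨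
          (j.val = 0 ∧ i.val = k + 1)) := by
      rw [SimpleGraph.cycleGraph_adj]
      -- The difference is taken modulo `k + 2`; the wrap gives the two edges at the vertex that
      -- closes the cycle.
      have e1 : ∀ a b : Fin (k + 2), a - b = 1 ↔
          (b.val + 1 = a.val ∨ (a.val = 0 ∧ b.val = k + 1)) := by
        intro a b
        rw [Fin.ext_iff, Fin.sub_def]
        have ha := a.isLt
        have hb := b.isLt
        simp only [Fin.val_one]
        rcases Nat.lt_or_ge a.val b.val with hlt | hge
        · rw [Nat.mod_eq_of_lt (by omega)]
          omega
        · rw [show k + 2 - b.val + a.val = (a.val - b.val) + (k + 2) by omega,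
            Nat.add_mod_right, Nat.mod_eq_of_lt (by omega)]
          omega
      rw [e1, e1]
      tauto
    rw [hadj]
    have hi := i.isLt
    have hj := j.isLt
    split_ifs with h1 h2 h2
    · rw [(h _ _ h1 h2).2]
      omega
    · rw [G.adj_comm, hx _ h1]
      omega
    · rw [hx _ h2]
      omega
    · simp only [SimpleGraph.irrefl, false_iff]
      omega

/-- Among the vertices that are not before `b`, the vertex `b` has the most neighbors before
`b`. -/
def IsMCS [Fintype V] (G : SimpleGraph V) (pos : V → ℕ) : Prop :=
  ∀ b c, pos b < pos c → ∀ a, pos a < pos b → G.Adj a c → ¬ G.Adj a b →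
    ∃ d, pos d < pos b ∧ G.Adj d b ∧ ¬ G.Adj d c

/-- There is no induced path whose interior comes after both of its ends. The vertex `p k` comes
before `p 1` and misses its neighbor `p 0`, so it has an earlier neighbor `x` that `p 1` misses. Let
`j ≥ 2` be the first index with `x` adjacent to `p j`. If `x` is adjacent to `p 0`, then `x, p 0, …,
p j` is an induced cycle of length at least four. Otherwise `p 0, …, p j, x` is again such a path,
and its later end precedes `p k`, so induction on the position of the later end applies. -/
theorem IsMCS.no_path [Fintype V] (hG : IsChordal G) (hinj : Function.Injective pos)
    (hm : IsMCS G pos) (m : ℕ) : ∀ (p : ℕ → V) (k : ℕ), IsInducedPath G p k → 2 ≤ k →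
      pos (p 0) < pos (p k) → pos (p k) = m → (∀ i, 0 < i → i < k → m < pos (p i)) → False := by
  induction m using Nat.strong_induction_on with
  | _ m ih =>
    intro p k hp hk h0k hkm hint
    have hge : ∀ i, 0 < i → i ≤ k → m ≤ pos (p i) := fun i h0 hi => by
      rcases Nat.lt_or_ge i k with h | h
      · exact (hint i h0 h).le
      · obtain rfl : i = k := by omega
        exact hkm.ge
    obtain ⟨x, hx1, hx2, hx3⟩ := hm (p k) (p 1) (hkm ▸ hint 1 (by omega) (by omega)) (p 0) h0k
      (((hp 0 1 (by omega) (by omega)).2).2 (by omega))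
      (fun h' => by have := ((hp 0 k (by omega) (by omega)).2).1 h'; omega)
    have hxne : ∀ i, 0 < i → i ≤ k → x ≠ p i := fun i h1 h2 e => by
      have := hge i h1 h2
      rw [← e] at this
      omega
    have hx0 : x ≠ p 0 := by
      rintro rfl
      have := ((hp 0 k (by omega) (by omega)).2).1 hx2
      omega
    classical
    have hex : ∃ j, 2 ≤ j ∧ G.Adj x (p j) := ⟨k, hk, hx2⟩
    set j := Nat.find hex with hj
    have hj2 : 2 ≤ j := (Nat.find_spec hex).1
    have hjx : G.Adj x (p j) := (Nat.find_spec hex).2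
    have hjk : j ≤ k := Nat.find_min' hex ⟨hk, hx2⟩
    have hjmin : ∀ i, 0 < i → i < j → ¬ G.Adj x (p i) := fun i h0 hi h' => by
      rcases Nat.lt_or_ge i 2 with h2 | h2
      · obtain rfl : i = 1 := by omega
        exact hx3 h'
      · exact Nat.find_min hex hi ⟨h2, h'⟩
    have hpj : IsInducedPath G p j := fun a b ha hb => hp a b (by omega) (by omega)
    have hxk : ∀ i ≤ j, x ≠ p i := fun i hi => by
      rcases Nat.eq_zero_or_pos i with rfl | h0
      · exact hx0
      · exact hxne i h0 (by omega)
    by_cases hx0' : G.Adj x (p 0)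
    · refine hG.not_close hpj hj2 (x := x) (fun i hi => ⟨fun h' => ?_, ?_⟩) hxk
      · by_contra hcon
        exact hjmin i (by omega) (by omega) h'
      · rintro (rfl | rfl)
        · exact hx0'
        · exact hjx
    · have hq : IsInducedPath G (fun i => if i ≤ j then p i else x) (j + 1) := by
        refine hpj.snoc (fun i hi => ⟨fun h' => ?_, ?_⟩) hxk
        · by_contra hcon
          rcases Nat.eq_zero_or_pos i with rfl | h0
          · exact hx0' h'
          · exact hjmin i h0 (by omega) h'
        · rintro rfl
          exact hjx
      rcases lt_or_gt_of_ne (fun e => hx0 (hinj e)) with hlt | hgt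
      · refine ih (pos (p 0)) (by omega) _ _ hq.reverse (by omega) (by simpa using hlt)
          (by simp) (fun i h0 hi => ?_)
        have : j + 1 - i ≤ j := by omega
        simp only [this, if_true]
        have := hge (j + 1 - i) (by omega) (by omega)
        omega
      · refine ih (pos x) (by omega) _ _ hq (by omega) (by simpa using hgt)
          (by simp) (fun i h0 hi => ?_)
        have : i ≤ j := by omega
        simp only [this, if_true]
        have := hge i h0 (by omega)
        omega

/-- On a chordal graph, maximum cardinality search finds a perfect elimination ordering. -/
theorem IsMCS.isPEO [Fintype V] (hG : IsChordal G) (hinj : Function.Injective pos)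
    (hm : IsMCS G pos) : IsPEO G pos := by
  refine ⟨hinj, ?_⟩
  have key : ∀ v x y, x ∈ earlier G pos v → y ∈ earlier G pos v → pos x < pos y →
      G.Adj x y := by
    intro v x y hx hy hlt
    rw [mem_earlier] at hx hy
    by_contra hn
    have hxy : x ≠ y := by rintro rfl; omega
    -- Nonadjacent earlier neighbors `x` and `y` of `v` would make `x, v, y` such a path.
    refine hm.no_path hG hinj (pos y)
      (fun i => if i = 0 then x else if i = 1 then v else y) 2 ?_ le_rfl
      (by simpa using hlt) (by simp) (fun i h0 hi => ?_)
    · have hn' : ¬ G.Adj y x := fun h => hn h.symm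
      have h1 := hx.1.ne
      have h2 := hy.1.ne
      have h3 := hx.1
      have h4 := hy.1
      intro i j hi hj
      interval_cases i <;> interval_cases j <;>
        simp [hxy, hxy.symm, h1, h2, h1.symm, h2.symm, h3, h4, h3.symm, h4.symm, hn, hn']
    · obtain rfl : i = 1 := by omega
      simpa using hy.2
  intro v x y hx hy hne
  rcases lt_or_gt_of_ne (fun e => hne (hinj e)) with h | h
  · exact key v x y hx hy h
  · exact (key v y x hy hx h).symm

end MaximumCardinality

/-! ### Separators as intervals and the greedy packing -/

section Greedy

variable {V : Type*} [Fintype V] [DecidableEq V] {G : SimpleGraph V} {pos key cap last : V → ℕ}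
  {n k : ℕ} {C D F : Finset V}

open Classical in
/-- The position of `v` among the vertices that separate `C` and `D`, on the way from `C` to `D`;
it is zero for all other vertices. -/
noncomputable def sepKey (G : SimpleGraph V) (pos : V → ℕ) (n : ℕ) (C D : Finset V) (v : V) : ℕ :=
  if Hits G pos v C then if Hits G pos v D then 0 else n - pos v
  else if Hits G pos v D then n + 1 + pos v else 0

omit [DecidableEq V] in
theorem sepKey_ne_zero (hn : ∀ v, pos v < n) {v : V} :
    sepKey G pos n C D v ≠ 0 ↔ Separates G pos v C D := by
  have := hn v
  unfold sepKey Separates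
  by_cases h1 : Hits G pos v C <;> by_cases h2 : Hits G pos v D <;> simp [h1, h2]
  omega

omit [DecidableEq V] in
-- Nonzero keys are at most `n` on the side of `C` and larger than `n` on the side of `D`; on each
-- side they determine the position.
theorem sepKey_injective (hn : ∀ v, pos v < n) (hinj : Function.Injective pos) {u v : V}
    (h0 : sepKey G pos n C D u ≠ 0) (h : sepKey G pos n C D u = sepKey G pos n C D v) : u = v := by
  have := hn u
  have := hn v
  apply hinj
  unfold sepKey at h h0
  split_ifs at h h0 <;> omega

omit [DecidableEq V] in
theorem sepKey_le (hn : ∀ v, pos v < n) (v : V) : sepKey G pos n C D v ≤ 2 * n := by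
  have := hn v
  unfold sepKey
  split_ifs <;> omega

omit [DecidableEq V] in
-- Of two vertices of a clique, the earlier is an ancestor of the later. So `u` and `v` have a
-- common descendant and are comparable.
theorem IsPEO.anc_of_hits (h : IsPEO G pos) (hC : G.IsClique (C : Set V)) {u v : V}
    (hu : Hits G pos u C) (hv : Hits G pos v C) (hle : pos v ≤ pos u) : Anc G pos v u := by
  obtain ⟨c, hc, huc⟩ := hu
  obtain ⟨d, hd, hvd⟩ := hv
  have key : ∃ w, Anc G pos u w ∧ Anc G pos v w := by
    by_cases hcd : c = d
    · subst hcd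
      exact ⟨c, huc, hvd⟩
    · have ha := hC hc hd hcd
      rcases lt_or_gt_of_ne (fun e => hcd (h.inj e)) with hlt | hgt
      · exact ⟨d, Relation.ReflTransGen.trans huc
          (h.anc_of_mem_earlier (mem_earlier.2 ⟨ha, hlt⟩)), hvd⟩
      · exact ⟨c, huc, Relation.ReflTransGen.trans hvd
          (h.anc_of_mem_earlier (mem_earlier.2 ⟨ha.symm, hgt⟩))⟩
  obtain ⟨w, huw, hvw⟩ := key
  rcases h.anc_total huw hvw with h1 | h1
  · have := h1.pos_le
    rw [h.inj (le_antisymm this hle)]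
    exact Relation.ReflTransGen.refl
  · exact h1

/-- The separators that contain a vertex are consecutive. -/
def Consecutive (G : SimpleGraph V) (pos key : V → ℕ) : Prop :=
  ∀ x y₁ y y₂, key y₁ ≠ 0 → x ∈ earlier G pos y₁ → x ∈ earlier G pos y₂ → key y₁ ≤ key y →
    key y ≤ key y₂ → x ∈ earlier G pos y

omit [DecidableEq V] in
-- Let `y` be on the side of `C`. Then so is `y₁`, and it lies in the subtree of `y`. As `x` is
-- adjacent to `y₁`, it belongs to `earlier y` unless it lies in the subtree of `y` itself. In that
-- case `y₂` is a proper descendant of `y`, which is impossible for a later separator: it would make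
-- `y` hit `D`, or have a smaller key than `y`. The side of `D` is symmetric.
theorem IsPEO.consecutive (h : IsPEO G pos) (hn : ∀ v, pos v < n) (hC : G.IsClique (C : Set V))
    (hD : G.IsClique (D : Set V)) : Consecutive G pos (sepKey G pos n C D) := by
  intro x y₁ y y₂ h0 h1 h2 hle1 hle2
  have p1 := hn y₁
  have p := hn y
  have p2 := hn y₂
  have l1 := mem_earlier.1 h1
  have l2 := mem_earlier.1 h2
  have hits : ∀ {u v E}, Anc G pos u v → Hits G pos v E → Hits G pos u E :=
    fun huv ⟨c, hc, hvc⟩ => ⟨c, hc, Relation.ReflTransGen.trans huv hvc⟩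
  have anc : ∀ {z}, x ∈ earlier G pos z → Anc G pos y x → Anc G pos y z := fun hz hy =>
    Relation.ReflTransGen.trans hy (h.anc_of_mem_earlier hz)
  by_cases hyC : Hits G pos y C
  · by_cases hyD : Hits G pos y D
    · simp only [sepKey, hyC, hyD, if_true] at hle1
      exact absurd (Nat.le_zero.1 hle1) h0
    · have h1C : Hits G pos y₁ C ∧ pos y ≤ pos y₁ := by
        simp only [sepKey, hyC, hyD, if_true, if_false] at hle1 h0
        split_ifs at hle1 h0 <;> first | omega | exact ⟨by assumption, by omega⟩
      refine h.separation (h.anc_of_hits hC h1C.1 hyC h1C.2) (fun hyx => ?_) l1.1.symm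
      by_cases h2D : Hits G pos y₂ D
      · exact hyD (hits (anc h2 hyx) h2D)
      · have : pos y₂ ≤ pos y := by
          simp only [sepKey, hyC, hyD, h2D, if_true, if_false] at hle2
          split_ifs at hle2 <;> omega
        have := hyx.pos_le
        omega
  · by_cases hyD : Hits G pos y D
    · have h2D : Hits G pos y₂ D ∧ pos y ≤ pos y₂ := by
        simp only [sepKey, hyC, hyD, if_true, if_false] at hle2
        split_ifs at hle2 <;> first | omega | exact ⟨by assumption, by omega⟩
      refine h.separation (h.anc_of_hits hD h2D.1 hyD h2D.2) (fun hyx => ?_) l2.1.symm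
      by_cases h1C : Hits G pos y₁ C
      · exact hyC (hits (anc h1 hyx) h1C)
      · have : pos y₁ ≤ pos y := by
          simp only [sepKey, hyC, hyD, h1C, if_true, if_false] at hle1 h0
          split_ifs at hle1 h0 <;> omega
        have := hyx.pos_le
        omega
    · simp only [sepKey, hyC, hyD, if_false] at hle1
      exact absurd (Nat.le_zero.1 hle1) h0

/-- `last x` is the largest key of a vertex that has `x` among its earlier neighbors. -/
def IsLast (G : SimpleGraph V) (pos key last : V → ℕ) : Prop :=
  ∀ x, (∀ y, x ∈ earlier G pos y → key y ≤ last x) ∧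
    (last x ≠ 0 → ∃ y, x ∈ earlier G pos y ∧ key y = last x)

/-- At most `cap y` of the vertices in `O` are earlier neighbors of `y`. -/
def Packs (G : SimpleGraph V) (pos key cap : V → ℕ) (O : Finset V) : Prop :=
  ∀ y, key y ≠ 0 → #(O ∩ earlier G pos y) ≤ cap y

theorem Packs.mono {O O' : Finset V} (h : Packs G pos key cap O) (hs : O' ⊆ O) :
    Packs G pos key cap O' := fun y hy =>
  (card_le_card (inter_subset_inter_right hs)).trans (h y hy)

/-- The exchange argument. If no full separator contains `x`, then `x` can be added to `O`.
Otherwise let `y₀` be the first full one that does. As `x` fits there together with `A`, some `z` in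
`O` at `y₀` is not yet decided, and its interval ends no earlier than that of `x`. So `z` lies in
all full separators that contain `x`, and replacing `z` by `x` keeps the capacities. -/
theorem Packs.exchange {P A O : Finset V} {x : V} (hc : Consecutive G pos key)
    (hl : IsLast G pos key last) (hO : Packs G pos key cap O) (hOF : O ⊆ F) (hOP : O ∩ P = A)
    (hxF : x ∈ F) (hA : Packs G pos key cap (insert x A))
    (hlast : ∀ z ∈ O, z ∉ P → last z ≠ 0 → last x ≤ last z) :
    ∃ O' ⊆ F, Packs G pos key cap O' ∧ #O ≤ #O' ∧ O' ∩ insert x P = insert x A := by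
  by_cases hxO : x ∈ O
  · refine ⟨O, hOF, hO, le_rfl, ?_⟩
    rw [inter_insert_of_mem hxO, hOP]
  have hins : ∀ E y, #(insert x E ∩ earlier G pos y) ≤ #(E ∩ earlier G pos y) + 1 := fun E y => by
    refine (card_le_card (t := insert x (E ∩ earlier G pos y)) fun z hz => ?_).trans
      (card_insert_le _ _)
    simp only [mem_inter, mem_insert] at hz ⊢
    tauto
  have hins' : ∀ E y, x ∉ earlier G pos y →
      #(insert x E ∩ earlier G pos y) = #(E ∩ earlier G pos y) := fun E y hy => by
    rw [insert_inter_of_notMem hy]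
  set T := univ.filter fun y => key y ≠ 0 ∧ x ∈ earlier G pos y ∧
    #(O ∩ earlier G pos y) = cap y with hT
  rcases T.eq_empty_or_nonempty with hTe | hTn
  · refine ⟨insert x O, insert_subset hxF hOF, fun y hy => ?_, card_le_card (subset_insert _ _),
      ?_⟩
    · by_cases hxy : x ∈ earlier G pos y
      · have h1 := hO y hy
        have h2 : #(O ∩ earlier G pos y) ≠ cap y := fun e => by
          have : y ∈ T := by simp [hT, hy, hxy, e]
          simp [hTe] at this
        have := hins O y
        omega
      · rw [hins' O y hxy]
        exact hO y hy
    · rw [← hOP]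
      ext z
      simp only [mem_inter, mem_insert]
      tauto
  · obtain ⟨y₀, hy₀, hmin⟩ := exists_min_image T key hTn
    simp only [hT, mem_filter, mem_univ, true_and] at hy₀ hmin
    obtain ⟨hk0, hx0, hsat⟩ := hy₀
    have hxA : x ∉ A := fun h => hxO (by rw [← hOP] at h; exact (mem_inter.1 h).1)
    obtain ⟨z, hz, hzA⟩ : ∃ z ∈ O ∩ earlier G pos y₀, z ∉ A := by
      by_contra! hcon
      have h1 := hA y₀ hk0
      rw [insert_inter_of_mem hx0, card_insert_of_notMem (by simp [hxA])] at h1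
      have h2 := card_le_card (show O ∩ earlier G pos y₀ ⊆ A ∩ earlier G pos y₀ from fun z hz =>
        mem_inter.2 ⟨hcon z hz, (mem_inter.1 hz).2⟩)
      omega
    obtain ⟨hzO, hz0⟩ := mem_inter.1 hz
    have hzP : z ∉ P := fun h => hzA (by rw [← hOP]; exact mem_inter.2 ⟨hzO, h⟩)
    have hzl : last z ≠ 0 := by
      have := (hl z).1 y₀ hz0
      omega
    have hxz := hlast z hzO hzP hzl
    obtain ⟨y₂, hy₂, hky₂⟩ := (hl z).2 hzl
    have hzT : ∀ y, key y ≠ 0 → x ∈ earlier G pos y → #(O ∩ earlier G pos y) = cap y →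
        z ∈ earlier G pos y := fun y h1 h2 h3 =>
      hc z y₀ y y₂ hk0 hz0 hy₂ (hmin y ⟨h1, h2, h3⟩) (by have := (hl x).1 y h2; omega)
    have hcard := card_erase_of_mem hzO
    have hpos := card_pos.2 ⟨z, hzO⟩
    refine ⟨insert x (O.erase z), insert_subset hxF ((erase_subset _ _).trans hOF),
      fun y hy => ?_, ?_, ?_⟩
    · have h1 := hO y hy
      by_cases hxy : x ∈ earlier G pos y
      · have h2 := hins (O.erase z) y
        by_cases hsy : #(O ∩ earlier G pos y) = cap y
        · have hzy := hzT y hy hxy hsy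
          rw [erase_inter, card_erase_of_mem (mem_inter.2 ⟨hzO, hzy⟩)] at h2
          have := card_pos.2 ⟨z, mem_inter.2 ⟨hzO, hzy⟩⟩
          omega
        · have := card_le_card (inter_subset_inter_right (u := earlier G pos y) (erase_subset z O))
          omega
      · rw [hins' _ y hxy]
        exact (card_le_card (inter_subset_inter_right (erase_subset z O))).trans h1
    · rw [card_insert_of_notMem (by simp [hxO])]
      omega
    · rw [← hOP]
      ext w
      simp only [mem_inter, mem_insert, mem_erase]
      by_cases hwz : w = z
      · subst hwz
        have : w ≠ x := fun e => hxO (e ▸ hzO)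
        tauto
      · tauto

/-- The vertices in `P` have been processed, those in `A` have been accepted, and every packing
can be replaced by one at least as large that agrees with these decisions. -/
structure GreedyInv (G : SimpleGraph V) (pos key cap : V → ℕ) (F P A : Finset V) : Prop where
  sub : A ⊆ P
  subF : P ⊆ F
  packs : Packs G pos key cap A
  opt : ∀ O ⊆ F, Packs G pos key cap O →
    ∃ O' ⊆ F, Packs G pos key cap O' ∧ #O ≤ #O' ∧ O' ∩ P = A

theorem GreedyInv.init : GreedyInv G pos key cap F ∅ ∅ :=
  ⟨subset_rfl, empty_subset _, fun y _ => by simp, fun O h1 h2 => ⟨O, h1, h2, le_rfl, by simp⟩⟩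

theorem GreedyInv.accept {P A : Finset V} {x : V} (h : GreedyInv G pos key cap F P A)
    (hc : Consecutive G pos key) (hl : IsLast G pos key last)
    (hxF : x ∈ F) (hA : Packs G pos key cap (insert x A))
    (hlast : ∀ z ∈ F, z ∉ P → last z ≠ 0 → last x ≤ last z) :
    GreedyInv G pos key cap F (insert x P) (insert x A) := by
  refine ⟨insert_subset_insert _ h.sub, insert_subset hxF h.subF, hA, fun O hOF hO => ?_⟩
  obtain ⟨O', h1, h2, h3, h4⟩ := h.opt O hOF hO
  obtain ⟨O'', g1, g2, g3, g4⟩ := h2.exchange hc hl h1 h4 hxF hA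
    fun z hz => hlast z (h1 hz)
  exact ⟨O'', g1, g2, h3.trans g3, g4⟩

theorem GreedyInv.reject {P A : Finset V} {x : V} (h : GreedyInv G pos key cap F P A)
    (hxF : x ∈ F) (hA : ¬ Packs G pos key cap (insert x A)) :
    GreedyInv G pos key cap F (insert x P) A := by
  refine ⟨h.sub.trans (subset_insert _ _), insert_subset hxF h.subF, h.packs,
    fun O hOF hO => ?_⟩
  obtain ⟨O', h1, h2, h3, h4⟩ := h.opt O hOF hO
  refine ⟨O', h1, h2, h3, ?_⟩
  have hxO : x ∉ O' := fun hx => hA (h2.mono (insert_subset hx (h4 ▸ inter_subset_left)))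
  rw [inter_insert_of_notMem hxO, h4]

/-- Complementation: `U ∪ C ∪ D` is the complement of `O`, so it keeps `k` elements of a separator
exactly if `O` takes at most `cap` of them. -/
theorem suffices_iff_packs (hkey : ∀ v, key v ≠ 0 ↔ Separates G pos v C D)
    (hcap : ∀ v, key v ≠ 0 → cap v + k = #(earlier G pos v)) {U O : Finset V}
    (hU : U = (univ \ (C ∪ D)) \ O) (hO : O ⊆ univ \ (C ∪ D)) :
    Suffices G pos k C D U ↔ Packs G pos key cap O := by
  have hd : Disjoint U (C ∪ D) := by
    rw [hU]
    exact disjoint_of_subset_left sdiff_subset sdiff_disjoint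
  have hU' : U ∪ (C ∪ D) = univ \ O := by
    ext x
    have := @hO x
    simp only [hU, mem_union, mem_sdiff, mem_univ, true_and] at this ⊢
    tauto
  have hcard : ∀ v, #((U ∪ (C ∪ D)) ∩ earlier G pos v) + #(O ∩ earlier G pos v) =
      #(earlier G pos v) := fun v => by
    rw [hU', ← card_union_of_disjoint]
    · congr 1
      ext x
      simp only [mem_union, mem_inter, mem_sdiff, mem_univ, true_and]
      tauto
    · rw [Finset.disjoint_left]
      intro x
      simp only [mem_inter, mem_sdiff]
      tauto
  unfold Suffices Packs
  simp only [hd, true_and]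
  refine forall_congr' fun v => ?_
  rw [← hkey v]
  refine imp_congr_right fun hv => ?_
  have := hcap v hv
  have := hcard v
  omega

/-- When all vertices that matter are processed, the rejected ones are an optimal choice. -/
theorem GreedyInv.optimal {P A : Finset V}
    (h : GreedyInv G pos key cap (univ \ (C ∪ D)) P A)
    (hkey : ∀ v, key v ≠ 0 ↔ Separates G pos v C D)
    (hcap : ∀ v, key v ≠ 0 → cap v + k = #(earlier G pos v))
    (hP : ∀ x ∈ univ \ (C ∪ D), x ∉ P → ∀ y, key y ≠ 0 → x ∉ earlier G pos y) :
    Suffices G pos k C D (P \ A) ∧ ∀ U, Suffices G pos k C D U → #(P \ A) ≤ #U := by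
  set F := univ \ (C ∪ D) with hF
  have hsub := h.sub
  have hsubF := h.subF
  have hAF : A ∪ F \ P ⊆ F := union_subset (hsub.trans hsubF) sdiff_subset
  constructor
  · refine (suffices_iff_packs hkey hcap (O := A ∪ F \ P) ?_ hAF).2 fun y hy => ?_
    · ext x
      have := @hsubF x
      simp only [mem_sdiff, mem_union, ← hF]
      tauto
    · refine (card_le_card fun x hx => ?_).trans (h.packs y hy)
      simp only [mem_inter, mem_union, mem_sdiff] at hx ⊢
      rcases hx with ⟨hA | hx, hxy⟩
      · exact ⟨hA, hxy⟩
      · exact absurd hxy (hP x hx.1 hx.2 y hy)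
  · intro U hU
    have hUF : U ⊆ F := fun x hx => by
      rw [hF, mem_sdiff]
      exact ⟨mem_univ _, Finset.disjoint_left.1 hU.1 hx⟩
    have hO := (suffices_iff_packs hkey hcap (O := F \ U) (by
      rw [← hF, Finset.sdiff_sdiff_eq_self hUF]) sdiff_subset).1 hU
    obtain ⟨O', h1, h2, h3, h4⟩ := h.opt _ sdiff_subset hO
    have hO' : O' ⊆ F \ (P \ A) := fun x hx => by
      simp only [mem_sdiff]
      refine ⟨h1 hx, fun h' => h'.2 (h4 ▸ mem_inter.2 ⟨hx, h'.1⟩)⟩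
    have c1 := card_le_card hO'
    have c2 := card_sdiff_add_card_eq_card hUF
    have c3 := card_sdiff_add_card_eq_card (sdiff_subset.trans hsubF : P \ A ⊆ F)
    omega

end Greedy

/-! ### Verification of programs -/

section Semantics

@[simp] theorem State.setReg_reg (s : State) (r x r' : ℕ) :
    (s.setReg r x).reg r' = if r' = r then x else s.reg r' := by
  simp [State.setReg, Function.update_apply]

@[simp] theorem State.setReg_arr (s : State) (r x : ℕ) : (s.setReg r x).arr = s.arr := rfl

@[simp] theorem State.setArr_reg (s : State) (a i x : ℕ) : (s.setArr a i x).reg = s.reg := rfl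

@[simp] theorem State.setArr_arr (s : State) (a i x a' : ℕ) :
    (s.setArr a i x).arr a' = if a' = a then Function.update (s.arr a) i x else s.arr a' := by
  simp [State.setArr, Function.update_apply]

/-- All registers and array cells hold values of at most `B`. -/
structure Bounded (B : ℕ) (s : State) : Prop where
  eight_le : 8 ≤ B
  reg : ∀ r, s.reg r ≤ B
  arr : ∀ a i, s.arr a i ≤ B

variable {B W : ℕ} {s : State}

theorem Bounded.setReg (h : Bounded B s) (r : ℕ) {x : ℕ} (hx : x ≤ B) :
    Bounded B (s.setReg r x) := by
  refine ⟨h.eight_le, fun r' => ?_, h.arr⟩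
  rw [State.setReg_reg]
  split_ifs
  · exact hx
  · exact h.reg r'

theorem Bounded.setArr (h : Bounded B s) (a i : ℕ) {x : ℕ} (hx : x ≤ B) :
    Bounded B (s.setArr a i x) := by
  refine ⟨h.eight_le, h.reg, fun a' i' => ?_⟩
  rw [State.setArr_arr]
  split_ifs
  · rw [Function.update_apply]
    split_ifs
    · exact hx
    · exact h.arr _ _
  · exact h.arr _ _

/-- A factor by which the values in an evaluation may exceed a bound on the memory contents. -/
def Expr.growth : Expr → ℕ
  | .const x => x
  | .reg _ => 1
  | .load _ e => max e.growth 1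
  | .add e f => e.growth + f.growth
  | .sub e f => max e.growth f.growth

/-- Memory contents are at most `B`, so only additions and constants of the program text can exceed
`B`, and by a factor that the text determines. -/
theorem Expr.fits_of_growth (hs : Bounded B s) (e : Expr) :
    e.eval s ≤ e.growth * B ∧ ∀ W, e.growth * B ≤ W → e.Fits W s := by
  have hB := hs.eight_le
  induction e with
  | const x =>
    simp only [Expr.eval, Expr.growth, Expr.Fits]
    exact ⟨by nlinarith, fun W hW => by nlinarith⟩
  | reg r =>
    have := hs.reg r
    simp only [Expr.eval, Expr.growth, Expr.Fits]
    exact ⟨by omega, fun W hW => by omega⟩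
  | load a e ih =>
    have h1 := hs.arr a (e.eval s)
    simp only [Expr.eval, Expr.growth, Expr.Fits]
    have h2 : B ≤ max e.growth 1 * B := Nat.le_mul_of_pos_left _ (by omega)
    have h3 : e.growth * B ≤ max e.growth 1 * B := Nat.mul_le_mul_right _ (by omega)
    exact ⟨by omega, fun W hW => ⟨ih.2 W (by omega), by omega⟩⟩
  | add e f ihe ihf =>
    simp only [Expr.eval, Expr.growth, Expr.Fits, add_mul]
    exact ⟨by omega, fun W hW => ⟨ihe.2 W (by omega), ihf.2 W (by omega), by omega⟩⟩
  | sub e f ihe ihf =>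
    simp only [Expr.eval, Expr.growth, Expr.Fits]
    have h2 : e.growth * B ≤ max e.growth f.growth * B := Nat.mul_le_mul_right _ (by omega)
    have h3 : f.growth * B ≤ max e.growth f.growth * B := Nat.mul_le_mul_right _ (by omega)
    exact ⟨by omega, fun W hW => ⟨ihe.2 W (by omega), ihf.2 W (by omega)⟩⟩

theorem Expr.fits (hs : Bounded B s) {e : Expr} (he : e.growth ≤ 8) : e.Fits (8 * B) s :=
  (e.fits_of_growth hs).2 _ (Nat.mul_le_mul_right _ he)

/-- The registers that a program writes. -/
def Prog.writesReg : Prog → List ℕ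
  | .skip => []
  | .assign r _ => [r]
  | .store _ _ _ => []
  | .seq p q => p.writesReg ++ q.writesReg
  | .cond _ p q => p.writesReg ++ q.writesReg
  | .loop _ p => p.writesReg

/-- The arrays that a program writes. -/
def Prog.writesArr : Prog → List ℕ
  | .skip => []
  | .assign _ _ => []
  | .store a _ _ => [a]
  | .seq p q => p.writesArr ++ q.writesArr
  | .cond _ p q => p.writesArr ++ q.writesArr
  | .loop _ p => p.writesArr

/-- The states agree on everything that `p` does not write. -/
structure Frame (p : Prog) (s s' : State) : Prop where
  reg : ∀ r, r ∉ p.writesReg → s'.reg r = s.reg r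
  arr : ∀ a, a ∉ p.writesArr → s'.arr a = s.arr a

theorem Frame.refl (p : Prog) (s : State) : Frame p s s := ⟨fun _ _ => rfl, fun _ _ => rfl⟩

theorem Frame.trans {p : Prog} {s₁ s₂ s₃ : State} (h : Frame p s₁ s₂) (h' : Frame p s₂ s₃) :
    Frame p s₁ s₃ :=
  ⟨fun r hr => (h'.reg r hr).trans (h.reg r hr), fun a ha => (h'.arr a ha).trans (h.arr a ha)⟩

theorem Frame.mono {p q : Prog} {s s' : State} (h : Frame p s s')
    (hr : ∀ r ∈ p.writesReg, r ∈ q.writesReg) (ha : ∀ a ∈ p.writesArr, a ∈ q.writesArr) :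
    Frame q s s' :=
  ⟨fun r hr' => h.reg r fun h' => hr' (hr r h'), fun a ha' => h.arr a fun h' => ha' (ha a h')⟩

/-- From `s` the program `p` halts after at most `b` steps in a state that satisfies `Q`;
if the memory contents are bounded by `B` at first, they are so at the end, and all values in
between are at most `8 * B`. -/
def Runs (B : ℕ) (p : Prog) (s : State) (b : ℕ) (Q : State → Prop) : Prop :=
  Bounded B s → ∃ t s', Exec (8 * B) p s t s' ∧ t ≤ b ∧ Bounded B s' ∧ Frame p s s' ∧ Q s'

variable {p q : Prog} {b b₁ b₂ : ℕ} {Q Q' : State → Prop}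

theorem Runs.mono (h : Runs B p s b Q) (hb : b ≤ b₁)
    (hQ : ∀ s', Bounded B s' → Frame p s s' → Q s' → Q' s') : Runs B p s b₁ Q' := by
  intro hs
  obtain ⟨t, s', h1, h2, h3, h4, h5⟩ := h hs
  exact ⟨t, s', h1, h2.trans hb, h3, h4, hQ s' h3 h4 h5⟩

theorem Runs.seq (h : Runs B p s b₁ Q)
    (h' : ∀ s', Bounded B s' → Frame p s s' → Q s' → Runs B q s' b₂ Q')
    (hb : b₁ + b₂ ≤ b) : Runs B (.seq p q) s b Q' := by
  intro hs
  obtain ⟨t, s', h1, h2, h3, h4, h5⟩ := h hs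
  obtain ⟨t', s'', g1, g2, g3, g4, g5⟩ := h' s' h3 h4 h5 h3
  exact ⟨t + t', s'', .seq h1 g1, by omega, g3,
    (h4.mono (q := .seq p q) (by simp +contextual [Prog.writesReg])
      (by simp +contextual [Prog.writesArr])).trans
    (g4.mono (by simp +contextual [Prog.writesReg]) (by simp +contextual [Prog.writesArr])), g5⟩

theorem Runs.cond {e : Expr} (he : e.growth ≤ 8) (h₁ : e.eval s ≠ 0 → Runs B p s b₁ Q)
    (h₂ : e.eval s = 0 → Runs B q s b₂ Q) (hb : e.cost + 1 + max b₁ b₂ ≤ b) :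
    Runs B (.cond e p q) s b Q := by
  intro hs
  by_cases h : e.eval s = 0
  · obtain ⟨t, s', h1, h2, h3, h4, h5⟩ := h₂ h hs
    exact ⟨_, s', .cond_false (Expr.fits hs he) h h1, by omega, h3,
      h4.mono (by simp +contextual [Prog.writesReg]) (by simp +contextual [Prog.writesArr]), h5⟩
  · obtain ⟨t, s', h1, h2, h3, h4, h5⟩ := h₁ h hs
    exact ⟨_, s', .cond_true (Expr.fits hs he) h h1, by omega, h3,
      h4.mono (by simp +contextual [Prog.writesReg]) (by simp +contextual [Prog.writesArr]), h5⟩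

/-- The loop rule: `φ` in `I φ s'` pays for the remaining steps. -/
theorem Runs.loop {e : Expr} {I : ℕ → State → Prop} {φ : ℕ} (he : e.growth ≤ 8)
    (h0 : I φ s)
    (hbody : ∀ φ s', Bounded B s' → Frame p s s' → I φ s' → e.eval s' ≠ 0 →
      ∃ b', Runs B p s' b' fun s'' => ∃ φ', I φ' s'' ∧ e.cost + 1 + b' + φ' ≤ φ)
    (hend : ∀ φ s', I φ s' → e.eval s' = 0 → e.cost + 1 ≤ φ) :
    Runs B (.loop e p) s φ fun s' => e.eval s' = 0 ∧ ∃ φ', I φ' s' := by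
  have key : ∀ φ s', Bounded B s' → Frame p s s' → I φ s' →
      ∃ t s'', Exec (8 * B) (.loop e p) s' t s'' ∧ t ≤ φ ∧ Bounded B s'' ∧ Frame p s s'' ∧
        (e.eval s'' = 0 ∧ ∃ φ', I φ' s'') := by
    intro φ
    -- Each round costs at least the test, so the budget strictly decreases; this also proves
    -- termination.
    induction φ using Nat.strong_induction_on with
    | _ φ ih =>
      intro s' hs' hf hI
      by_cases h : e.eval s' = 0
      · exact ⟨_, s', .loop_false (Expr.fits hs' he) h, hend φ s' hI h, hs', hf, h, φ, hI⟩
      · obtain ⟨b', hr⟩ := hbody φ s' hs' hf hI h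
        obtain ⟨t, s₁, h1, h2, h3, h4, φ', h5, h6⟩ := hr hs'
        obtain ⟨t', s₂, g1, g2, g3, g4, g5⟩ := ih φ' (by omega) s₁ h3 (hf.trans h4) h5
        exact ⟨_, s₂, .loop_true (Expr.fits hs' he) h h1 g1, by omega, g3, g4, g5⟩
  intro hs
  obtain ⟨t, s', h1, h2, h3, h4, h5⟩ := key φ s hs (Frame.refl p s) h0
  exact ⟨t, s', h1, h2, h3, h4.mono (fun _ h => h) (fun _ h => h), h5⟩

/-- The program has no loops and every expression has growth at most `8`. -/
def Prog.flat : Prog → Bool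
  | .skip => true
  | .assign _ e => e.growth ≤ 8
  | .store _ i e => (i.growth ≤ 8) && (e.growth ≤ 8)
  | .seq p q => p.flat && q.flat
  | .cond e p q => (e.growth ≤ 8) && (p.flat && q.flat)
  | .loop _ _ => false

/-- A bound on the number of steps of a program without loops. -/
def Prog.maxCost : Prog → ℕ
  | .skip => 1
  | .assign _ e => e.cost + 1
  | .store _ i e => i.cost + e.cost + 1
  | .seq p q => p.maxCost + q.maxCost
  | .cond e p q => e.cost + 1 + max p.maxCost q.maxCost
  | .loop _ _ => 0

/-- The effect of a program without loops. -/
def Prog.run : Prog → State → State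
  | .skip, s => s
  | .assign r e, s => s.setReg r (e.eval s)
  | .store a i e, s => s.setArr a (i.eval s) (e.eval s)
  | .seq p q, s => q.run (p.run s)
  | .cond e p q, s => if e.eval s ≠ 0 then p.run s else q.run s
  | .loop _ _, s => s

/-- The value of the expression may be written into memory. -/
def Expr.storable (B : ℕ) (s : State) : Expr → Prop
  | .const x => x ≤ B
  | .reg _ => True
  | .load _ _ => True
  | .add e f => e.eval s + f.eval s ≤ B
  | .sub e f => e.storable B s ∨ e.eval s - f.eval s ≤ B

theorem Expr.eval_le_of_storable (hs : Bounded B s) : ∀ {e : Expr}, e.storable B s → e.eval s ≤ B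
  | .const _, h => h
  | .reg r, _ => hs.reg r
  | .load a _, _ => hs.arr a _
  | .add _ _, h => h
  | .sub e _, h => h.elim (fun h => (Nat.sub_le _ _).trans (e.eval_le_of_storable hs h)) id

/-- In a program without loops, every value written into memory is at most `B`. -/
def Prog.safe (B : ℕ) : Prog → State → Prop
  | .skip, _ => True
  | .assign _ e, s => e.storable B s
  | .store _ _ e, s => e.storable B s
  | .seq p q, s => p.safe B s ∧ q.safe B (p.run s)
  | .cond e p q, s => (e.eval s ≠ 0 → p.safe B s) ∧ (e.eval s = 0 → q.safe B s)
  | .loop _ _, _ => True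

theorem Runs.of_run (hp : p.flat = true) (hsafe : p.safe B s) :
    Runs B p s p.maxCost fun s' => s' = p.run s := by
  induction p generalizing s with
  | skip => exact fun hs => ⟨1, s, .skip s, le_rfl, hs, Frame.refl _ _, rfl⟩
  | assign r e =>
    intro hs
    simp only [Prog.flat, decide_eq_true_eq] at hp
    refine ⟨_, _, .assign s r e (Expr.fits hs hp), le_rfl,
      hs.setReg r (Expr.eval_le_of_storable hs hsafe), ⟨fun r' hr' => ?_, fun _ _ => rfl⟩, rfl⟩
    simp only [Prog.writesReg, List.mem_singleton] at hr'
    simp [hr']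
  | store a i e =>
    intro hs
    simp only [Prog.flat, Bool.and_eq_true, decide_eq_true_eq] at hp
    refine ⟨_, _, .store s a i e (Expr.fits hs hp.1) (Expr.fits hs hp.2), le_rfl,
      hs.setArr a _ (Expr.eval_le_of_storable hs hsafe), ⟨fun _ _ => rfl, fun a' ha' => ?_⟩, rfl⟩
    simp only [Prog.writesArr, List.mem_singleton] at ha'
    simp [ha']
  | seq p q ihp ihq =>
    simp only [Prog.flat, Bool.and_eq_true] at hp
    exact (ihp hp.1 hsafe.1).seq (fun s' _ _ h => h ▸ ihq hp.2 hsafe.2) le_rfl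
  | cond e p q ihp ihq =>
    simp only [Prog.flat, Bool.and_eq_true, decide_eq_true_eq] at hp
    refine Runs.cond hp.1 (fun h => ?_) (fun h => ?_) le_rfl
    · simp only [Prog.run, h, ne_eq, not_false_eq_true, if_true]
      exact ihp hp.2.1 (hsafe.1 h)
    · simp only [Prog.run, h, ne_eq, not_true_eq_false, if_false]
      exact ihq hp.2.2 (hsafe.2 h)
  | loop e p => simp [Prog.flat] at hp

/-- This verifies code without loops by evaluation: shape and cost are closed computations, and only
the safety of stores and the postcondition of `Prog.run` are left. -/
theorem Runs.flat (hp : p.flat = true) (hb : p.maxCost ≤ b) (hsafe : Bounded B s → p.safe B s)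
    (hQ : Bounded B s → Q (p.run s)) : Runs B p s b Q := fun hs =>
  (Runs.of_run hp (hsafe hs)).mono hb (fun _ _ _ h => h ▸ hQ hs) hs

/-- `for r := 0` up to but excluding the value of register `m`. -/
def forTo (r m : ℕ) (body : Prog) : Prog :=
  .seq (.assign r (.const 0)) (.loop (.sub (.reg m) (.reg r))
    (.seq body (.assign r (.add (.reg r) (.const 1)))))

/-- The `8` per round is the test and the increment, four steps each; the final `6` is the
initialization and the last test. The invariant must not depend on the counter register. -/
theorem Runs.forTo {r m N : ℕ} {body : Prog} {I : ℕ → State → Prop} {c : ℕ → ℕ}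
    (hr : r ∉ body.writesReg) (hm : m ∉ body.writesReg) (hmr : m ≠ r) (hN : s.reg m = N)
    (hI : ∀ i s' x, I i s' → I i (s'.setReg r x)) (h0 : I 0 s)
    (hbody : ∀ i s', i < N → Bounded B s' → Frame (forTo r m body) s s' → s'.reg r = i → I i s' →
      Runs B body s' (c i) (I (i + 1)))
    (hb : ∑ i ∈ range N, (c i + 8) + 6 ≤ b) : Runs B (forTo r m body) s b (I N) := by
  have hf0 : ∀ {s₁ s₂ : State}, Frame (.seq body (.assign r (.add (.reg r) (.const 1)))) s₁ s₂ →
      Frame (CliqueReconf.forTo r m body) s₁ s₂ := fun h =>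
    h.mono (by simp +contextual [Prog.writesReg, CliqueReconf.forTo])
      (by simp +contextual [Prog.writesArr, CliqueReconf.forTo])
  have hfb : ∀ {s₁ s₂ : State}, Frame body s₁ s₂ →
      Frame (.seq body (.assign r (.add (.reg r) (.const 1)))) s₁ s₂ := fun h =>
    h.mono (by simp +contextual [Prog.writesReg]) (by simp +contextual [Prog.writesArr])
  refine Runs.seq (b₁ := 2) (b₂ := ∑ i ∈ range N, (c i + 8) + 4)
    (Q := fun s' => s' = s.setReg r 0)
    (Runs.flat (by simp [Prog.flat, Expr.growth]) (by simp [Prog.maxCost, Expr.cost])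
      (fun h => by simp [Prog.safe, Expr.storable])
      (fun _ => by simp [Prog.run, Expr.eval])) (fun s₁ hs₁ hf₁ he₁ => ?_) (by omega)
  subst he₁
  refine (Runs.loop (B := B) (s := s.setReg r 0) (I := fun φ s' => ∃ i ≤ N, s'.reg r = i ∧
    s'.reg m = N ∧ I i s' ∧ φ = ∑ j ∈ Ico i N, (c j + 8) + 4)
    (φ := ∑ i ∈ range N, (c i + 8) + 4) (by simp [Expr.growth]) ?_ ?_ ?_).mono le_rfl ?_
  · refine ⟨0, Nat.zero_le _, by simp, by simp [hmr, hN], hI _ _ _ h0, ?_⟩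
    rw [Nat.Ico_zero_eq_range]
  · rintro φ s' hs' hf ⟨i, hi, h1, h2, h3, rfl⟩ hne
    simp only [Expr.eval, h1, h2] at hne
    have hiN : i < N := by omega
    refine ⟨c i + 4, Runs.seq (hbody i s' hiN hs' ?_ h1 h3)
      (fun s'' hs'' hf'' hI'' => Runs.flat (b := 4) (by simp [Prog.flat, Expr.growth])
        (by simp [Prog.maxCost, Expr.cost])
        (fun _ => ?_) (fun _ => ⟨_, ⟨i + 1, hiN, ?_, ?_, ?_, rfl⟩, ?_⟩)) le_rfl⟩
    · refine Frame.trans (s₂ := s.setReg r 0) ⟨fun r' hr' => ?_, fun a _ => rfl⟩ (hf0 hf)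
      have : r' ≠ r := by rintro rfl; simp [Prog.writesReg, CliqueReconf.forTo] at hr'
      simp [this]
    -- The increased counter is at most the limit, which is itself stored in a register.
    · have := hs''.reg m
      have e1 := hf''.reg r hr
      have e2 := hf''.reg m hm
      simp only [Prog.safe, Expr.storable, Expr.eval]
      omega
    · have e1 := hf''.reg r hr
      simp [Prog.run, Expr.eval, e1, h1]
    · have e2 := hf''.reg m hm
      simp [Prog.run, Expr.eval, e2, h2, hmr]
    · exact hI _ _ _ hI''
    · rw [Finset.sum_eq_sum_Ico_succ_bot hiN]
      simp only [Expr.cost]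
      omega
  · rintro φ s' ⟨i, hi, h1, h2, h3, rfl⟩ -
    simp only [Expr.cost]
    omega
  · rintro s' hs' hf ⟨he, φ', i, hi, h1, h2, h3, -⟩
    simp only [Expr.eval, h1, h2] at he
    obtain rfl : i = N := by omega
    exact h3

/-- Arrays `0` and `1` hold the adjacency lists. -/
def HasAdj {n : ℕ} (adj : Fin n → List (Fin n)) (s : State) : Prop :=
  ∀ v : Fin n, s.arr 0 (v + 1) = s.arr 0 v + (adj v).length ∧
    ∀ i (h : i < (adj v).length), s.arr 1 (s.arr 0 v + i) = ((adj v)[i] : ℕ)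

/-- For all `x` in the adjacency list of the vertex in register `v`, using register `j` as a
pointer. -/
def forNbr (v j x : ℕ) (body : Prog) : Prog :=
  .seq (.assign j (.load 0 (.reg v))) (.loop (.sub (.load 0 (.add (.reg v) (.const 1))) (.reg j))
    (.seq (.assign x (.load 1 (.reg j))) (.seq body (.assign j (.add (.reg j) (.const 1))))))

theorem Runs.forNbr {n rv rj rx : ℕ} {adj : Fin n → List (Fin n)} {v : Fin n} {body : Prog}
    {I : List (Fin n) → State → Prop} {c : Fin n → ℕ}
    (hj : rj ∉ body.writesReg) (hv : rv ∉ body.writesReg) (hvj : rv ≠ rj) (hvx : rv ≠ rx)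
    (hjx : rj ≠ rx) (h0 : 0 ∉ body.writesArr) (h1 : 1 ∉ body.writesArr)
    (hadj : HasAdj adj s) (hsv : s.reg rv = v)
    (hI : ∀ pre s' (x : ℕ), I pre s' → I pre (s'.setReg rj x) ∧ I pre (s'.setReg rx x))
    (hi0 : I [] s)
    (hbody : ∀ (pre : List (Fin n)) (x : Fin n) (post : List (Fin n)) s',
      adj v = pre ++ x :: post → Bounded B s' →
      Frame (forNbr rv rj rx body) s s' → s'.reg rx = x → I pre s' →
      Runs B body s' (c x) (I (pre ++ [x])))
    (hb : ((adj v).map fun x => c x + 14).sum + 11 ≤ b) :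
    Runs B (forNbr rv rj rx body) s b (I (adj v)) := by
  set lp : Prog := .seq (.assign rx (.load 1 (.reg rj)))
    (.seq body (.assign rj (.add (.reg rj) (.const 1)))) with hlp
  have hf0 : ∀ {s₁ s₂ : State}, Frame lp s₁ s₂ →
      Frame (CliqueReconf.forNbr rv rj rx body) s₁ s₂ := fun h =>
    h.mono (by simp +contextual [Prog.writesReg, CliqueReconf.forNbr, hlp])
      (by simp +contextual [Prog.writesArr, CliqueReconf.forNbr, hlp])
  have hfj : ∀ (s₁ : State) (y : ℕ), Frame (CliqueReconf.forNbr rv rj rx body) s₁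
      (s₁.setReg rj y) := fun s₁ y => by
    refine ⟨fun r' hr' => ?_, fun a _ => rfl⟩
    have : r' ≠ rj := by rintro rfl; simp [Prog.writesReg, CliqueReconf.forNbr] at hr'
    simp [this]
  have hfx : ∀ (s₁ : State) (y : ℕ), Frame (CliqueReconf.forNbr rv rj rx body) s₁
      (s₁.setReg rx y) := fun s₁ y => by
    refine ⟨fun r' hr' => ?_, fun a _ => rfl⟩
    have : r' ≠ rx := by rintro rfl; simp [Prog.writesReg, CliqueReconf.forNbr] at hr'
    simp [this]
  have hrv : rv ∉ (CliqueReconf.forNbr rv rj rx body).writesReg := by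
    simp [Prog.writesReg, CliqueReconf.forNbr, hv, hvj, hvx]
  have hra0 : 0 ∉ (CliqueReconf.forNbr rv rj rx body).writesArr := by
    simp [Prog.writesArr, CliqueReconf.forNbr, h0]
  have hra1 : 1 ∉ (CliqueReconf.forNbr rv rj rx body).writesArr := by
    simp [Prog.writesArr, CliqueReconf.forNbr, h1]
  refine Runs.seq (b₁ := 3) (b₂ := ((adj v).map fun x => c x + 14).sum + 8)
    (Q := fun s' => s' = s.setReg rj (s.arr 0 v))
    (Runs.flat (by simp [Prog.flat, Expr.growth]) (by simp [Prog.maxCost, Expr.cost])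
      (fun h => by simp [Prog.safe, Expr.storable])
      (fun _ => by simp [Prog.run, Expr.eval, hsv])) (fun s₁ hs₁ hf₁ he₁ => ?_) (by omega)
  subst he₁
  refine (Runs.loop (B := B) (s := s.setReg rj (s.arr 0 v)) (I := fun φ s' => ∃ pre post,
    adj v = pre ++ post ∧ s'.reg rj = s.arr 0 v + pre.length ∧
    I pre s' ∧ φ = (post.map fun x => c x + 14).sum + 8)
    (φ := ((adj v).map fun x => c x + 14).sum + 8) (by simp [Expr.growth]) ?_ ?_ ?_).mono le_rfl ?_
  · exact ⟨[], adj v, by simp, by simp, (hI _ _ _ hi0).1, rfl⟩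
  · rintro φ s' hs' hf ⟨pre, post, h2, h3, h4, rfl⟩ hne
    have hF : Frame (CliqueReconf.forNbr rv rj rx body) s s' := (hfj _ _).trans (hf0 hf)
    have e0 := hF.arr 0 hra0
    have e1 := hF.arr 1 hra1
    have ev := hF.reg rv hrv
    have hlen := (hadj v).1
    rcases post with _ | ⟨x, post⟩
    · simp only [Expr.eval, e0, ev, hsv, h3, hlen] at hne
      rw [h2] at hne
      simp at hne
    have hx : s'.arr 1 (s'.reg rj) = x := by
      rw [e1, h3, (hadj v).2 pre.length (by simp [h2])]
      simp [h2]
    refine ⟨c x + 7, Runs.seq (b₁ := 3) (b₂ := c x + 4)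
      (Q := fun s'' => s'' = s'.setReg rx x)
      (Runs.flat (by simp [Prog.flat, Expr.growth]) (by simp [Prog.maxCost, Expr.cost])
        (fun h => by simp [Prog.safe, Expr.storable])
        (fun _ => by simp [Prog.run, Expr.eval, hx])) (fun s₂ hs₂ hf₂ he₂ => ?_) (by omega)⟩
    subst he₂
    refine Runs.seq (b₂ := 4) (hbody pre x post _ h2 hs₂ (hF.trans (hfx _ _)) (by simp)
        (hI _ _ _ h4).2)
      (fun s'' hs'' hf'' hI'' => Runs.flat (b := 4) (by simp [Prog.flat, Expr.growth])
        (by simp [Prog.maxCost, Expr.cost])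
        (fun _ => ?_) (fun _ => ⟨_, ⟨pre ++ [x], post, by simp [h2], ?_, ?_, rfl⟩, ?_⟩)) le_rfl
    -- The increased pointer is at most the next offset, which is stored in array `0` and hence
    -- bounded.
    · have e1 := hf''.reg rj hj
      simp only [State.setReg_reg, hjx, if_false, h3] at e1
      have e2 := hs₁.arr 0 (v + 1)
      simp only [State.setReg_arr] at e2
      rw [hlen, h2] at e2
      simp only [Prog.safe, Expr.storable, Expr.eval, e1]
      simp only [List.length_append, List.length_cons] at e2
      omega
    · have e1 := hf''.reg rj hj
      simp only [State.setReg_reg, hjx, if_false, h3] at e1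
      simp [Prog.run, Expr.eval, e1]
      omega
    · exact (hI _ _ _ hI'').1
    · simp only [Expr.cost, List.map_cons, List.sum_cons]
      omega
  · rintro φ s' ⟨pre, post, h2, h3, h4, rfl⟩ -
    simp only [Expr.cost]
    omega
  · rintro s' hs' hf ⟨he, φ', pre, post, h2, h3, h4, -⟩
    have hF : Frame (CliqueReconf.forNbr rv rj rx body) s s' := (hfj _ _).trans
      (hf0 (hf.mono (fun _ h => h) (fun _ h => h)))
    have e0 := hF.arr 0 hra0
    have ev := hF.reg rv hrv
    have hlen := (hadj v).1
    simp only [Expr.eval, e0, ev, hsv, h3, hlen] at he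
    rw [h2] at he
    have : post = [] := by
      rw [← List.length_eq_zero_iff]
      simp at he
      omega
    subst this
    simpa [h2] using h4

end Semantics

/-! ### Maximum cardinality search

Register `4` holds the current vertex, `5` its current neighbor, `8` the number of list nodes, `9`
an upper bound on the weights and `10` the number of visited vertices. Array `4` holds the
positions of the visited vertices, from one on, array `5` the weights, array `6` the parents
(increased by one), array `7` the vertices in the order of their visits, array `8` the heads of the
buckets, and arrays `9` and `10` the successors and the vertices of the list nodes. -/

section Search

variable {n : ℕ} {G : SimpleGraph (Fin n)} {adj : Fin n → List (Fin n)}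

/-- The linked list from node `h` on holds `xs`; all of its nodes are at most `c`. -/
def Chain (nx vt : ℕ → ℕ) (c : ℕ) : ℕ → List (Fin n) → Prop
  | h, [] => h = 0
  | h, x :: xs => h ≠ 0 ∧ h ≤ c ∧ vt h = x ∧ Chain nx vt c (nx h) xs

/-- Lists survive the allocation of a fresh node, since they only refer to nodes up to `c`. -/
theorem Chain.congr {nx vt nx' vt' : ℕ → ℕ} {c c' h : ℕ} {xs : List (Fin n)}
    (hc : Chain nx vt c h xs) (hnx : ∀ i ≤ c, nx' i = nx i) (hvt : ∀ i ≤ c, vt' i = vt i)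
    (hcc : c ≤ c') : Chain nx' vt' c' h xs := by
  induction xs generalizing h with
  | nil => exact hc
  | cons x xs ih =>
    obtain ⟨h1, h2, h3, h4⟩ := hc
    exact ⟨h1, h2.trans hcc, (hvt h h2).trans h3, by rw [hnx h h2]; exact ih h4⟩

/-- The buckets in the memory hold the lists `b`. -/
def Buckets (b : ℕ → List (Fin n)) (s : State) : Prop :=
  ∀ j, Chain (s.arr 9) (s.arr 10) (s.reg 8) (s.arr 8 j) (b j)

theorem Buckets.congr {b : ℕ → List (Fin n)} {s s' : State} (h : Buckets b s)
    (h8 : s'.reg 8 = s.reg 8) (a8 : s'.arr 8 = s.arr 8) (a9 : s'.arr 9 = s.arr 9)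
    (a10 : s'.arr 10 = s.arr 10) : Buckets b s' := by
  unfold Buckets at h ⊢
  rwa [h8, a8, a9, a10]

/-- Put the vertex in register `5` into the bucket of its weight. -/
def push : Prog :=
  .seq (.assign 8 (.add (.reg 8) (.const 1)))
  (.seq (.store 9 (.reg 8) (.load 8 (.load 5 (.reg 5))))
  (.seq (.store 10 (.reg 8) (.reg 5))
    (.store 8 (.load 5 (.reg 5)) (.reg 8))))

theorem runs_push {B : ℕ} {s : State} {b : ℕ → List (Fin n)} {x : Fin n} (hx : s.reg 5 = x)
    (hb : Buckets b s) (hB : s.reg 8 + 1 ≤ B) :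
    Runs B push s 20 fun s' => s'.reg 8 = s.reg 8 + 1 ∧
      Buckets (Function.update b (s.arr 5 x) (x :: b (s.arr 5 x))) s' := by
  refine Runs.flat (by decide) (by decide) (fun hs => ?_) (fun hs => ⟨?_, fun j => ?_⟩)
  · simpa [push, Prog.safe, Expr.storable, Prog.run, Expr.eval] using hB
  · simp [push, Prog.run, Expr.eval]
  · have hne : ∀ i ≤ s.reg 8, i ≠ s.reg 8 + 1 := fun i hi => by omega
    have hch : ∀ j, Chain (push.run s |>.arr 9) (push.run s |>.arr 10) (push.run s |>.reg 8)
        (s.arr 8 j) (b j) := fun j => (hb j).congr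
      (fun i hi => by simp [push, Prog.run, Expr.eval, Function.update_of_ne (hne i hi)])
      (fun i hi => by simp [push, Prog.run, Expr.eval, Function.update_of_ne (hne i hi)])
      (by simp [push, Prog.run, Expr.eval])
    by_cases hj : j = s.arr 5 x
    · subst hj
      rw [Function.update_self]
      have h8 : (push.run s).arr 8 (s.arr 5 x) = s.reg 8 + 1 := by
        simp [push, Prog.run, Expr.eval, hx]
      rw [h8]
      refine ⟨by omega, by simp [push, Prog.run, Expr.eval],
        by simp [push, Prog.run, Expr.eval, hx], ?_⟩
      convert hch (s.arr 5 x) using 1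
      simp [push, Prog.run, Expr.eval, hx]
    · rw [Function.update_of_ne hj]
      convert hch j using 1
      simp [push, Prog.run, Expr.eval, hx, Function.update_of_ne hj]

/-- `x` is a visited neighbor of `v`, and visited before `v` if `v` is visited. -/
def VisitedNbr (adj : Fin n → List (Fin n)) (pos : Fin n → ℕ) (v x : Fin n) : Prop :=
  x ∈ adj v ∧ 0 < pos x ∧ (pos v = 0 ∨ pos x < pos v)

instance (pos : Fin n → ℕ) (v x : Fin n) : Decidable (VisitedNbr adj pos v x) := by
  unfold VisitedNbr
  infer_instance

/-- The invariant of the search after `vc` visits; unvisited vertices have position zero. -/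
structure MCSInv (adj : Fin n → List (Fin n)) (vc cur : ℕ) (pos w par : Fin n → ℕ)
    (ord : ℕ → ℕ) (b : ℕ → List (Fin n)) : Prop where
  pos_le : ∀ v, pos v ≤ vc
  ord_eq : ∀ i < vc, ∃ v : Fin n, ord i = v ∧ pos v = i + 1
  inj : ∀ u v, pos u ≠ 0 → pos u = pos v → u = v
  w_eq : ∀ v, w v = #{x | VisitedNbr adj pos v x}
  par_max : ∀ v x, VisitedNbr adj pos v x →
    ∃ p : Fin n, par v = p + 1 ∧ VisitedNbr adj pos v p ∧ pos x ≤ pos p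
  par_mem : ∀ v, par v ≠ 0 → ∃ p : Fin n, par v = p + 1 ∧ VisitedNbr adj pos v p
  mcs : ∀ v u a, pos v ≠ 0 → (pos u = 0 ∨ pos v < pos u) → 0 < pos a → pos a < pos v →
    a ∈ adj u → a ∉ adj v → ∃ d, 0 < pos d ∧ pos d < pos v ∧ d ∈ adj v ∧ d ∉ adj u
  mem_bucket : ∀ u, pos u = 0 → u ∈ b (w u)
  bucket_le : ∀ u j, u ∈ b j → j ≤ w u
  w_le : ∀ u, pos u = 0 → w u ≤ cur
  cur_le : cur ≤ vc

/-! ### Effect of a visit on the invariant of the search -/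

section Invariant

variable {vc cur : ℕ} {pos w par : Fin n → ℕ} {ord : ℕ → ℕ} {b : ℕ → List (Fin n)}

theorem MCSInv.exists_unvisited (h : MCSInv adj vc cur pos w par ord b) (hvc : vc < n) :
    ∃ u, pos u = 0 := by
  by_contra! hcon
  have : Fintype.card (Fin n) ≤ #(range vc) := by
    refine card_le_card_of_injOn (fun u => pos u - 1) (fun u _ => ?_) (fun u _ v _ he => ?_)
    · have := h.pos_le u
      have := hcon u
      simp only [coe_range, Set.mem_Iio]
      omega
    · have hu := hcon u
      have hv := hcon v
      exact h.inj u v hu (by dsimp only at he; omega)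
  simp at this
  omega

theorem MCSInv.pos_ne_zero (h : MCSInv adj n cur pos w par ord b) (v : Fin n) : pos v ≠ 0 := by
  choose f hf using fun i : Fin n => h.ord_eq i i.isLt
  have hinj : Function.Injective f := fun i j hij => by
    have h1 := (hf i).2
    have h2 := (hf j).2
    rw [hij] at h1
    exact Fin.ext (by omega)
  obtain ⟨i, rfl⟩ := (Finite.injective_iff_surjective.1 hinj) v
  rw [(hf i).2]
  omega

theorem MCSInv.w_lt (h : MCSInv adj vc cur pos w par ord b) (hadj : IsAdjList G adj) (v : Fin n) :
    w v < n := by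
  rw [h.w_eq]
  have : #{x | VisitedNbr adj pos v x} < #(univ : Finset (Fin n)) := by
    refine card_lt_card ⟨subset_univ _, fun hsub => ?_⟩
    have := (mem_filter.1 (hsub (mem_univ v))).2.1
    exact G.irrefl (((hadj v).2 v).1 this)
  simpa using this

/-- Visiting `v` changes the visited neighbors only of unvisited vertices, since `v` comes after
everything visited so far. Weights grow by at most one, so the bound `cur` need only grow by one. -/
theorem MCSInv.visit (h : MCSInv adj vc cur pos w par ord b) (hadj : IsAdjList G adj)
    {v : Fin n} (hv : pos v = 0) (hvb : v ∈ b cur) {pos' w' par' : Fin n → ℕ} {ord' : ℕ → ℕ}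
    {b' : ℕ → List (Fin n)} (hpos : pos' = Function.update pos v (vc + 1))
    (hord : ord' = Function.update ord vc v)
    (hw : ∀ u, w' u = w u + if u ∈ adj v ∧ pos' u = 0 then 1 else 0)
    (hpar : ∀ u, par' u = if u ∈ adj v ∧ pos' u = 0 then (v : ℕ) + 1 else par u)
    (hb1 : ∀ u, pos' u = 0 → u ∈ b' (w' u)) (hb2 : ∀ u j, u ∈ b' j → j ≤ w' u) :
    MCSInv adj (vc + 1) (cur + 1) pos' w' par' ord' b' := by
  have hsymm : ∀ u x, u ∈ adj x ↔ x ∈ adj u := fun u x => by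
    rw [(hadj x).2, (hadj u).2, G.adj_comm]
  have hirr : ∀ u, u ∉ adj u := fun u hu => G.irrefl (((hadj u).2 u).1 hu)
  have hpv : pos' v = vc + 1 := by simp [hpos]
  have hpu : ∀ u, u ≠ v → pos' u = pos u := fun u hu => by simp [hpos, hu]
  have hvis0 : ∀ u x, pos' u = 0 →
      (VisitedNbr adj pos' u x ↔ VisitedNbr adj pos u x ∨ (x = v ∧ u ∈ adj v)) := by
    intro u x hu
    have huv : u ≠ v := by rintro rfl; omega
    have hu0 : pos u = 0 := by rw [← hpu u huv, hu]
    by_cases hx : x = v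
    · subst hx
      simp [VisitedNbr, hu, hu0, hpv, hv, hsymm u x]
    · simp [VisitedNbr, hu, hu0, hpu x hx, hx]
  have hvis1 : ∀ u x, pos' u ≠ 0 → (VisitedNbr adj pos' u x ↔ VisitedNbr adj pos u x) := by
    intro u x hu
    by_cases huv : u = v
    · subst huv
      by_cases hx : x = u
      · subst hx
        simp [VisitedNbr, hirr]
      · have := h.pos_le x
        simp only [VisitedNbr, hpu x hx, hpv, hv]
        refine and_congr_right fun _ => and_congr_right fun _ => ?_
        simp
        omega
    · rw [hpu u huv] at hu
      by_cases hx : x = v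
      · subst hx
        have := h.pos_le u
        simp only [VisitedNbr, hpu u huv, hpv, hv]
        omega
      · simp only [VisitedNbr, hpu u huv, hpu x hx]
  refine ⟨fun u => ?_, fun i hi => ?_, fun u x hu hux => ?_, fun u => ?_, fun u x hx => ?_,
    fun u hu => ?_, fun y u a hy hu ha hay hau hay' => ?_, hb1, hb2, fun u hu => ?_, ?_⟩
  · by_cases hu : u = v
    · rw [hu, hpv]
    · rw [hpu u hu]
      exact (h.pos_le u).trans (Nat.le_succ _)
  · by_cases hiv : i = vc
    · exact ⟨v, by simp [hord, hiv], by rw [hpv, hiv]⟩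
    · obtain ⟨x, h1, h2⟩ := h.ord_eq i (by omega)
      refine ⟨x, by simp [hord, hiv, h1], ?_⟩
      rw [hpu x, h2]
      rintro rfl
      omega
  · have h1 := h.pos_le u
    have h2 := h.pos_le x
    by_cases huv : u = v <;> by_cases hxv : x = v
    · rw [huv, hxv]
    · rw [huv, hpv, hpu x hxv] at hux
      omega
    · rw [hxv, hpv, hpu u huv] at hux
      omega
    · rw [hpu u huv] at hu hux
      rw [hpu x hxv] at hux
      exact h.inj u x hu hux
  · rw [hw, h.w_eq]
    by_cases hu : pos' u = 0
    · have huv : u ≠ v := by rintro rfl; omega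
      by_cases huadj : u ∈ adj v
      · simp only [huadj, hu, and_self, if_true]
        have : ({x | VisitedNbr adj pos' u x} : Finset (Fin n)) =
            insert v ({x | VisitedNbr adj pos u x} : Finset (Fin n)) := by
          ext x
          simp [hvis0 u x hu, huadj, or_comm]
        rw [this, card_insert_of_notMem fun h' => by
          have := (mem_filter.1 h').2.2.1
          omega]
      · simp only [huadj, false_and, if_false, add_zero]
        congr 1
        ext x
        simp [hvis0 u x hu, huadj]
    · simp only [hu, and_false, if_false, add_zero]
      congr 1
      ext x
      simp [hvis1 u x hu]
  · rw [hpar]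
    by_cases hu : pos' u = 0
    · by_cases huadj : u ∈ adj v
      · simp only [huadj, hu, and_self, if_true]
        refine ⟨v, rfl, (hvis0 u v hu).2 (Or.inr ⟨rfl, huadj⟩), ?_⟩
        rw [hpv]
        by_cases hxv : x = v
        · rw [hxv, hpv]
        · rw [hpu x hxv]
          have := h.pos_le x
          omega
      · simp only [huadj, false_and, if_false]
        have hx' := ((hvis0 u x hu).1 hx).resolve_right (fun h' => huadj h'.2)
        obtain ⟨p, h1, h2, h3⟩ := h.par_max u x hx'
        refine ⟨p, h1, (hvis0 u p hu).2 (Or.inl h2), ?_⟩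
        rwa [hpu p (by rintro rfl; have := h2.2.1; omega),
          hpu x (by rintro rfl; have := hx'.2.1; omega)]
    · simp only [hu, and_false, if_false]
      have hx' := (hvis1 u x hu).1 hx
      obtain ⟨p, h1, h2, h3⟩ := h.par_max u x hx'
      refine ⟨p, h1, (hvis1 u p hu).2 h2, ?_⟩
      rwa [hpu p (by rintro rfl; have := h2.2.1; omega),
        hpu x (by rintro rfl; have := hx'.2.1; omega)]
  · rw [hpar] at hu ⊢
    split_ifs at hu ⊢ with hc
    · exact ⟨v, rfl, (hvis0 u v hc.2).2 (Or.inr ⟨rfl, hc.1⟩)⟩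
    · obtain ⟨p, h1, h2⟩ := h.par_mem u hu
      refine ⟨p, h1, ?_⟩
      by_cases hu' : pos' u = 0
      · exact (hvis0 u p hu').2 (Or.inl h2)
      · exact (hvis1 u p hu').2 h2
  · have hple := h.pos_le
    have hav : a ≠ v := by
      rintro rfl
      by_cases hya : y = a
      · rw [hya] at hay
        omega
      · rw [hpv, hpu y hya] at hay
        have := hple y
        omega
    rw [hpu a hav] at ha hay
    by_cases hyv : y = v
    · subst hyv
      have huy : u ≠ y := by
        rintro rfl
        omega
      have hu0 : pos u = 0 := by
        rw [hpv, hpu u huy] at hu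
        have := hple u
        omega
      obtain ⟨d, hd1, hd2⟩ : ∃ d ∈ ({x | VisitedNbr adj pos y x} : Finset (Fin n)),
          d ∉ ({x | VisitedNbr adj pos u x} : Finset (Fin n)) := by
        by_contra! hcon
        -- The reason why lazy deletion is correct: the chosen vertex comes from bucket `cur`, so
        -- its weight is at least `cur`, and no unvisited weight exceeds `cur`. If all visited
        -- neighbors of the chosen vertex were neighbors of `u`, the two sets would coincide, but
        -- `a` tells them apart.
        have h1 : w u ≤ w y := (h.w_le u hu0).trans (h.bucket_le y cur hvb)
        rw [h.w_eq, h.w_eq] at h1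
        have h2 := eq_of_subset_of_card_le
          (show ({x | VisitedNbr adj pos y x} : Finset (Fin n)) ⊆ _ from hcon) h1
        have h3 : a ∈ ({x | VisitedNbr adj pos u x} : Finset (Fin n)) := by
          simp [VisitedNbr, hau, ha, hu0]
        rw [← h2] at h3
        exact hay' (mem_filter.1 h3).2.1
      simp only [mem_filter, mem_univ, true_and, VisitedNbr, hv, hu0, true_or, and_true]
        at hd1 hd2
      have hdy : d ≠ y := by rintro rfl; omega
      refine ⟨d, ?_, ?_, hd1.1, fun h' => hd2 ⟨h', hd1.2⟩⟩
      · rw [hpu d hdy]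
        exact hd1.2
      · rw [hpu d hdy, hpv]
        have := hple d
        omega
    · rw [hpu y hyv] at hy hu hay
      have hu' : pos u = 0 ∨ pos y < pos u := by
        by_cases huv : u = v
        · rw [huv]
          exact Or.inl hv
        · rwa [hpu u huv] at hu
      obtain ⟨d, h1, h2, h3, h4⟩ := h.mcs y u a hy hu' ha hay hau hay'
      have hdv : d ≠ v := by rintro rfl; omega
      exact ⟨d, by rwa [hpu d hdv], by rwa [hpu d hdv, hpu y hyv], h3, h4⟩
  · have huv : u ≠ v := by rintro rfl; omega
    rw [hpu u huv] at hu
    have := h.w_le u hu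
    rw [hw]
    split_ifs <;> omega
  · have := h.cur_le
    omega

end Invariant

/-- Handle one neighbor of a newly visited vertex. -/
def visitNbr : Prog :=
  .cond (.load 4 (.reg 5)) .skip
    (.seq (.seq (.store 5 (.reg 5) (.add (.load 5 (.reg 5)) (.const 1)))
      (.store 6 (.reg 5) (.add (.reg 4) (.const 1)))) push)

/-- The vertices in the buckets are as required for the weights. -/
structure BucketInv (pos w : Fin n → ℕ) (b : ℕ → List (Fin n)) : Prop where
  mem : ∀ u, pos u = 0 → u ∈ b (w u)
  le : ∀ u j, u ∈ b j → j ≤ w u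

/-- The old entry of `x` stays in its bucket. This is harmless, because an entry only has to be in a
bucket not above the present weight. -/
theorem BucketInv.push {pos w : Fin n → ℕ} {b : ℕ → List (Fin n)} (h : BucketInv pos w b)
    (x : Fin n) : BucketInv pos (Function.update w x (w x + 1))
      (Function.update b (w x + 1) (x :: b (w x + 1))) := by
  constructor
  · intro u hu
    by_cases hux : u = x
    · subst hux
      simp
    · rw [Function.update_of_ne hux, Function.update_apply]
      have := h.mem u hu
      split_ifs with hw
      · rw [hw] at this
        exact List.mem_cons_of_mem _ this
      · exact this
  · intro u j huj
    rw [Function.update_apply] at huj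
    have key : u ∈ b j ∨ (u = x ∧ j = w x + 1) := by
      split_ifs at huj with hj
      · rw [hj]
        rcases List.mem_cons.1 huj with h' | h'
        · exact Or.inr ⟨h', rfl⟩
        · exact Or.inl h'
      · exact Or.inl huj
    rcases key with h' | ⟨rfl, rfl⟩
    · have := h.le u j h'
      rw [Function.update_apply]
      split_ifs with hux
      · rw [← hux]
        omega
      · exact this
    · simp

/-- The number of vertices in the first buckets. -/
def load (n : ℕ) (b : ℕ → List (Fin n)) : ℕ := ∑ j ∈ range (n + 1), (b j).length

theorem load_update {b : ℕ → List (Fin n)} {j : ℕ} (hj : j ≤ n) (xs : List (Fin n)) :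
    load n (Function.update b j xs) + (b j).length = load n b + xs.length := by
  unfold load
  rw [← Finset.add_sum_erase _ _ (mem_range.2 (Nat.lt_succ_of_le hj)),
    ← Finset.add_sum_erase (range (n + 1)) (fun j => (b j).length)
      (mem_range.2 (Nat.lt_succ_of_le hj))]
  rw [Function.update_self]
  have : ∑ x ∈ (range (n + 1)).erase j, (Function.update b j xs x).length =
      ∑ x ∈ (range (n + 1)).erase j, (b x).length :=
    sum_congr rfl fun i hi => by rw [Function.update_of_ne (mem_erase.1 hi).1]
  rw [this]
  omega

theorem update_coe (f : ℕ → ℕ) (x : Fin n) (y : ℕ) :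
    (fun u : Fin n => Function.update f x y u) = Function.update (fun u : Fin n => f u) x y := by
  funext u
  simp [Function.update_apply, Fin.ext_iff]

/-- Each neighbor contributes at most one new list node, which bounds the growth of the node counter
and of the bucket load by the degree. -/
theorem runs_visitNbrs {B : ℕ} {s : State} {v : Fin n} {b : ℕ → List (Fin n)}
    (hadj : HasAdj adj s) (hnd : (adj v).Nodup) (hv : s.reg 4 = v) (hb : Buckets b s)
    (hbi : BucketInv (fun u : Fin n => s.arr 4 u) (fun u : Fin n => s.arr 5 u) b)
    (hw : ∀ u : Fin n, s.arr 5 u < n) (hB : s.reg 8 + (adj v).length ≤ B) (hnB : n ≤ B) :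
    Runs B (forNbr 4 3 5 visitNbr) s (60 * (adj v).length + 11) fun s' =>
      (∀ u : Fin n, s'.arr 5 u = s.arr 5 u + if u ∈ adj v ∧ s.arr 4 u = 0 then 1 else 0) ∧
      (∀ u : Fin n, s'.arr 6 u = if u ∈ adj v ∧ s.arr 4 u = 0 then (v : ℕ) + 1 else s.arr 6 u) ∧
      s'.reg 8 ≤ s.reg 8 + (adj v).length ∧
      ∃ b', Buckets b' s' ∧
        BucketInv (fun u : Fin n => s.arr 4 u) (fun u : Fin n => s'.arr 5 u) b' ∧
        load n b' ≤ load n b + (adj v).length := by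
  refine Runs.forNbr (adj := adj) (v := v) (c := fun _ => 46) (I := fun pre s' =>
      (∀ u : Fin n, s'.arr 5 u = s.arr 5 u + if u ∈ pre ∧ s.arr 4 u = 0 then 1 else 0) ∧
      (∀ u : Fin n, s'.arr 6 u = if u ∈ pre ∧ s.arr 4 u = 0 then (v : ℕ) + 1 else s.arr 6 u) ∧
      s'.reg 8 ≤ s.reg 8 + pre.length ∧
      ∃ b', Buckets b' s' ∧
        BucketInv (fun u : Fin n => s.arr 4 u) (fun u : Fin n => s'.arr 5 u) b' ∧
        load n b' ≤ load n b + pre.length)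
    (by decide) (by decide) (by decide) (by decide) (by decide) (by decide) (by decide) hadj hv
    ?_ ?_ ?_ ?_
  · intro pre s' x h
    constructor
    · simpa [Buckets] using h
    · simpa [Buckets] using h
  · simp only [List.not_mem_nil, false_and, if_false, add_zero, implies_true, true_and,
      List.length_nil, le_refl]
    exact ⟨b, hb, hbi, le_rfl⟩
  · rintro pre x post s' hpp hs' hf hx ⟨h5, h6, h8, b', hb', hbi', hl'⟩
    have hf4 := hf.arr 4 (by decide)
    have hfv := hf.reg 4 (by decide)
    rw [hpp] at hnd hB
    have hxpre : x ∉ pre := fun h' => by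
      rw [List.nodup_append] at hnd
      exact hnd.2.2 _ h' _ (by simp) rfl
    have hlen : pre.length + 1 ≤ (pre ++ x :: post).length := by simp
    have hif : ∀ u : Fin n, u ≠ x → ((u ∈ pre ++ [x] ∧ s.arr 4 u = 0) ↔
        (u ∈ pre ∧ s.arr 4 u = 0)) := fun u hu => by simp [hu]
    refine Runs.cond (b₁ := 1) (b₂ := 36) (by decide) (fun hne => ?_) (fun heq => ?_) (by decide)
    · simp only [Expr.eval, hx, hf4] at hne
      have hif' : ∀ u : Fin n, ((u ∈ pre ++ [x] ∧ s.arr 4 u = 0) ↔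
          (u ∈ pre ∧ s.arr 4 u = 0)) := fun u => by
        by_cases hu : u = x
        · subst hu; simp [hne]
        · exact hif u hu
      refine Runs.flat (by decide) (by decide) (fun _ => trivial)
        (fun _ => ⟨fun u => ?_, fun u => ?_, ?_, b', hb', hbi', ?_⟩)
      · simp only [Prog.run, h5 u, hif']
      · simp only [Prog.run, h6 u, hif']
      · simp only [Prog.run, List.length_append, List.length_singleton]
        omega
      · simp only [List.length_append]
        omega
    · simp only [Expr.eval, hx, hf4] at heq
      have hwx : s'.arr 5 x = s.arr 5 x := by simp [h5 x, hxpre]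
      have hwxn := hw x
      have hvn := v.isLt
      refine Runs.seq (b₁ := 14) (b₂ := 20) (Q := fun s'' => s''.reg = s'.reg ∧
          s''.arr 5 = Function.update (s'.arr 5) x (s'.arr 5 x + 1) ∧
          s''.arr 6 = Function.update (s'.arr 6) x (v + 1))
        (Runs.flat (by decide) (by decide) (fun hs => ?_) (fun hs => ?_))
        (fun s'' hs'' hf'' hQ => ?_) (by decide)
      · simp only [Prog.safe, Expr.storable, Expr.eval, hx, Prog.run, State.setArr_reg, hfv, hv,
          hwx]
        omega
      · simp [Prog.run, Expr.eval, hx, hfv, hv]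
      · obtain ⟨q1, q2, q3⟩ := hQ
        have q8 := hf''.arr 8 (by decide)
        have q9 := hf''.arr 9 (by decide)
        have q10 := hf''.arr 10 (by decide)
        have hw1 : s''.arr 5 x = s'.arr 5 x + 1 := by simp [q2]
        refine (runs_push (b := b') (x := x) (by rw [q1, hx])
          (hb'.congr (by rw [q1]) q8 q9 q10) (by rw [q1]; omega)).mono (by decide) ?_
        rintro s₃ hs₃ hf₃ ⟨r8, rb⟩
        have r5 := hf₃.arr 5 (by decide)
        have r6 := hf₃.arr 6 (by decide)
        refine ⟨fun u => ?_, fun u => ?_, ?_, _, rb, ?_, ?_⟩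
        · rw [r5, q2]
          by_cases hu : u = x
          · subst hu
            simp [heq, h5 u, hxpre]
          · rw [Function.update_of_ne (by simpa [Fin.ext_iff] using hu), h5 u]
            simp only [hif u hu]
        · rw [r6, q3]
          by_cases hu : u = x
          · subst hu
            simp [heq]
          · rw [Function.update_of_ne (by simpa [Fin.ext_iff] using hu), h6 u]
            simp only [hif u hu]
        · rw [r8, q1]
          simp only [List.length_append, List.length_singleton]
          omega
        · rw [hw1, r5, q2, update_coe]
          exact hbi'.push x
        -- The new weight is at most `n`, so the bucket is among those counted in `load`.
        · have := load_update (b := b') (j := s''.arr 5 x) (by omega) (x :: b' (s''.arr 5 x))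
          simp only [List.length_cons, List.length_append, List.length_nil] at this ⊢
          omega
  · simp only [List.map_const', List.sum_replicate, smul_eq_mul]
    omega

end Search

/-! ### Amortized running time of the search -/

section Search

variable {n : ℕ} {G : SimpleGraph (Fin n)} {adj : Fin n → List (Fin n)}

/-- Take the first vertex from the highest bucket, and visit it unless this has been done. -/
def searchStep : Prog :=
  .cond (.load 8 (.reg 9))
    (.seq (.seq (.assign 4 (.load 10 (.load 8 (.reg 9))))
        (.store 8 (.reg 9) (.load 9 (.load 8 (.reg 9)))))
      (.cond (.load 4 (.reg 4)) .skip
        (.seq (.seq (.store 7 (.reg 10) (.reg 4))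
            (.seq (.assign 10 (.add (.reg 10) (.const 1)))
            (.seq (.store 4 (.reg 4) (.reg 10))
              (.assign 9 (.add (.reg 9) (.const 1))))))
          (forNbr 4 3 5 visitNbr))))
    (.assign 9 (.sub (.reg 9) (.const 1)))

/-- Visit all vertices. -/
def search : Prog :=
  .seq (forTo 2 0 (.seq (.assign 5 (.reg 2)) push))
    (.loop (.sub (.reg 0) (.reg 10)) searchStep)

/-- The number of edge ends. -/
def degSum (adj : Fin n → List (Fin n)) : ℕ := ∑ v, (adj v).length

/-- The weight of the unvisited vertices in the running time. -/
def unvisited (adj : Fin n → List (Fin n)) (pos : Fin n → ℕ) : ℕ :=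
  ∑ v, if pos v = 0 then (adj v).length + 1 else 0

theorem unvisited_update {pos : Fin n → ℕ} {v : Fin n} (hv : pos v = 0) {x : ℕ} (hx : x ≠ 0) :
    unvisited adj (Function.update pos v x) + (adj v).length + 1 = unvisited adj pos := by
  unfold unvisited
  rw [← Finset.add_sum_erase univ _ (mem_univ v),
    ← Finset.add_sum_erase univ (fun v => if pos v = 0 then (adj v).length + 1 else 0)
      (mem_univ v)]
  have : ∑ u ∈ univ.erase v, (if Function.update pos v x u = 0 then (adj u).length + 1 else 0) =
      ∑ u ∈ univ.erase v, if pos u = 0 then (adj u).length + 1 else 0 :=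
    sum_congr rfl fun i hi => by rw [Function.update_of_ne (mem_erase.1 hi).1]
  rw [this]
  simp only [Function.update_self, hx, hv, if_true, if_false]
  omega

/-- The invariant of the search in terms of the memory contents. -/
def SearchInv (adj : Fin n → List (Fin n)) (b : ℕ → List (Fin n)) (s : State) : Prop :=
  Buckets b s ∧ MCSInv adj (s.reg 10) (s.reg 9) (fun v : Fin n => s.arr 4 v)
    (fun v : Fin n => s.arr 5 v) (fun v : Fin n => s.arr 6 v) (s.arr 7) b

/-- The potential is `50` times the bucket load plus the cursor, and `200` times the degrees plus
one of the unvisited vertices. An empty bucket lowers the cursor, and a stale entry lowers the load.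
A visit lowers the third term by `200 (deg + 1)`, which pays for its scan and for the increase of
load and cursor. The bound on `s.reg 8` keeps node numbers within a word. -/
theorem runs_searchStep {B : ℕ} {s : State} {b : ℕ → List (Fin n)} (hadj : HasAdj adj s)
    (hG : IsAdjList G adj) (h : SearchInv adj b s) (hlt : s.reg 10 < n)
    (hcnt : s.reg 8 + unvisited adj (fun v : Fin n => s.arr 4 v) ≤ degSum adj + 2 * n - s.reg 10)
    (hB : degSum adj + 2 * n + 1 ≤ B) :
    ∃ t, Runs B searchStep s t fun s' => s'.reg 10 ≤ n ∧
      s'.reg 8 + unvisited adj (fun v : Fin n => s'.arr 4 v) ≤ degSum adj + 2 * n - s'.reg 10 ∧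
      ∃ b', SearchInv adj b' s' ∧
        t + 4 + 50 * (load n b' + s'.reg 9) +
            200 * unvisited adj (fun v : Fin n => s'.arr 4 v) ≤
          50 * (load n b + s.reg 9) + 200 * unvisited adj (fun v : Fin n => s.arr 4 v) := by
  obtain ⟨hb, hm⟩ := h
  obtain ⟨u, hu⟩ := hm.exists_unvisited hlt
  have hcurn : s.reg 9 ≤ n := hm.cur_le.trans hlt.le
  by_cases hhead : s.arr 8 (s.reg 9) = 0
  · -- the bucket is empty
    have hbe : b (s.reg 9) = [] := by
      have := hb (s.reg 9)
      rcases hbb : b (s.reg 9) with _ | ⟨x, xs⟩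
      · rfl
      · rw [hbb] at this
        exact absurd hhead this.1
    have hne : ∀ u : Fin n, s.arr 4 u = 0 → s.arr 5 u ≠ s.reg 9 := fun u hu he => by
      have := hm.mem_bucket u hu
      simp [he, hbe] at this
    -- Some unvisited vertex has weight at most the cursor, but not equal to it, so the cursor can
    -- be lowered.
    have hpos : 0 < s.reg 9 := by
      have := hm.w_le u hu
      have := hne u hu
      omega
    refine ⟨9, Runs.cond (b₁ := 0) (b₂ := 4) (by decide) (fun h' => absurd hhead h')
      (fun _ => Runs.flat (by decide) (by decide) (fun _ => Or.inl trivial) fun _ => ?_)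
      (by decide)⟩
    have e : Prog.run (.assign 9 (.sub (.reg 9) (.const 1))) s = s.setReg 9 (s.reg 9 - 1) := rfl
    rw [e]
    refine ⟨by simpa using hlt.le, by simpa using hcnt, b, ⟨by simpa [Buckets] using hb, ?_⟩, ?_⟩
    · refine ⟨by simpa using hm.pos_le, by simpa using hm.ord_eq, by simpa using hm.inj,
        fun u => hm.w_eq u, by simpa using hm.par_max, by simpa using hm.par_mem,
        by simpa using hm.mcs, by simpa using hm.mem_bucket, by simpa using hm.bucket_le,
        fun u hu => ?_, ?_⟩
      · have := hm.w_le u hu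
        have := hne u hu
        simp only [State.setReg_arr, State.setReg_reg, if_true] at *
        omega
      · have := hm.cur_le
        simp only [State.setReg_reg, if_true]
        norm_num
        omega
    · simp only [State.setReg_arr, State.setReg_reg, if_true]
      omega
  · obtain ⟨v, xs, hbb⟩ : ∃ v xs, b (s.reg 9) = v :: xs := by
      rcases hbb : b (s.reg 9) with _ | ⟨x, xs⟩
      · have := hb (s.reg 9)
        rw [hbb] at this
        exact absurd this hhead
      · exact ⟨x, xs, rfl⟩
    have hch := hb (s.reg 9)
    rw [hbb] at hch
    obtain ⟨-, hle, hvt, hrest⟩ := hch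
    have hload := load_update (b := b) hcurn xs
    rw [hbb, List.length_cons] at hload
    -- the state after the first vertex has been taken from the bucket
    have hpop : Runs B (.seq (.assign 4 (.load 10 (.load 8 (.reg 9))))
        (.store 8 (.reg 9) (.load 9 (.load 8 (.reg 9))))) s 12 fun s' => s'.reg 4 = v ∧
          (∀ r, r ≠ 4 → s'.reg r = s.reg r) ∧ (∀ a, a ≠ 8 → s'.arr a = s.arr a) ∧
          Buckets (Function.update b (s.reg 9) xs) s' := by
      refine Runs.flat (by decide) (by decide) (fun _ => by simp [Prog.safe, Expr.storable])
        (fun _ => ⟨?_, fun r hr => ?_, fun a ha => ?_, fun j => ?_⟩)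
      · simp [Prog.run, Expr.eval, hvt]
      · simp [Prog.run, hr]
      · simp [Prog.run, ha]
      · simp only [Prog.run, Expr.eval, State.setArr_arr, State.setReg_arr, State.setReg_reg,
          State.setArr_reg]
        by_cases hj : j = s.reg 9
        · subst hj
          simpa using hrest
        · simpa [Function.update_of_ne hj] using hb j
    by_cases hvis : s.arr 4 v = 0
    · -- a new vertex is visited
      have hum := unvisited_update (adj := adj) (pos := fun v : Fin n => s.arr 4 v) hvis
        (x := s.reg 10 + 1) (by omega)
      have hdeg : s.reg 8 + (adj v).length ≤ B := by omega
      refine ⟨60 * (adj v).length + 60, Runs.cond (b₁ := 60 * (adj v).length + 50) (b₂ := 0)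
        (by decide) (fun _ => ?_) (fun h' => absurd h' hhead) (by simp [Expr.cost]; omega)⟩
      refine hpop.seq (b₂ := 60 * (adj v).length + 38) (fun s₁ hs₁ hf₁ ⟨p1, p2, p3, p4⟩ => ?_)
        (by omega)
      refine Runs.cond (b₁ := 0) (b₂ := 60 * (adj v).length + 34) (by decide)
        (fun h' => absurd (by simp [Expr.eval, p1, p3, hvis]) h') (fun _ => ?_)
        (by simp [Expr.cost]; omega)
      refine Runs.seq (b₁ := 23) (b₂ := 60 * (adj v).length + 11) (Q := fun s' =>
          s'.reg 10 = s.reg 10 + 1 ∧ s'.reg 9 = s.reg 9 + 1 ∧ s'.reg 4 = v ∧ s'.reg 8 = s.reg 8 ∧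
          s'.arr 7 = Function.update (s.arr 7) (s.reg 10) v ∧
          s'.arr 4 = Function.update (s.arr 4) v (s.reg 10 + 1))
        (Runs.flat (by decide) (by decide) (fun hs => ?_) (fun hs => ?_))
        (fun s₂ hs₂ hf₂ hQ => ?_) (by omega)
      · have := p2 9 (by decide)
        have := p2 10 (by decide)
        simp [Prog.safe, Expr.storable, Expr.eval, Prog.run]
        omega
      · simp [Prog.run, Expr.eval, p1, p2, p3]
      obtain ⟨q1, q2, q3, q4, q5, q6⟩ := hQ
      have a5 := (hf₂.arr 5 (by decide)).trans (p3 5 (by decide))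
      have a6 := (hf₂.arr 6 (by decide)).trans (p3 6 (by decide))
      have hpos' : (fun u : Fin n => s₂.arr 4 u) =
          Function.update (fun u : Fin n => s.arr 4 u) v (s.reg 10 + 1) := by
        rw [q6, update_coe]
      have hb₂ : Buckets (Function.update b (s.reg 9) xs) s₂ :=
        p4.congr (by rw [q4, p2 8 (by decide)]) (hf₂.arr 8 (by decide)) (hf₂.arr 9 (by decide))
          (hf₂.arr 10 (by decide))
      have hbi : BucketInv (fun u : Fin n => s₂.arr 4 u) (fun u : Fin n => s₂.arr 5 u)
          (Function.update b (s.reg 9) xs) := by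
        rw [hpos', a5]
        constructor
        · intro u hu
          have huv : u ≠ v := by
            rintro rfl
            simp at hu
          rw [Function.update_of_ne huv] at hu
          have := hm.mem_bucket u hu
          by_cases hj : s.arr 5 u = s.reg 9
          · rw [hj, hbb] at this
            rw [hj, Function.update_self]
            exact (List.mem_cons.1 this).resolve_left huv
          · rwa [Function.update_of_ne hj]
        · intro u j hu
          refine hm.bucket_le u j ?_
          by_cases hj : j = s.reg 9
          · rw [hj, Function.update_self] at hu
            rw [hj, hbb]
            exact List.mem_cons_of_mem _ hu
          · rwa [Function.update_of_ne hj] at hu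
      have hadj₂ : HasAdj adj s₂ := by
        have e0 := (hf₂.arr 0 (by decide)).trans (p3 0 (by decide))
        have e1 := (hf₂.arr 1 (by decide)).trans (p3 1 (by decide))
        unfold HasAdj
        rw [e0, e1]
        exact hadj
      refine (runs_visitNbrs hadj₂ (hG v).1 q3 hb₂ hbi (fun u => by rw [a5]; exact hm.w_lt hG u)
        (by omega) (by omega)).mono le_rfl ?_
      rintro s₃ hs₃ hf₃ ⟨r5, r6, r8, b', hb', hbi', hl'⟩
      have c9 := (hf₃.reg 9 (by decide)).trans q2
      have c10 := (hf₃.reg 10 (by decide)).trans q1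
      have c4 := hf₃.arr 4 (by decide)
      have c7 := (hf₃.arr 7 (by decide)).trans q5
      have hvb : v ∈ b (s.reg 9) := by simp [hbb]
      have hpos₃ : (fun u : Fin n => s₃.arr 4 u) =
          Function.update (fun u : Fin n => s.arr 4 u) v (s.reg 10 + 1) := by rw [c4, hpos']
      refine ⟨by omega, ?_, b', ⟨hb', ?_⟩, ?_⟩
      · rw [hpos₃, c10]
        omega
      · rw [c9, c10]
        refine hm.visit hG hvis hvb hpos₃ c7 (fun u => ?_) (fun u => ?_)
          (fun u hu => hbi'.mem u (by rwa [← c4])) hbi'.le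
        · rw [r5, a5, c4]
        · rw [r6, a6, c4]
      · rw [hpos₃, c9]
        omega
    · refine ⟨40, Runs.cond (b₁ := 30) (b₂ := 0)
        (by decide) (fun _ => ?_) (fun h' => absurd h' hhead) (by simp [Expr.cost])⟩
      refine hpop.seq (b₂ := 10) (fun s₁ hs₁ hf₁ ⟨p1, p2, p3, p4⟩ => ?_) (by omega)
      refine Runs.cond (b₁ := 1) (b₂ := 0) (by decide)
        (fun _ => ?_) (fun h' => absurd h' (by simpa [Expr.eval, p1, p3] using hvis))
        (by simp [Expr.cost])
      refine Runs.flat (by decide) (by decide) (fun _ => trivial) fun _ => ?_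
      rw [Prog.run, p2 10 (by decide), p2 8 (by decide), p2 9 (by decide), p3 4 (by decide)]
      refine ⟨hlt.le, hcnt, _, ⟨p4, ?_⟩, ?_⟩
      · rw [p2 10 (by decide), p2 9 (by decide), p3 4 (by decide), p3 5 (by decide),
          p3 6 (by decide), p3 7 (by decide)]
        refine ⟨hm.pos_le, hm.ord_eq, hm.inj, hm.w_eq, hm.par_max, hm.par_mem, hm.mcs,
          fun u hu => ?_, fun u j hu => hm.bucket_le u j ?_, hm.w_le, hm.cur_le⟩
        · have := hm.mem_bucket u hu
          by_cases hj : s.arr 5 u = s.reg 9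
          · rw [hj, hbb] at this
            rw [hj, Function.update_self]
            refine (List.mem_cons.1 this).resolve_left ?_
            rintro rfl
            exact hvis hu
          · rwa [Function.update_of_ne hj]
        · by_cases hj : j = s.reg 9
          · rw [hj, Function.update_self] at hu
            rw [hj, hbb]
            exact List.mem_cons_of_mem _ hu
          · rwa [Function.update_of_ne hj] at hu
      · omega

/-- The result of the search: the vertices are ordered, and their numbers of earlier neighbors
and their parents are known. -/
structure Searched (G : SimpleGraph (Fin n)) (s : State) : Prop where
  pos_pos : ∀ v : Fin n, 1 ≤ s.arr 4 v
  pos_le : ∀ v : Fin n, s.arr 4 v ≤ n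
  ord_eq : ∀ i < n, ∃ v : Fin n, s.arr 7 i = v ∧ s.arr 4 v = i + 1
  inj : Function.Injective fun v : Fin n => s.arr 4 v
  mcs : IsMCS G fun v : Fin n => s.arr 4 v
  weight : ∀ v : Fin n, s.arr 5 v = #(earlier G (fun v : Fin n => s.arr 4 v) v)
  par : ∀ v p : Fin n, s.arr 6 v = p + 1 ↔ IsPar G (fun v : Fin n => s.arr 4 v) p v

/-- After `n` visits no position is zero, so visited neighbors are the same as earlier neighbors. -/
theorem SearchInv.searched {b : ℕ → List (Fin n)} {s : State} (h : SearchInv adj b s)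
    (hG : IsAdjList G adj) (hn : s.reg 10 = n) : Searched G s := by
  obtain ⟨-, hm⟩ := h
  rw [hn] at hm
  have h0 := hm.pos_ne_zero
  have hinj : Function.Injective fun v : Fin n => s.arr 4 v := fun u v he => hm.inj u v (h0 u) he
  have hvis : ∀ v x, VisitedNbr adj (fun v : Fin n => s.arr 4 v) v x ↔
      x ∈ earlier G (fun v : Fin n => s.arr 4 v) v := fun v x => by
    have hv := h0 v
    have hx := h0 x
    rw [mem_earlier, VisitedNbr, (hG v).2, G.adj_comm]
    refine and_congr_right fun _ => ?_
    omega
  refine ⟨fun v => Nat.one_le_iff_ne_zero.2 (h0 v), hm.pos_le, hm.ord_eq, hinj, ?_, fun v => ?_,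
    fun v p => ⟨fun he => ?_, fun hp => ?_⟩⟩
  · intro v u hvu a ha hau hav
    obtain ⟨d, h1, h2, h3, h4⟩ := hm.mcs v u a (h0 v) (Or.inr hvu)
      (Nat.pos_of_ne_zero (h0 a)) ha (((hG u).2 a).2 hau.symm)
      (fun h' => hav (((hG v).2 a).1 h').symm)
    exact ⟨d, h2, (((hG v).2 d).1 h3).symm, fun h' => h4 (((hG u).2 d).2 h'.symm)⟩
  · rw [hm.w_eq]
    congr 1
    ext x
    rw [mem_filter, hvis]
    simp
  · obtain ⟨q, h1, h2⟩ := hm.par_mem v (by omega)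
    have hqp : q = p := by
      exact Fin.ext (by omega)
    subst hqp
    refine ⟨(hvis v q).1 h2, fun x hx => ?_⟩
    obtain ⟨q', g1, g2, g3⟩ := hm.par_max v x ((hvis v x).2 hx)
    have : q' = q := by
      exact Fin.ext (by omega)
    rwa [this] at g3
  · obtain ⟨q, g1, g2, g3⟩ := hm.par_max v p ((hvis v p).2 hp.1)
    have : q = p := hinj (le_antisymm (hp.2 q ((hvis v q).1 g2)) g3)
    rw [← this]
    exact g1

theorem runs_search {B : ℕ} {s : State} (hadj : HasAdj adj s)
    (hG : IsAdjList G adj) (hn : s.reg 0 = n) (hB : degSum adj + 2 * n + 1 ≤ B)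
    (h8 : s.reg 8 = 0) (h9 : s.reg 9 = 0) (h10 : s.reg 10 = 0)
    (ha : ∀ a, 4 ≤ a → ∀ i, s.arr a i = 0) :
    Runs B search s (200 * degSum adj + 300 * n + 20) (Searched G) := by
  refine Runs.seq (b₁ := 31 * n + 6) (b₂ := 200 * degSum adj + 260 * n + 10)
    (Q := fun s' => s'.reg 8 = n ∧ ∃ b : ℕ → List (Fin n), Buckets b s' ∧ (∀ u, u ∈ b 0) ∧
      (∀ j, j ≠ 0 → b j = []) ∧ (b 0).length = n) ?_ ?_ (by omega)
  · refine (Runs.forTo (N := n) (c := fun _ => 23) (I := fun i s' => s'.reg 8 = i ∧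
      ∃ b : ℕ → List (Fin n), Buckets b s' ∧ (∀ u : Fin n, u.val < i → u ∈ b 0) ∧
      (∀ j, j ≠ 0 → b j = []) ∧ (b 0).length = i) (by decide) (by decide) (by decide) hn
      ?_ ?_ ?_ ?_).mono le_rfl ?_
    · rintro i s' x ⟨h1, b, h2, h3⟩
      exact ⟨by simpa using h1, b, by simpa [Buckets] using h2, h3⟩
    · refine ⟨h8, fun _ => [], fun j => ?_, by simp, by simp, rfl⟩
      exact ha 8 (by decide) j
    · rintro i s' hi hs' hf h2 ⟨h1, b, hb, hb1, hb2, hb3⟩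
      have ha5 : ∀ j, s'.arr 5 j = 0 := fun j => by
        rw [hf.arr 5 (by decide)]
        exact ha 5 (by decide) j
      refine Runs.seq (b₁ := 2) (b₂ := 20) (Q := fun s'' => s'' = s'.setReg 5 i)
        (Runs.flat (by decide) (by decide) (fun _ => trivial)
          (fun _ => by simp [Prog.run, Expr.eval, h2])) ?_ (by omega)
      rintro s₂ hs₂ hf₂ rfl
      refine (runs_push (x := (⟨i, hi⟩ : Fin n)) (by simp) (b := b) (by simpa [Buckets] using hb)
        (by simp [h1]; omega)).mono le_rfl ?_
      rintro s₃ hs₃ hf₃ ⟨r8, rb⟩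
      simp only [State.setReg_arr, ha5] at rb
      refine ⟨by simp [r8, h1], _, rb, fun u hu => ?_, fun j hj => ?_, ?_⟩
      · rw [Function.update_self, List.mem_cons]
        by_cases hui : u.val = i
        · exact Or.inl (Fin.ext hui)
        · exact Or.inr (hb1 u (by omega))
      · rw [Function.update_of_ne hj]
        exact hb2 j hj
      · simp [hb3]
    · simp only [sum_const, card_range, smul_eq_mul]
      omega
    · rintro s' hs' hf ⟨h1, b, h2, h3, h4, h5⟩
      exact ⟨h1, b, h2, fun u => h3 u u.isLt, h4, h5⟩
  · rintro s₁ hs₁ hf₁ ⟨g8, b, hb, hb1, hb2, hb3⟩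
    have z : ∀ a, 4 ≤ a → a < 8 → ∀ i, s₁.arr a i = 0 := fun a h4 h7 i => by
      rw [hf₁.arr a (by
        intro h'
        simp [Prog.writesArr, forTo, push] at h'
        omega)]
      exact ha a h4 i
    have g0 := (hf₁.reg 0 (by decide)).trans hn
    have g9 := (hf₁.reg 9 (by decide)).trans h9
    have g10 := (hf₁.reg 10 (by decide)).trans h10
    have hadj₁ : HasAdj adj s₁ := by
      unfold HasAdj
      rw [hf₁.arr 0 (by decide), hf₁.arr 1 (by decide)]
      exact hadj
    have hload : load n b = n := by
      unfold load
      rw [sum_eq_single 0 (fun j _ hj => by simp [hb2 j hj]) (by simp), hb3]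
    have hunv : unvisited adj (fun v : Fin n => s₁.arr 4 v) = degSum adj + n := by
      unfold unvisited degSum
      simp [z 4 (by decide) (by decide), sum_add_distrib]
    have hvis : ∀ v x : Fin n, ¬ VisitedNbr adj (fun v : Fin n => s₁.arr 4 v) v x := by
      intro v x h'
      have := h'.2.1
      simp [z 4 (by decide) (by decide)] at this
    have hinv : SearchInv adj b s₁ := by
      have z4 := z 4 (by decide) (by decide)
      have z5 := z 5 (by decide) (by decide)
      have z6 := z 6 (by decide) (by decide)
      refine ⟨hb, ⟨by simp [z4], by simp [g10], fun u v h' => absurd (z4 u) h', fun v => ?_,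
        fun v x h' => absurd h' (hvis v x), fun v h' => absurd (z6 v) h',
        fun v u a h' => absurd (z4 v) h', fun u _ => ?_, fun u j hu => ?_, by simp [z5],
        by simp [g9]⟩⟩
      · simp [z5, hvis]
      · simp [z5, hb1]
      · by_cases hj : j = 0
        · omega
        · simp [hb2 j hj] at hu
    -- At the start there are `n` entries, all in bucket zero, the cursor is zero and nothing is
    -- visited; the extra `10` pays for the last test.
    refine (Runs.loop (B := B) (s := s₁) (I := fun φ s' => s'.reg 10 ≤ n ∧
      s'.reg 8 + unvisited adj (fun v : Fin n => s'.arr 4 v) ≤ degSum adj + 2 * n - s'.reg 10 ∧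
      ∃ b', SearchInv adj b' s' ∧ 50 * (load n b' + s'.reg 9) +
        200 * unvisited adj (fun v : Fin n => s'.arr 4 v) + 10 = φ)
      (φ := 50 * n + 200 * (degSum adj + n) + 10) (by decide) ?_ ?_ ?_).mono (by omega) ?_
    · exact ⟨by omega, by rw [hunv, g8, g10]; omega, b, hinv, by rw [hload, hunv, g9]; omega⟩
    · rintro φ s' hs' hf ⟨i1, i2, b', i3, rfl⟩ hne
      have f0 := (hf.reg 0 (by decide)).trans g0
      simp only [Expr.eval, f0] at hne
      have hadj' : HasAdj adj s' := by
        unfold HasAdj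
        rw [hf.arr 0 (by decide), hf.arr 1 (by decide)]
        exact hadj₁
      obtain ⟨t, ht⟩ := runs_searchStep (B := B) hadj' hG i3 (by omega) i2 hB
      refine ⟨t, ht.mono le_rfl ?_⟩
      rintro s'' hs'' hf'' ⟨j1, j2, b'', j3, j4⟩
      refine ⟨_, ⟨j1, j2, b'', j3, rfl⟩, ?_⟩
      simp only [Expr.cost]
      omega
    · rintro φ s' ⟨i1, i2, b', i3, rfl⟩ -
      simp only [Expr.cost]
      omega
    · rintro s' hs' hf ⟨he, φ, i1, i2, b', i3, -⟩
      have f0 := (hf.reg 0 (by decide)).trans g0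
      simp only [Expr.eval, f0] at he
      exact i3.searched hG (by omega)

end Search

/-! ### Subtrees that meet the cliques, and keys of the separators -/

section Keys

variable {n : ℕ} {G : SimpleGraph (Fin n)} {adj : Fin n → List (Fin n)}

/-- Array `a` holds the characteristic vector of `C`. -/
def HasSet (a : ℕ) (C : Finset (Fin n)) (s : State) : Prop := ∀ v : Fin n, s.arr a v ≠ 0 ↔ v ∈ C

/-- The position of a vertex in the order found by the search. -/
def posOf (n : ℕ) (s : State) (v : Fin n) : ℕ := s.arr 4 v

/-- Test whether the subtree of the vertex in register `4` meets the set in array `c`, the marks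
being in array `m`. -/
def isMarked (m c : ℕ) : Expr := .add (.load m (.add (.reg 4) (.const 1))) (.load c (.reg 4))

/-- Mark in array `m` all vertices that have a proper descendant in the set in array `c`. -/
def markLoop (m c : ℕ) : Prog :=
  forTo 2 0 (.seq (.assign 4 (.load 7 (.sub (.sub (.reg 0) (.reg 2)) (.const 1))))
    (.cond (isMarked m c) (.store m (.load 6 (.reg 4)) (.const 1)) .skip))

theorem hits_iff {pos : Fin n → ℕ} {v : Fin n} {C : Finset (Fin n)} :
    Hits G pos v C ↔ v ∈ C ∨ ∃ u, IsPar G pos v u ∧ Hits G pos u C := by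
  constructor
  · rintro ⟨c, hc, hvc⟩
    rcases Relation.ReflTransGen.cases_head hvc with rfl | ⟨u, h1, h2⟩
    · exact Or.inl hc
    · exact Or.inr ⟨u, h1, c, hc, h2⟩
  · rintro (h | ⟨u, h1, c, hc, h2⟩)
    · exact ⟨v, h, Relation.ReflTransGen.refl⟩
    · exact ⟨c, hc, Relation.ReflTransGen.head h1 h2⟩

/-- Marks are passed from children to parents, from the last vertex to the first, so that the mark
of a vertex is final when it is read. -/
theorem runs_markLoop {B m c : ℕ} {s : State} {C : Finset (Fin n)} (hm : 8 ≤ m) (hmc : c ≠ m)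
    (hn : s.reg 0 = n) (hs : Searched G s) (hC : HasSet c C s)
    (hz : ∀ i, s.arr m i = 0) :
    Runs B (markLoop m c) s (40 * n + 6) fun s' =>
      ∀ v : Fin n, s'.arr m (v + 1) + s'.arr c v ≠ 0 ↔ Hits G (posOf n s) v C := by
  have hwr : ∀ a, a ≠ m → a ∉ (markLoop m c).writesArr := fun a ha => by
    simp [markLoop, forTo, Prog.writesArr, ha]
  refine (Runs.forTo (N := n) (c := fun _ => 30) (I := fun i s' => ∀ v : Fin n,
    s'.arr m (v + 1) ≠ 0 ↔ ∃ u : Fin n, n < s.arr 4 u + i ∧ IsPar G (posOf n s) v u ∧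
      Hits G (posOf n s) u C) (by simp [Prog.writesReg]) (by simp [Prog.writesReg]) (by decide) hn
    ?_ ?_ ?_ ?_).mono le_rfl ?_
  · exact fun i s' x h => h
  · intro v
    simp only [hz, ne_eq, not_true_eq_false, false_iff]
    rintro ⟨u, h1, -⟩
    have := hs.pos_le u
    omega
  · intro i s' hi hs' hf h2 hI
    have f0 := (hf.reg 0 (by simp [forTo, Prog.writesReg])).trans hn
    have f4 := hf.arr 4 (hwr 4 (by omega))
    have f6 := hf.arr 6 (hwr 6 (by omega))
    have f7 := hf.arr 7 (hwr 7 (by omega))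
    have fc := hf.arr c (hwr c hmc)
    -- Round `i` handles the vertex at position `n - i`, since positions start at one.
    obtain ⟨u, hu1, hu2⟩ := hs.ord_eq (n - i - 1) (by omega)
    have hmark : s'.arr m (u + 1) + s'.arr c u ≠ 0 ↔ Hits G (posOf n s) u C := by
      rw [hits_iff, ← hC u, fc]
      have : s'.arr m (u + 1) ≠ 0 ↔ ∃ x, IsPar G (posOf n s) u x ∧ Hits G (posOf n s) x C := by
        rw [hI u]
        refine exists_congr fun x => ⟨fun h => h.2, fun h => ⟨?_, h⟩⟩
        have := (mem_earlier.1 h.1.1).2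
        simp only [posOf] at this
        omega
      rw [← this]
      omega
    have hnew : ∀ v : Fin n, (∃ x : Fin n, n < s.arr 4 x + (i + 1) ∧ IsPar G (posOf n s) v x ∧
        Hits G (posOf n s) x C) ↔ ((∃ x : Fin n, n < s.arr 4 x + i ∧ IsPar G (posOf n s) v x ∧
        Hits G (posOf n s) x C) ∨ (IsPar G (posOf n s) v u ∧ Hits G (posOf n s) u C)) := by
      intro v
      constructor
      · rintro ⟨x, h1, h2⟩
        by_cases hx : n < s.arr 4 x + i
        · exact Or.inl ⟨x, hx, h2⟩
        · have hxu : x = u := hs.inj (by dsimp only; omega)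
          subst hxu
          exact Or.inr h2
      · rintro (⟨x, h1, h2⟩ | h2)
        · exact ⟨x, by omega, h2⟩
        · exact ⟨u, by omega, h2⟩
    refine Runs.seq (b₁ := 8) (b₂ := 22) (Q := fun s'' => s'' = s'.setReg 4 u)
      (Runs.flat (by decide) (by decide) (fun _ => by simp [Prog.safe, Expr.storable])
        (fun _ => by simp [Prog.run, Expr.eval, f0, h2, f7, hu1])) ?_ (by omega)
    rintro s₂ hs₂ hf₂ rfl
    refine Runs.flat rfl (by simp [Prog.maxCost, Expr.cost, isMarked]) (fun hb => ?_)
      (fun _ v => ?_)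
    · have := hb.eight_le
      simp only [Prog.safe, Expr.storable]
      exact ⟨fun _ => by omega, fun _ => trivial⟩
    · rw [hnew v, ← hI v]
      by_cases hH : Hits G (posOf n s) u C
      · have e := hmark.2 hH
        have hp : s.arr 6 u = v + 1 ↔ IsPar G (posOf n s) v u := hs.par u v
        have hcond : (isMarked m c).eval (s'.setReg 4 u) ≠ 0 := by
          simpa [isMarked, Expr.eval] using e
        simp only [Prog.run, hcond, ne_eq, not_false_eq_true, if_true, Expr.eval,
          State.setReg_arr, State.setReg_reg, State.setArr_arr, f6, hH, and_true]
        -- Parents are stored increased by one. A root therefore writes cell zero, which belongs to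
        -- no vertex.
        by_cases hpv : s.arr 6 u = v + 1
        · simp [hpv, hp.1 hpv]
        · have : ¬ IsPar G (posOf n s) v u := fun h => hpv (hp.2 h)
          simp [this, Ne.symm hpv]
      · have e : s'.arr m (u + 1) + s'.arr c u = 0 := by
          by_contra h
          exact hH (hmark.1 h)
        have hcond : (isMarked m c).eval (s'.setReg 4 u) = 0 := by
          simpa [isMarked, Expr.eval] using e
        simp [Prog.run, hcond, hH]
  · simp only [sum_const, card_range, smul_eq_mul]
    omega
  · intro s' hs' hf h v
    have hv := h v
    rw [hits_iff, ← hC v, hf.arr c (hwr c hmc)]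
    have : (∃ u : Fin n, n < s.arr 4 u + n ∧ IsPar G (posOf n s) v u ∧
        Hits G (posOf n s) u C) ↔ ∃ u, IsPar G (posOf n s) v u ∧ Hits G (posOf n s) u C := by
      refine exists_congr fun u => ⟨fun h => h.2, fun h => ⟨?_, h⟩⟩
      have := hs.pos_pos u
      omega
    rw [← this, ← hv]
    omega

/-- Compute the keys in array `13` and their inverse in array `14`; register `13` tells if some
separator is too small. -/
def keyLoop : Prog :=
  forTo 4 0 (.seq
    (.cond (isMarked 11 2)
      (.cond (isMarked 12 3) .skip
        (.store 13 (.reg 4) (.sub (.add (.reg 0) (.const 1)) (.load 4 (.reg 4)))))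
      (.cond (isMarked 12 3)
        (.store 13 (.reg 4) (.add (.add (.reg 0) (.const 2)) (.load 4 (.reg 4)))) .skip))
    (.cond (.load 13 (.reg 4))
      (.seq (.store 14 (.load 13 (.reg 4)) (.add (.reg 4) (.const 1)))
        (.cond (.sub (.reg 1) (.load 5 (.reg 4))) (.assign 13 (.const 1)) .skip))
      .skip))

/-- Keys of separators are distinct, so array `14` can be filled as an inverse table; zero stands
for an unused key, and vertices are stored increased by one. A separator with fewer than `k`
elements raises the flag in register `13`. -/
theorem runs_keyLoop {B : ℕ} {s : State} {C D : Finset (Fin n)} {K : Fin n → ℕ}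
    (hn : s.reg 0 = n) (hs : Searched G s) (hnB : 2 * n + 2 ≤ B)
    (hK : K = sepKey G (posOf n s) (n + 1) C D)
    (hC : ∀ v : Fin n, s.arr 11 (v + 1) + s.arr 2 v ≠ 0 ↔ Hits G (posOf n s) v C)
    (hD : ∀ v : Fin n, s.arr 12 (v + 1) + s.arr 3 v ≠ 0 ↔ Hits G (posOf n s) v D)
    (hz : ∀ i, s.arr 13 i = 0) (hz' : ∀ i, s.arr 14 i = 0) (h13 : s.reg 13 = 0) :
    Runs B keyLoop s (70 * n + 6) fun s' =>
      (∀ v : Fin n, s'.arr 13 v = K v) ∧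
      (∀ i, s'.arr 14 i ≠ 0 → ∃ v : Fin n, s'.arr 14 i = v + 1 ∧ K v = i ∧ i ≠ 0) ∧
      (∀ v : Fin n, K v ≠ 0 → s'.arr 14 (K v) = v + 1) ∧
      (s'.reg 13 ≠ 0 ↔ ∃ v : Fin n, K v ≠ 0 ∧ s.arr 5 v < s.reg 1) := by
  have hpos : ∀ v, posOf n s v < n + 1 := fun v => Nat.lt_succ_of_le (hs.pos_le v)
  have hKinj : ∀ u v, K u ≠ 0 → K u = K v → u = v := fun u v h1 h2 => by
    rw [hK] at h1 h2
    exact sepKey_injective hpos hs.inj h1 h2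
  refine (Runs.forTo (N := n) (c := fun _ => 60) (I := fun i s' =>
    (∀ v : Fin n, s'.arr 13 v = if v.val < i then K v else 0) ∧
      (∀ i, s'.arr 14 i ≠ 0 → ∃ v : Fin n, s'.arr 14 i = v + 1 ∧ K v = i ∧ i ≠ 0) ∧
      (∀ v : Fin n, v.val < i → K v ≠ 0 → s'.arr 14 (K v) = v + 1) ∧
      (s'.reg 13 ≠ 0 ↔ ∃ v : Fin n, v.val < i ∧ K v ≠ 0 ∧ s.arr 5 v < s.reg 1))
    (by decide) (by decide) (by decide) hn ?_ ?_ ?_ ?_).mono le_rfl ?_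
  · exact fun i s' x h => by simpa using h
  · simp [hz, hz', h13]
  · rintro i s' hi hs' hf h4 ⟨i1, i2, i3, i4⟩
    obtain ⟨v, hvi⟩ : ∃ v : Fin n, (v : ℕ) = i := ⟨⟨i, hi⟩, rfl⟩
    rw [← hvi] at h4
    have f0 := (hf.reg 0 (by decide)).trans hn
    have f1 := hf.reg 1 (by decide)
    have f2 := hf.arr 2 (by decide)
    have f3 := hf.arr 3 (by decide)
    have a4 := hf.arr 4 (by decide)
    have a5 := hf.arr 5 (by decide)
    have f11 := hf.arr 11 (by decide)
    have f12 := hf.arr 12 (by decide)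
    have hA : (isMarked 11 2).eval s' ≠ 0 ↔ Hits G (posOf n s) v C := by
      rw [← hC v]
      simp only [isMarked, Expr.eval, h4, f11, f2]
    have hB : (isMarked 12 3).eval s' ≠ 0 ↔ Hits G (posOf n s) v D := by
      rw [← hD v]
      simp only [isMarked, Expr.eval, h4, f12, f3]
    have h13v : s'.arr 13 v = 0 := by rw [i1 v, if_neg (by omega)]
    have hself : s'.arr 13 = Function.update (s'.arr 13) v 0 := by
      rw [← h13v, Function.update_eq_self]
    have hpv := hs.pos_le v
    refine Runs.seq (b₁ := 30) (b₂ := 30) (Q := fun s'' => s''.reg = s'.reg ∧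
        s''.arr 13 = Function.update (s'.arr 13) v (K v))
      (Runs.flat (by decide) (by decide) (fun hb => ?_) (fun hb => ⟨?_, ?_⟩))
      (fun s₂ hs₂ hf₂ hQ => ?_) (by omega)
    · simp only [Prog.safe, Expr.storable, Expr.eval, f0, h4, a4]
      exact ⟨fun _ => ⟨fun _ => trivial, fun _ => by omega⟩,
        fun _ => ⟨fun _ => by omega, fun _ => trivial⟩⟩
    · simp only [Prog.run]
      split_ifs <;> rfl
    · rw [hK, sepKey]
      by_cases h1 : Hits G (posOf n s) v C <;> by_cases h2 : Hits G (posOf n s) v D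
      · rw [if_pos h1, if_pos h2, Prog.run, if_pos (hA.2 h1), Prog.run, if_pos (hB.2 h2)]
        exact hself
      · rw [if_pos h1, if_neg h2, Prog.run, if_pos (hA.2 h1), Prog.run,
          if_neg (fun h => h2 (hB.1 h))]
        simp [Prog.run, Expr.eval, f0, h4, a4, posOf]
      · rw [if_neg h1, if_pos h2, Prog.run, if_neg (fun h => h1 (hA.1 h)), Prog.run,
          if_pos (hB.2 h2)]
        simp [Prog.run, Expr.eval, f0, h4, a4, posOf]
      · rw [if_neg h1, if_neg h2, Prog.run, if_neg (fun h => h1 (hA.1 h)), Prog.run,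
          if_neg (fun h => h2 (hB.1 h))]
        exact hself
    · obtain ⟨q1, q2⟩ := hQ
      have q5 := hf₂.arr 5 (by decide)
      have q14 := hf₂.arr 14 (by decide)
      have e13 : s₂.arr 13 v = K v := by simp [q2]
      have hne : ∀ u : Fin n, u ≠ v → (u : ℕ) ≠ i := fun u hu h => hu (Fin.ext (by omega))
      have h13' : ∀ u : Fin n, s₂.arr 13 u = if u.val < i + 1 then K u else 0 := fun u => by
        rw [q2]
        by_cases huv : u = v
        · subst huv
          rw [Function.update_self, if_pos (by omega)]
        · have := hne u huv
          rw [Function.update_of_ne (by omega), i1 u]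
          have : u.val < i + 1 ↔ u.val < i := by omega
          simp only [this]
      have hex : ∀ P : Fin n → Prop, (∃ u : Fin n, u.val < i + 1 ∧ P u) ↔
          (∃ u : Fin n, u.val < i ∧ P u) ∨ P v := fun P => by
        constructor
        · rintro ⟨u, h1, h2⟩
          by_cases hu : u = v
          · exact Or.inr (hu ▸ h2)
          · have := hne u hu
            exact Or.inl ⟨u, by omega, h2⟩
        · rintro (⟨u, h1, h2⟩ | h2)
          · exact ⟨u, by omega, h2⟩
          · exact ⟨v, by omega, h2⟩
      have e : Expr.eval s₂ (.load 13 (.reg 4)) = K v := by simp [Expr.eval, q1, h4, e13]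
      refine Runs.cond (b₁ := 24) (b₂ := 1) (by decide) (fun h => ?_) (fun h => ?_) (by decide)
      · rw [e] at h
        refine Runs.seq (b₁ := 12) (b₂ := 12) (Q := fun s₃ => s₃.reg = s₂.reg ∧
            s₃.arr 14 = Function.update (s₂.arr 14) (K v) (v + 1))
          (Runs.flat (by decide) (by decide) (fun hb => ?_) (fun hb => ?_))
          (fun s₃ hs₃ hf₃ hQ => ?_) (by omega)
        · simp only [Prog.safe, Expr.storable, Expr.eval, q1, h4]
          omega
        · simp [Prog.run, Expr.eval, q1, h4, e13]
        · obtain ⟨r1, r2⟩ := hQ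
          have r13 := hf₃.arr 13 (by decide)
          have r5 := hf₃.arr 5 (by decide)
          have h14 : s₃.arr 14 = Function.update (s'.arr 14) (K v) (v + 1) := by rw [r2, q14]
          have ec : Expr.eval s₃ (.sub (.reg 1) (.load 5 (.reg 4))) = s.reg 1 - s.arr 5 v := by
            simp [Expr.eval, r1, q1, h4, f1, r5, q5, a5]
          refine Runs.flat (by decide) (by decide) (fun hb => ?_) (fun hb => ⟨?_, ?_, ?_, ?_⟩)
          · have := hb.eight_le
            simp only [Prog.safe, Expr.storable]
            exact ⟨fun _ => by omega, fun _ => trivial⟩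
          · intro u
            rw [← h13' u, ← r13, Prog.run]
            split_ifs <;> rfl
          · have : ∀ i, s₃.arr 14 i ≠ 0 → ∃ v : Fin n, s₃.arr 14 i = v + 1 ∧ K v = i ∧ i ≠ 0 := by
              intro τ hτ
              by_cases hτv : τ = K v
              · exact ⟨v, by simp [h14, hτv], hτv.symm, hτv ▸ h⟩
              · rw [h14, Function.update_of_ne hτv] at hτ ⊢
                exact i2 τ hτ
            rw [Prog.run]
            split_ifs <;> exact this
          · have : ∀ u : Fin n, u.val < i + 1 → K u ≠ 0 → s₃.arr 14 (K u) = u + 1 := by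
              intro u hu hu0
              by_cases huv : u = v
              · simp [h14, huv]
              · rw [h14, Function.update_of_ne (fun h' => huv (hKinj u v hu0 h'))]
                have := hne u huv
                exact i3 u (by omega) hu0
            rw [Prog.run]
            split_ifs <;> exact this
          · rw [hex, ← i4, Prog.run, ec]
            split_ifs with h'
            · have h'' : s.arr 5 v < s.reg 1 := by omega
              simp [Prog.run, Expr.eval, h, h'']
            · have h'' : ¬ s.arr 5 v < s.reg 1 := by omega
              simp [Prog.run, r1, q1, h'']
      · rw [e] at h
        refine Runs.flat (by decide) (by decide) (fun _ => trivial) (fun _ => ?_)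
        rw [Prog.run]
        refine ⟨h13', by rwa [q14], fun u hu hu0 => ?_, ?_⟩
        · rw [q14]
          have := hne u (fun huv => hu0 (huv ▸ h))
          exact i3 u (by omega) hu0
        · rw [hex, q1, i4]
          simp [h]
  · simp only [sum_const, card_range, smul_eq_mul]
    omega
  · rintro s' hs' hf ⟨i1, i2, i3, i4⟩
    exact ⟨fun v => by simp [i1 v], i2, fun v => i3 v v.isLt, by simpa using i4⟩

end Keys

/-! ### The greedy algorithm on the machine -/

section GreedyLoops

variable {n : ℕ} {G : SimpleGraph (Fin n)} {adj : Fin n → List (Fin n)}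

theorem mem_earlier_posOf (hG : IsAdjList G adj) {s : State} {x y : Fin n} :
    x ∈ earlier G (posOf n s) y ↔ y ∈ adj x ∧ s.arr 4 x < s.arr 4 y := by
  rw [mem_earlier, (hG x).2]
  rfl

theorem sum_map_add_const (l : List (Fin n)) (c : ℕ) : (l.map fun _ => c).sum = l.length * c := by
  simp

/-- Compute in array `15` the last key of a separator that contains the vertex. -/
def lastLoop : Prog :=
  forTo 5 0 (forNbr 5 3 7
    (.cond (.sub (.load 4 (.reg 7)) (.load 4 (.reg 5)))
      (.cond (.sub (.load 13 (.reg 7)) (.load 15 (.reg 5)))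
        (.store 15 (.reg 5) (.load 13 (.reg 7))) .skip) .skip))

theorem runs_lastLoop {B : ℕ} {s : State} {K : Fin n → ℕ} (hn : s.reg 0 = n)
    (hG : IsAdjList G adj) (hadj : HasAdj adj s) (hK : ∀ v : Fin n, s.arr 13 v = K v)
    (hz : ∀ i, s.arr 15 i = 0) :
    Runs B lastLoop s (40 * degSum adj + 30 * n + 6) fun s' =>
      IsLast G (posOf n s) K fun v : Fin n => s'.arr 15 v := by
  refine (Runs.forTo (N := n) (c := fun i => if h : i < n then 40 * (adj ⟨i, h⟩).length + 12 else 0)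
    (I := fun i s' => (∀ v : Fin n, v.val < i → (∀ y, v ∈ earlier G (posOf n s) y →
        K y ≤ s'.arr 15 v) ∧
        (s'.arr 15 v ≠ 0 → ∃ y, v ∈ earlier G (posOf n s) y ∧ K y = s'.arr 15 v)) ∧
      ∀ v : Fin n, i ≤ v.val → s'.arr 15 v = 0)
    (by decide) (by decide) (by decide) hn ?_ ?_ ?_ ?_).mono le_rfl ?_
  · exact fun i s' x h => h
  · exact ⟨fun v hv => absurd hv (by omega), fun v _ => hz v⟩
  · rintro i s' hi hs' hf h5 ⟨i1, i2⟩
    obtain ⟨x, hx⟩ : ∃ x : Fin n, (x : ℕ) = i := ⟨⟨i, hi⟩, rfl⟩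
    rw [← hx] at h5
    have hadj' : HasAdj adj s' := by
      unfold HasAdj
      rw [hf.arr 0 (by decide), hf.arr 1 (by decide)]
      exact hadj
    have f4 := hf.arr 4 (by decide)
    have f13 := hf.arr 13 (by decide)
    have hxe : (⟨i, hi⟩ : Fin n) = x := Fin.ext hx.symm
    rw [dif_pos hi, hxe]
    refine (Runs.forNbr (adj := adj) (v := x) (c := fun _ => 20) (I := fun pre s'' =>
      (∀ u : Fin n, u ≠ x → s''.arr 15 u = s'.arr 15 u) ∧
      (∀ y ∈ pre, s.arr 4 x < s.arr 4 y → K y ≤ s''.arr 15 x) ∧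
      (s''.arr 15 x ≠ 0 → ∃ y ∈ pre, s.arr 4 x < s.arr 4 y ∧ K y = s''.arr 15 x))
      (by decide) (by decide) (by decide) (by decide) (by decide) (by decide) (by decide)
      hadj' h5 ?_ ?_ ?_ ?_).mono le_rfl ?_
    · exact fun pre s' x h => ⟨h, h⟩
    · exact ⟨fun _ _ => rfl, by simp, fun h => absurd (i2 x hx.ge) h⟩
    · rintro pre y post s₂ - hs₂ hf₂ h7 ⟨j1, j2, j3⟩
      have g4 := (hf₂.arr 4 (by decide)).trans f4
      have g13 := (hf₂.arr 13 (by decide)).trans f13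
      have g5 := (hf₂.reg 5 (by decide)).trans h5
      have e1 : Expr.eval s₂ (.sub (.load 4 (.reg 7)) (.load 4 (.reg 5))) =
          s.arr 4 y - s.arr 4 x := by simp [Expr.eval, h7, g5, g4]
      have e2 : Expr.eval s₂ (.sub (.load 13 (.reg 7)) (.load 15 (.reg 5))) =
          K y - s₂.arr 15 x := by simp [Expr.eval, h7, g5, g13, hK]
      refine Runs.flat (by decide) (by decide)
        (fun _ => by simp [Prog.safe, Expr.storable]) (fun _ => ?_)
      by_cases h1 : s.arr 4 x < s.arr 4 y
      · by_cases h2 : s₂.arr 15 x < K y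
        · rw [Prog.run, if_pos (by rw [e1]; omega), Prog.run, if_pos (by rw [e2]; omega)]
          have e : (Prog.run (.store 15 (.reg 5) (.load 13 (.reg 7))) s₂).arr 15 =
              Function.update (s₂.arr 15) x (K y) := by
            simp [Prog.run, Expr.eval, h7, g5, g13, hK]
          rw [e]
          refine ⟨fun u hu => ?_, fun z hz hlt => ?_, fun _ => ⟨y, by simp, h1, by simp⟩⟩
          · rw [Function.update_of_ne (fun h => hu (Fin.ext h)), j1 u hu]
          · rw [Function.update_self]
            rcases List.mem_append.1 hz with hz | hz
            · exact (j2 z hz hlt).trans h2.le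
            · rw [List.mem_singleton.1 hz]
        · rw [Prog.run, if_pos (by rw [e1]; omega), Prog.run, if_neg (by rw [e2]; omega), Prog.run]
          refine ⟨j1, fun z hz hlt => ?_, fun h => ?_⟩
          · rcases List.mem_append.1 hz with hz | hz
            · exact j2 z hz hlt
            · rw [List.mem_singleton.1 hz]
              omega
          · obtain ⟨z, hz, hz'⟩ := j3 h
            exact ⟨z, by simp [hz], hz'⟩
      · rw [Prog.run, if_neg (by rw [e1]; omega), Prog.run]
        refine ⟨j1, fun z hz hlt => ?_, fun h => ?_⟩
        · rcases List.mem_append.1 hz with hz | hz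
          · exact j2 z hz hlt
          · rw [List.mem_singleton.1 hz] at hlt
            omega
        · obtain ⟨z, hz, hz'⟩ := j3 h
          exact ⟨z, by simp [hz], hz'⟩
    · rw [sum_map_add_const]
      omega
    · rintro s₂ hs₂ hf₂ ⟨j1, j2, j3⟩
      refine ⟨fun v hv => ?_, fun v hv => ?_⟩
      · by_cases hvx : v = x
        · subst hvx
          refine ⟨fun y hy => ?_, fun h => ?_⟩
          · rw [mem_earlier_posOf hG] at hy
            exact j2 y hy.1 hy.2
          · obtain ⟨y, h1, h2, h3⟩ := j3 h
            exact ⟨y, (mem_earlier_posOf hG).2 ⟨h1, h2⟩, h3⟩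
        · rw [j1 v hvx]
          have : (v : ℕ) ≠ x := fun h => hvx (Fin.ext h)
          exact i1 v (by omega)
      · have hvx : v ≠ x := by rintro rfl; omega
        rw [j1 v hvx]
        exact i2 v (by omega)
  · rw [sum_add_distrib, ← Fin.sum_univ_eq_sum_range
      (fun i => if h : i < n then 40 * (adj ⟨i, h⟩).length + 12 else 0)]
    simp only [Fin.is_lt, dif_pos, Fin.eta, sum_add_distrib, ← mul_sum, sum_const, card_univ,
      Fintype.card_fin, card_range, smul_eq_mul, degSum]
    omega
  · exact fun s' hs' hf h v => h.1 v v.isLt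

/-- Test whether the vertex in register `5` can be dropped. -/
def testNbr : Prog :=
  .cond (.load 13 (.reg 7)) (.cond (.sub (.load 4 (.reg 7)) (.load 4 (.reg 5)))
    (.cond (.sub (.load 5 (.reg 7)) (.reg 1)) .skip (.assign 11 (.const 0))) .skip) .skip

/-- Drop the vertex in register `5` from a separator. -/
def dropNbr : Prog :=
  .cond (.load 13 (.reg 7)) (.cond (.sub (.load 4 (.reg 7)) (.load 4 (.reg 5)))
    (.store 5 (.reg 7) (.sub (.load 5 (.reg 7)) (.const 1))) .skip) .skip

/-- Drop the vertex in register `5` if all separators that contain it remain large enough, and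
count it in register `12` otherwise. -/
def process : Prog :=
  .seq (.assign 11 (.const 1)) (.seq (forNbr 5 6 7 testNbr)
    (.cond (.reg 11) (forNbr 5 6 7 dropNbr) (.assign 12 (.add (.reg 12) (.const 1)))))

/-- Array `5` holds the number of vertices still kept in each separator. One more can be dropped
exactly if this number is larger than `k` in all separators that contain `x`. -/
theorem runs_test {B : ℕ} {s : State} {K : Fin n → ℕ} {x : Fin n} (hG : IsAdjList G adj)
    (hadj : HasAdj adj s) (hK : ∀ v : Fin n, s.arr 13 v = K v) (hx : s.reg 5 = x)
    (h11 : s.reg 11 = 1) :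
    Runs B (forNbr 5 6 7 testNbr) s (40 * (adj x).length + 11) fun s' =>
      (s'.reg 11 ≠ 0 ↔ ∀ y, K y ≠ 0 → x ∈ earlier G (posOf n s) y → s.reg 1 < s.arr 5 y) := by
  refine (Runs.forNbr (adj := adj) (v := x) (c := fun _ => 20) (I := fun pre s' =>
    (s'.reg 11 ≠ 0 ↔ ∀ y ∈ pre, K y ≠ 0 → s.arr 4 x < s.arr 4 y → s.reg 1 < s.arr 5 y))
    (by decide) (by decide) (by decide) (by decide) (by decide) (by decide) (by decide)
    hadj hx ?_ ?_ ?_ ?_).mono le_rfl ?_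
  · exact fun pre s' y h => ⟨by simpa using h, by simpa using h⟩
  · simp [h11]
  · rintro pre y post s₂ - hs₂ hf₂ h7 hI
    have g1 := hf₂.reg 1 (by decide)
    have g4 := hf₂.arr 4 (by decide)
    have g5 := hf₂.arr 5 (by decide)
    have g13 := hf₂.arr 13 (by decide)
    have gx := (hf₂.reg 5 (by decide)).trans hx
    have e1 : Expr.eval s₂ (.sub (.load 4 (.reg 7)) (.load 4 (.reg 5))) =
        s.arr 4 y - s.arr 4 x := by simp [Expr.eval, h7, gx, g4]
    have e2 : Expr.eval s₂ (.load 13 (.reg 7)) = K y := by simp [Expr.eval, h7, g13, hK]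
    have e3 : Expr.eval s₂ (.sub (.load 5 (.reg 7)) (.reg 1)) = s.arr 5 y - s.reg 1 := by
      simp [Expr.eval, h7, g1, g5]
    have hsplit : (∀ z ∈ pre ++ [y], K z ≠ 0 → s.arr 4 x < s.arr 4 z → s.reg 1 < s.arr 5 z) ↔
        s₂.reg 11 ≠ 0 ∧ (K y ≠ 0 → s.arr 4 x < s.arr 4 y → s.reg 1 < s.arr 5 y) := by
      rw [hI, List.forall_mem_append, List.forall_mem_singleton]
    refine Runs.flat (by decide) (by decide)
      (fun _ => by simp [testNbr, Prog.safe, Expr.storable]) (fun _ => ?_)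
    rw [hsplit]
    simp only [testNbr, Prog.run, e1, e2, e3]
    split_ifs with h1 h2 h3
    · have : s.reg 1 < s.arr 5 y := by omega
      simp [this]
    · have h2' : s.arr 4 x < s.arr 4 y := by omega
      have : ¬ s.reg 1 < s.arr 5 y := by omega
      simp [Expr.eval, h1, h2', this]
    · have h2' : ¬ s.arr 4 x < s.arr 4 y := by omega
      simp [h2']
    · simp only [ne_eq, not_not] at h1
      simp [h1]
  · rw [sum_map_add_const]
    omega
  · intro s' hs' hf h
    rw [h]
    refine ⟨fun h y h1 h2 => ?_, fun h y h1 h2 h3 => ?_⟩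
    · rw [mem_earlier_posOf hG] at h2
      exact h y h2.1 h1 h2.2
    · exact h y h2 ((mem_earlier_posOf hG).2 ⟨h1, h3⟩)

/-- The form with `max` describes truncated subtraction without assuming that the test has
succeeded. -/
theorem runs_drop {B : ℕ} {s : State} {K : Fin n → ℕ} {x : Fin n} (hG : IsAdjList G adj)
    (hadj : HasAdj adj s) (hK : ∀ v : Fin n, s.arr 13 v = K v) (hx : s.reg 5 = x) :
    Runs B (forNbr 5 6 7 dropNbr) s (40 * (adj x).length + 11) fun s' =>
      ∀ y : Fin n, K y ≠ 0 → s'.arr 5 y + (if x ∈ earlier G (posOf n s) y then 1 else 0) =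
        max (s.arr 5 y) (if x ∈ earlier G (posOf n s) y then 1 else 0) := by
  refine (Runs.forNbr (adj := adj) (v := x) (c := fun _ => 20) (I := fun pre s' =>
    ∀ y : Fin n, K y ≠ 0 → s'.arr 5 y + (if y ∈ pre ∧ s.arr 4 x < s.arr 4 y then 1 else 0) =
      max (s.arr 5 y) (if y ∈ pre ∧ s.arr 4 x < s.arr 4 y then 1 else 0))
    (by decide) (by decide) (by decide) (by decide) (by decide) (by decide) (by decide)
    hadj hx ?_ ?_ ?_ ?_).mono le_rfl ?_
  · exact fun pre s' y h => ⟨by simpa using h, by simpa using h⟩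
  · simp
  · rintro pre y post s₂ hpp hs₂ hf₂ h7 hI
    have g4 := hf₂.arr 4 (by decide)
    have g13 := hf₂.arr 13 (by decide)
    have gx := (hf₂.reg 5 (by decide)).trans hx
    have hypre : y ∉ pre := fun h' => by
      have hnd := (hG x).1
      rw [hpp, List.nodup_append] at hnd
      exact hnd.2.2 _ h' _ (by simp) rfl
    have e1 : Expr.eval s₂ (.sub (.load 4 (.reg 7)) (.load 4 (.reg 5))) =
        s.arr 4 y - s.arr 4 x := by simp [Expr.eval, h7, gx, g4]
    have e2 : Expr.eval s₂ (.load 13 (.reg 7)) = K y := by simp [Expr.eval, h7, g13, hK]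
    have hskip : (K y = 0 ∨ ¬ s.arr 4 x < s.arr 4 y) → ∀ z : Fin n, K z ≠ 0 →
        s₂.arr 5 z + (if z ∈ pre ++ [y] ∧ s.arr 4 x < s.arr 4 z then 1 else 0) =
          max (s.arr 5 z) (if z ∈ pre ++ [y] ∧ s.arr 4 x < s.arr 4 z then 1 else 0) := by
      intro h z hz
      have : (z ∈ pre ++ [y] ∧ s.arr 4 x < s.arr 4 z) ↔ (z ∈ pre ∧ s.arr 4 x < s.arr 4 z) := by
        simp only [List.mem_append, List.mem_singleton]
        by_cases hzy : z = y
        · subst hzy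
          tauto
        · tauto
      simp only [this]
      exact hI z hz
    refine Runs.flat (by decide) (by decide)
      (fun _ => by simp [dropNbr, Prog.safe, Expr.storable]) (fun _ => ?_)
    simp only [dropNbr, Prog.run, e1, e2]
    split_ifs with h1 h2
    · have h2' : s.arr 4 x < s.arr 4 y := by omega
      intro z hz
      have e : (s₂.setArr 5 (Expr.eval s₂ (.reg 7))
          (Expr.eval s₂ (.sub (.load 5 (.reg 7)) (.const 1)))).arr 5 =
          Function.update (s₂.arr 5) y (s₂.arr 5 y - 1) := by
        simp [Expr.eval, h7]
      rw [e]
      have hIz := hI z hz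
      by_cases hzy : z = y
      · subst hzy
        simp only [hypre, false_and, if_false] at hIz
        rw [Function.update_self, if_pos ⟨by simp, h2'⟩]
        omega
      · rw [Function.update_of_ne (fun h => hzy (Fin.ext h))]
        simpa [hzy] using hIz
    · exact hskip (Or.inr (by omega))
    · exact hskip (Or.inl (by omega))
  · rw [sum_map_add_const]
    omega
  · intro s' hs' hf h y hy
    have := h y hy
    simp only [mem_earlier_posOf hG]
    exact this

/-- The state of the greedy algorithm, with the processed set `P` and the dropped set `A`. -/
def GreedyState (G : SimpleGraph (Fin n)) (pos K : Fin n → ℕ) (k : ℕ) (F : Finset (Fin n))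
    (s : State) (P A : Finset (Fin n)) : Prop :=
  GreedyInv G pos K (fun y => #(earlier G pos y) - k) F P A ∧
    (∀ y : Fin n, K y ≠ 0 → s.arr 5 y + #(A ∩ earlier G pos y) = #(earlier G pos y)) ∧
    s.reg 12 = #(P \ A)

/-- Capacities are truncated differences, but the equivalence needs no assumption `k ≤ #(earlier G
pos y)`: a capacity that admits `x` is positive. So the loop is verified for infeasible inputs as
well. -/
theorem packs_insert_iff {pos K w : Fin n → ℕ} {k : ℕ} {A : Finset (Fin n)} {x : Fin n}
    (hA : Packs G pos K (fun y => #(earlier G pos y) - k) A) (hx : x ∉ A)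
    (hw : ∀ y : Fin n, K y ≠ 0 → w y + #(A ∩ earlier G pos y) = #(earlier G pos y)) :
    Packs G pos K (fun y => #(earlier G pos y) - k) (insert x A) ↔
      ∀ y, K y ≠ 0 → x ∈ earlier G pos y → k < w y := by
  have hc : ∀ y, x ∈ earlier G pos y →
      #(insert x A ∩ earlier G pos y) = #(A ∩ earlier G pos y) + 1 := fun y hy => by
    rw [insert_inter_of_mem hy, card_insert_of_notMem (by simp [hx])]
  refine ⟨fun h y h1 h2 => ?_, fun h y h1 => ?_⟩
  · have h3 := h y h1
    dsimp only at h3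
    rw [hc y h2] at h3
    have := hw y h1
    omega
  · by_cases h2 : x ∈ earlier G pos y
    · have := h y h1 h2
      have := hw y h1
      dsimp only
      rw [hc y h2]
      omega
    · rw [insert_inter_of_notMem h2]
      exact hA y h1

/-- The test succeeds exactly if `insert x A` still packs, so the two branches are acceptance and
rejection by the greedy algorithm. Register `12` counts the rejected vertices, which form the set
`U`. -/
theorem runs_process {B : ℕ} {s : State} {K last : Fin n → ℕ} {x : Fin n} {k : ℕ}
    {F P A : Finset (Fin n)} (hG : IsAdjList G adj) (hadj : HasAdj adj s) (hnB : n + 1 ≤ B)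
    (hK : ∀ v : Fin n, s.arr 13 v = K v) (hk : s.reg 1 = k) (hx : s.reg 5 = x)
    (hcons : Consecutive G (posOf n s) K) (hlast : IsLast G (posOf n s) K last)
    (hI : GreedyState G (posOf n s) K k F s P A) (hxF : x ∈ F) (hxP : x ∉ P)
    (hmin : ∀ z ∈ F, z ∉ P → last z ≠ 0 → last x ≤ last z) :
    Runs B process s (80 * (adj x).length + 40) fun s' =>
      ∃ A', GreedyState G (posOf n s) K k F s' (insert x P) A' := by
  obtain ⟨hinv, hw, h12⟩ := hI
  have hxA : x ∉ A := fun h => hxP (hinv.sub h)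
  have hiff := packs_insert_iff (w := fun y => s.arr 5 y) hinv.packs hxA hw
  refine Runs.seq (b₁ := 2) (b₂ := 80 * (adj x).length + 38) (Q := fun s' => s' = s.setReg 11 1)
    (Runs.flat (by decide) (by decide) (fun hb => ?_) (fun hb => rfl)) ?_ (by omega)
  · have := hb.eight_le
    simp only [Prog.safe, Expr.storable]
    omega
  rintro s₁ hs₁ hf₁ rfl
  refine Runs.seq (runs_test (K := K) (x := x) hG (by simpa [HasAdj] using hadj) (by simpa using hK)
    (by simpa using hx) (by simp)) (b₂ := 40 * (adj x).length + 27) ?_ (by omega)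
  intro s₂ hs₂ hf₂ hQ
  have e1 : (s.setReg 11 1).reg 1 = k := by simpa using hk
  rw [e1] at hQ
  have hQ' : s₂.reg 11 ≠ 0 ↔
      Packs G (posOf n s) K (fun y => #(earlier G (posOf n s) y) - k) (insert x A) := by
    rw [hQ, hiff]
    rfl
  have g0 : s₂.arr 0 = s.arr 0 := hf₂.arr 0 (by decide)
  have g1 : s₂.arr 1 = s.arr 1 := hf₂.arr 1 (by decide)
  have g4 : s₂.arr 4 = s.arr 4 := hf₂.arr 4 (by decide)
  have g5 : s₂.arr 5 = s.arr 5 := hf₂.arr 5 (by decide)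
  have g13 : s₂.arr 13 = s.arr 13 := hf₂.arr 13 (by decide)
  have gx : s₂.reg 5 = x := (hf₂.reg 5 (by decide)).trans (by simpa using hx)
  have g12 : s₂.reg 12 = s.reg 12 := (hf₂.reg 12 (by decide)).trans (by simp)
  have hpos : posOf n s₂ = posOf n s := by
    funext v
    simp [posOf, g4]
  refine Runs.cond (b₁ := 40 * (adj x).length + 11) (b₂ := 4) (by decide) (fun h => ?_)
    (fun h => ?_) (by simp [Expr.cost]; omega)
  · have hp := hQ'.1 h
    refine (runs_drop (K := K) (x := x) hG (by unfold HasAdj; rw [g0, g1]; exact hadj)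
      (by rw [g13]; exact hK) gx).mono le_rfl ?_
    intro s₃ hs₃ hf₃ hd
    refine ⟨insert x A, hinv.accept hcons hlast hxF hp hmin, fun y hy => ?_, ?_⟩
    · have h1 := hd y hy
      rw [hpos, g5] at h1
      have h2 := hw y hy
      by_cases hxy : x ∈ earlier G (posOf n s) y
      · have h3 := hiff.1 hp y hy hxy
        rw [if_pos hxy] at h1
        rw [insert_inter_of_mem hxy, card_insert_of_notMem (by simp [hxA])]
        omega
      · rw [if_neg hxy] at h1
        rw [insert_inter_of_notMem hxy]
        omega
    · have h3 : s₃.reg 12 = s₂.reg 12 := hf₃.reg 12 (by decide)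
      rw [h3, g12, h12]
      congr 1
      ext z
      simp only [mem_sdiff, mem_insert]
      by_cases hzx : z = x
      · subst hzx
        tauto
      · tauto
  · have hp : ¬ Packs G (posOf n s) K (fun y => #(earlier G (posOf n s) y) - k) (insert x A) :=
      fun hp => hQ'.2 hp h
    have hcard : #(P \ A) ≤ n := (card_le_univ _).trans (by simp)
    refine Runs.flat (by decide) (by decide) (fun hb => ?_) (fun hb => ⟨A, hinv.reject hxF hp,
      fun y hy => ?_, ?_⟩)
    · simp only [Prog.safe, Expr.storable, Expr.eval]
      omega
    · simp only [Prog.run, State.setReg_arr, g5]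
      exact hw y hy
    · simp only [Prog.run, Expr.eval, State.setReg_reg, if_true]
      rw [insert_sdiff_of_notMem _ hxA, card_insert_of_notMem (by simp [hxP]), g12, h12]

/-- Process the neighbor in register `5` if its last key is in register `2`. -/
def greedyNbr : Prog :=
  .cond (.add (.sub (.load 15 (.reg 5)) (.reg 2)) (.sub (.reg 2) (.load 15 (.reg 5)))) .skip
    (.cond (.add (.load 2 (.reg 5)) (.load 3 (.reg 5))) .skip process)

/-- Process the vertices in the order of their last keys. -/
def greedyLoop : Prog :=
  .seq (.assign 16 (.add (.add (.reg 0) (.reg 0)) (.const 3)))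
    (forTo 2 16 (.seq (.assign 4 (.load 14 (.reg 2)))
      (.cond (.reg 4)
        (.seq (.assign 4 (.sub (.reg 4) (.const 1))) (forNbr 4 3 5 greedyNbr)) .skip)))

/-- The state of the greedy algorithm when the vertices with last key below `t`, and those with
last key `t` in the list `pre`, have been processed. -/
def GreedyAt (G : SimpleGraph (Fin n)) (pos K last : Fin n → ℕ) (k : ℕ) (F : Finset (Fin n))
    (t : ℕ) (pre : List (Fin n)) (s : State) : Prop :=
  ∃ P A, GreedyState G pos K k F s P A ∧
    ∀ x, x ∈ P ↔ x ∈ F ∧ last x ≠ 0 ∧ (last x < t ∨ last x = t ∧ x ∈ pre)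

theorem GreedyAt.congr {pos K last : Fin n → ℕ} {k t t' : ℕ} {F : Finset (Fin n)}
    {pre pre' : List (Fin n)} {s s' : State} (h : GreedyAt G pos K last k F t pre s)
    (h5 : s'.arr 5 = s.arr 5) (h12 : s'.reg 12 = s.reg 12)
    (ht : ∀ x ∈ F, last x ≠ 0 → ((last x < t ∨ last x = t ∧ x ∈ pre) ↔
      (last x < t' ∨ last x = t' ∧ x ∈ pre'))) : GreedyAt G pos K last k F t' pre' s' := by
  obtain ⟨P, A, ⟨h1, h2, h3⟩, h4⟩ := h
  refine ⟨P, A, ⟨h1, by rwa [h5], by rwa [h12]⟩, fun x => ?_⟩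
  rw [h4]
  refine and_congr_right fun hx => and_congr_right fun hl => ht x hx hl

theorem runs_greedyNbrs {B : ℕ} {s : State} {K last : Fin n → ℕ} {v : Fin n} {k t : ℕ}
    {C D : Finset (Fin n)} (hG : IsAdjList G adj) (hadj : HasAdj adj s) (hnB : n + 1 ≤ B)
    (hK : ∀ v : Fin n, s.arr 13 v = K v) (hL : ∀ v : Fin n, s.arr 15 v = last v)
    (hC : HasSet 2 C s) (hD : HasSet 3 D s) (hk : s.reg 1 = k) (hv : s.reg 4 = v)
    (ht : s.reg 2 = t) (ht0 : t ≠ 0) (hcons : Consecutive G (posOf n s) K)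
    (hlast : IsLast G (posOf n s) K last)
    (hI : GreedyAt G (posOf n s) K last k (univ \ (C ∪ D)) t [] s) :
    Runs B (forNbr 4 3 5 greedyNbr) s
      (((adj v).map fun x => (if last x = t then 80 * (adj x).length + 40 else 0) + 40).sum + 11)
      (GreedyAt G (posOf n s) K last k (univ \ (C ∪ D)) t (adj v)) := by
  refine Runs.forNbr (adj := adj) (v := v)
    (c := fun x => (if last x = t then 80 * (adj x).length + 40 else 0) + 20)
    (I := fun pre s' => GreedyAt G (posOf n s) K last k (univ \ (C ∪ D)) t pre s')
    (by decide) (by decide) (by decide) (by decide) (by decide) (by decide) (by decide)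
    hadj hv ?_ hI ?_ ?_
  · exact fun pre s' y h => ⟨h.congr rfl (by simp) (fun _ _ _ => Iff.rfl),
      h.congr rfl (by simp) (fun _ _ _ => Iff.rfl)⟩
  · intro pre x post s' hpp hs' hf hx hI
    have f0 := hf.arr 0 (by decide)
    have f1 := hf.arr 1 (by decide)
    have f2 := hf.arr 2 (by decide)
    have f3 := hf.arr 3 (by decide)
    have f4 := hf.arr 4 (by decide)
    have f13 := hf.arr 13 (by decide)
    have f15 := hf.arr 15 (by decide)
    have r1 := (hf.reg 1 (by decide)).trans hk
    have r2 := (hf.reg 2 (by decide)).trans ht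
    have hpos : posOf n s' = posOf n s := by
      funext v
      simp [posOf, f4]
    have hxpre : x ∉ pre := fun h' => by
      have hnd := (hG v).1
      rw [hpp, List.nodup_append] at hnd
      exact hnd.2.2 _ h' _ (by simp) rfl
    have hskip : ¬ (x ∈ univ \ (C ∪ D) ∧ last x = t) →
        GreedyAt G (posOf n s) K last k (univ \ (C ∪ D)) t (pre ++ [x]) s' := fun h =>
      hI.congr rfl rfl fun z hz _ => by
        by_cases hzx : z = x
        · subst hzx
          tauto
        · simp [hzx]
    -- The sum of both truncated differences is zero exactly if the numbers are equal.
    have e1 : Expr.eval s' (.add (.sub (.load 15 (.reg 5)) (.reg 2))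
        (.sub (.reg 2) (.load 15 (.reg 5)))) = (last x - t) + (t - last x) := by
      simp [Expr.eval, hx, f15, hL, r2]
    have e2 : Expr.eval s' (.add (.load 2 (.reg 5)) (.load 3 (.reg 5))) ≠ 0 ↔ x ∈ C ∪ D := by
      rw [mem_union, ← hC x, ← hD x]
      simp only [Expr.eval, hx, f2, f3]
      omega
    refine Runs.cond (b₁ := 1)
      (b₂ := if last x = t then 80 * (adj x).length + 47 else 0) (by decide) (fun h => ?_)
      (fun h => ?_) ?_
    · rw [e1] at h
      exact Runs.flat (by decide) (by decide) (fun _ => trivial)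
        (fun _ => hskip fun h' => h (by omega))
    · rw [e1] at h
      have hxt : last x = t := by omega
      rw [if_pos hxt]
      refine Runs.cond (b₁ := 1) (b₂ := 80 * (adj x).length + 40) (by decide) (fun h => ?_)
        (fun h => ?_) (by simp [Expr.cost]; omega)
      · exact Runs.flat (by decide) (by decide) (fun _ => trivial)
          (fun _ => hskip fun h' => (mem_sdiff.1 h'.1).2 (e2.1 h))
      · have hxF : x ∈ univ \ (C ∪ D) := by
          rw [mem_sdiff]
          exact ⟨mem_univ _, fun h' => e2.2 h' h⟩
        obtain ⟨P, A, hst, hP⟩ := hI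
        have hxP : x ∉ P := by
          rw [hP]
          rintro ⟨-, -, h' | h'⟩
          · omega
          · exact hxpre h'.2
        rw [← hpos] at hst hcons hlast ⊢
        refine (runs_process (last := last) hG (by unfold HasAdj; rw [f0, f1]; exact hadj) hnB
          (by rw [f13]; exact hK) r1 hx hcons hlast hst hxF hxP fun z hz hzP hz0 => ?_).mono
          le_rfl ?_
        -- All relevant vertices with last key below `t` are processed, so `x`, with last key `t`,
        -- is a legitimate next choice.
        · by_contra hlt
          exact hzP ((hP z).2 ⟨hz, hz0, Or.inl (by omega)⟩)
        · rintro s₂ hs₂ hf₂ ⟨A', hA'⟩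
          refine ⟨_, A', hA', fun z => ?_⟩
          rw [mem_insert, hP z, List.mem_append, List.mem_singleton]
          by_cases hzx : z = x
          · subst hzx
            simp [hxF, hxt, ht0]
          · simp [hzx]
    · simp only [Expr.cost]
      split_ifs <;> omega
  · simp only [add_assoc]
    exact Nat.add_le_add_right (List.sum_le_sum fun x _ => by split_ifs <;> omega) _

end GreedyLoops

/-! ### Total cost and optimality of the greedy algorithm -/

section GreedyTotal

variable {n : ℕ} {G : SimpleGraph (Fin n)} {adj : Fin n → List (Fin n)}

/-- Double counting. The neighbors of `v` are scanned only when `t` is the key of `v`, and `x` is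
processed only at the unique separator whose key is `last x`. -/
theorem sum_visit_cost_le {K last : Fin n → ℕ} (hnd : ∀ v, (adj v).Nodup)
    (hinj : ∀ u v, K u ≠ 0 → K u = K v → u = v) (N : ℕ) :
    ∑ t ∈ range N, ∑ v, (if K v = t ∧ t ≠ 0 then
      ((adj v).map fun x => (if last x = t then 80 * (adj x).length + 40 else 0) + 40).sum
      else 0) ≤ 120 * degSum adj + 40 * n := by
  set w : Fin n → ℕ := fun x => 80 * (adj x).length + 40 with hw
  rw [sum_comm]
  have h1 : ∀ v, ∑ t ∈ range N, (if K v = t ∧ t ≠ 0 then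
      ((adj v).map fun x => (if last x = t then w x else 0) + 40).sum else 0) ≤
      ∑ x, (if K v ≠ 0 ∧ last x = K v then w x else 0) + 40 * (adj v).length := fun v => by
    have hle : ∀ t ∈ range N, t ≠ K v → (if K v = t ∧ t ≠ 0 then
        ((adj v).map fun x => (if last x = t then w x else 0) + 40).sum else 0) = 0 :=
      fun t _ ht => if_neg fun h => ht h.1.symm
    have hone : ∑ t ∈ range N, (if K v = t ∧ t ≠ 0 then
        ((adj v).map fun x => (if last x = t then w x else 0) + 40).sum else 0) ≤
        if K v ≠ 0 then ((adj v).map fun x => (if last x = K v then w x else 0) + 40).sum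
          else 0 := by
      by_cases hm : K v ∈ range N
      · rw [sum_eq_single_of_mem _ hm hle]
        simp
      · rw [sum_eq_zero fun t ht => hle t ht fun h => hm (h ▸ ht)]
        exact Nat.zero_le _
    refine hone.trans ?_
    split_ifs with h0
    · rw [List.sum_map_add, sum_map_add_const, ← List.sum_toFinset _ (hnd v), mul_comm]
      refine Nat.add_le_add_right ?_ _
      simp only [h0, not_false_eq_true, true_and, ne_eq]
      exact sum_le_sum_of_subset (subset_univ _)
    · exact Nat.zero_le _
  have h2 : ∀ x, ∑ v, (if K v ≠ 0 ∧ last x = K v then w x else 0) ≤ w x := fun x => by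
    by_cases h : ∃ v, K v ≠ 0 ∧ last x = K v
    · obtain ⟨v, hv, hx⟩ := h
      rw [sum_eq_single_of_mem v (mem_univ v) fun u _ hu => if_neg fun h' =>
        hu (hinj u v h'.1 (by rw [← h'.2, hx]))]
      split_ifs <;> omega
    · rw [sum_eq_zero fun v _ => if_neg fun h' => h ⟨v, h'⟩]
      exact Nat.zero_le _
  refine (sum_le_sum fun v _ => h1 v).trans ?_
  rw [sum_add_distrib, sum_comm, ← mul_sum]
  refine (Nat.add_le_add_right (sum_le_sum fun x _ => h2 x) _).trans ?_
  simp only [hw, sum_add_distrib, ← mul_sum, sum_const, card_univ, Fintype.card_fin, smul_eq_mul,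
    degSum]
  omega

/-- Running through the keys in increasing order yields the vertices by increasing last key without
sorting, because a vertex with last key `t` is a neighbor of the vertex with key `t`. -/
theorem runs_greedyLoop {B : ℕ} {s : State} {K : Fin n → ℕ} {k : ℕ}
    {C D : Finset (Fin n)} (hG : IsAdjList G adj) (hadj : HasAdj adj s) (hnB : 2 * n + 3 ≤ B)
    (hn : s.reg 0 = n) (hk : s.reg 1 = k) (h12 : s.reg 12 = 0)
    (hw : ∀ v : Fin n, s.arr 5 v = #(earlier G (posOf n s) v))
    (hK : ∀ v : Fin n, s.arr 13 v = K v) (hC : HasSet 2 C s) (hD : HasSet 3 D s)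
    (ho : ∀ i, s.arr 14 i ≠ 0 → ∃ v : Fin n, s.arr 14 i = v + 1 ∧ K v = i ∧ i ≠ 0)
    (ho' : ∀ v : Fin n, K v ≠ 0 → s.arr 14 (K v) = v + 1)
    (hinj : ∀ u v, K u ≠ 0 → K u = K v → u = v) (hKle : ∀ v, K v ≤ 2 * n + 2)
    (hcons : Consecutive G (posOf n s) K)
    (hlast : IsLast G (posOf n s) K fun v : Fin n => s.arr 15 v) :
    Runs B greedyLoop s (120 * degSum adj + 100 * n + 110) fun s' =>
      ∃ P A, GreedyState G (posOf n s) K k (univ \ (C ∪ D)) s' P A ∧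
        ∀ x, x ∈ P ↔ x ∈ univ \ (C ∪ D) ∧ s.arr 15 x ≠ 0 := by
  set last : Fin n → ℕ := fun v => s.arr 15 v with hL
  have hlast' : ∀ x, last x ≠ 0 → ∃ v, K v = last x ∧ x ∈ adj v := fun x hx => by
    obtain ⟨y, hy, hy'⟩ := (hlast x).2 hx
    exact ⟨y, hy', ((hG y).2 x).2 (mem_earlier.1 hy).1.symm⟩
  -- Keys are at most `2 n + 2`, so `2 n + 3` rounds reach them all.
  refine Runs.seq (b₁ := 6) (b₂ := 120 * degSum adj + 100 * n + 104)
    (Q := fun s' => s' = s.setReg 16 (2 * n + 3)) (Runs.flat (by decide) (by decide)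
      (fun _ => ?_) (fun _ => ?_)) ?_ (by omega)
  · simp only [Prog.safe, Expr.storable, Expr.eval, hn]
    omega
  · simp only [Prog.run, Expr.eval, hn]
    congr 1
    omega
  rintro s₁ hs₁ hf₁ rfl
  refine (Runs.forTo (N := 2 * n + 3) (c := fun t => (∑ v, if K v = t ∧ t ≠ 0 then
      ((adj v).map fun x => (if last x = t then 80 * (adj x).length + 40 else 0) + 40).sum
      else 0) + 22)
    (I := fun t s' => GreedyAt G (posOf n s) K last k (univ \ (C ∪ D)) t [] s')
    (by decide) (by decide) (by decide) (by simp) ?_ ?_ ?_ ?_).mono le_rfl ?_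
  · exact fun t s' x h => h.congr rfl (by simp) (fun _ _ _ => Iff.rfl)
  · refine ⟨∅, ∅, ⟨.init, fun y _ => by simp [hw], by simp [h12]⟩, fun x => ?_⟩
    simp
  · intro t s' ht hs' hf h2 hI
    have f0 : s'.arr 0 = s.arr 0 := hf.arr 0 (by decide)
    have f1 : s'.arr 1 = s.arr 1 := hf.arr 1 (by decide)
    have f2 : s'.arr 2 = s.arr 2 := hf.arr 2 (by decide)
    have f3 : s'.arr 3 = s.arr 3 := hf.arr 3 (by decide)
    have f4 : s'.arr 4 = s.arr 4 := hf.arr 4 (by decide)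
    have f13 : s'.arr 13 = s.arr 13 := hf.arr 13 (by decide)
    have f14 : s'.arr 14 = s.arr 14 := hf.arr 14 (by decide)
    have f15 : s'.arr 15 = s.arr 15 := hf.arr 15 (by decide)
    have r1 : s'.reg 1 = k := (hf.reg 1 (by decide)).trans (by simpa using hk)
    refine Runs.seq (b₁ := 3) (b₂ := (∑ v, if K v = t ∧ t ≠ 0 then
      ((adj v).map fun x => (if last x = t then 80 * (adj x).length + 40 else 0) + 40).sum
      else 0) + 19) (Q := fun s₂ => s₂ = s'.setReg 4 (s.arr 14 t)) (Runs.flat (by decide)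
      (by decide) (fun _ => by simp [Prog.safe, Expr.storable])
      (fun _ => by simp [Prog.run, Expr.eval, h2, f14])) ?_ (by omega)
    rintro s₂ hs₂ hf₂ rfl
    refine Runs.cond (b₁ := (∑ v, if K v = t ∧ t ≠ 0 then
      ((adj v).map fun x => (if last x = t then 80 * (adj x).length + 40 else 0) + 40).sum
      else 0) + 15) (b₂ := 1) (by decide) (fun h => ?_) (fun h => ?_)
      (by simp only [Expr.cost]; omega)
    · obtain ⟨v, hv, hKv, ht0⟩ := ho t (by simpa [Expr.eval] using h)
      refine Runs.seq (b₁ := 4) (b₂ := ((adj v).map fun x =>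
        (if last x = t then 80 * (adj x).length + 40 else 0) + 40).sum + 11)
        (Q := fun s₂ => s₂ = (s'.setReg 4 (s.arr 14 t)).setReg 4 v) (Runs.flat (by decide)
        (by decide) (fun hb => ?_) (fun _ => ?_)) ?_ ?_
      · simp only [Prog.safe, Expr.storable, Expr.eval]
        right
        have := hb.reg 4
        omega
      · simp [Prog.run, Expr.eval, hv]
      · rintro s₃ hs₃ hf₃ rfl
        have hpos : posOf n ((s'.setReg 4 (s.arr 14 t)).setReg 4 v) = posOf n s := by
          funext u
          simp [posOf, f4]
        refine (runs_greedyNbrs (K := K) (last := last) (v := v) (k := k) (t := t) (C := C)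
          (D := D) hG (by simpa [HasAdj, f0, f1] using hadj) (by omega) (by simpa [f13] using hK)
          (by simp [f15, hL]) (by simpa [HasSet, f2] using hC) (by simpa [HasSet, f3] using hD)
          (by simpa using r1) (by simp) (by simpa using h2) ht0 (by rwa [hpos]) (by rwa [hpos])
          (by rw [hpos]; exact hI.congr (by simp) (by simp) (fun _ _ _ => Iff.rfl))).mono le_rfl ?_
        intro s₄ hs₄ hf₄ hQ
        rw [hpos] at hQ
        refine hQ.congr rfl rfl fun x _ hx => ?_
        -- The scan of one list has met every vertex with last key `t`, so the dependence on the
        -- list can be dropped.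
        have : last x = t → x ∈ adj v := fun hxt => by
          obtain ⟨u, hu, hxu⟩ := hlast' x hx
          rwa [hinj v u (by omega) (by omega)]
        simp only [List.not_mem_nil, and_false, or_false]
        constructor
        · rintro (h | h)
          · omega
          · omega
        · intro h
          by_cases hxt : last x = t
          · exact Or.inr ⟨hxt, this hxt⟩
          · omega
      · have : ((adj v).map fun x =>
            (if last x = t then 80 * (adj x).length + 40 else 0) + 40).sum ≤
            ∑ v, if K v = t ∧ t ≠ 0 then ((adj v).map fun x =>
              (if last x = t then 80 * (adj x).length + 40 else 0) + 40).sum else 0 := by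
          refine le_trans (le_of_eq ?_) (single_le_sum (fun _ _ => Nat.zero_le _) (mem_univ v))
          rw [if_pos ⟨hKv, ht0⟩]
        omega
    · refine Runs.flat (by decide) (by decide) (fun _ => trivial) (fun _ => ?_)
      refine hI.congr rfl (by simp [Prog.run]) fun x _ hx => ?_
      have : last x ≠ t := fun hxt => by
        obtain ⟨u, hu, -⟩ := hlast' x hx
        have := ho' u (by omega)
        rw [hu, hxt] at this
        simp only [Expr.eval, State.setReg_reg, if_true] at h
        omega
      simp only [List.not_mem_nil, and_false, or_false]
      omega
  · have := sum_visit_cost_le (last := last) (fun v => (hG v).1) hinj (2 * n + 3)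
    simp only [sum_add_distrib, sum_const, card_range, smul_eq_mul] at this ⊢
    omega
  · rintro s' hs' hf ⟨P, A, h1, h2⟩
    refine ⟨P, A, h1, fun x => (h2 x).trans (and_congr_right fun _ => ?_)⟩
    refine ⟨fun h => h.1, fun h => ⟨h, Or.inl ?_⟩⟩
    obtain ⟨u, hu, -⟩ := hlast' x h
    have := hKle u
    omega

/-- The greedy algorithm finds an optimal set of additional vertices. -/
theorem GreedyState.optimal {pos K last : Fin n → ℕ} {k : ℕ} {C D P A : Finset (Fin n)}
    {s : State} (h : GreedyState G pos K k (univ \ (C ∪ D)) s P A)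
    (hkey : ∀ v, K v ≠ 0 ↔ Separates G pos v C D)
    (hk : ∀ v, K v ≠ 0 → k ≤ #(earlier G pos v)) (hlast : IsLast G pos K last)
    (hP : ∀ x, x ∈ P ↔ x ∈ univ \ (C ∪ D) ∧ last x ≠ 0) :
    ∃ U, Suffices G pos k C D U ∧ #U = s.reg 12 ∧ ∀ U', Suffices G pos k C D U' → #U ≤ #U' := by
  obtain ⟨h1, -, h3⟩ := h
  obtain ⟨g1, g2⟩ := h1.optimal hkey (fun v hv => Nat.sub_add_cancel (hk v hv))
    fun x hx hxP y hy hxy => by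
      have := (hlast x).1 y hxy
      exact hxP ((hP x).2 ⟨hx, by omega⟩)
  exact ⟨_, g1, h3.symm, g2⟩

end GreedyTotal

/-! ### The common core of the three programs -/

section Core

variable {n : ℕ} {G : SimpleGraph (Fin n)} {adj : Fin n → List (Fin n)}

/-- Array `a` is the characteristic vector of `C`. -/
def IsChar (a : ℕ) (C : Finset (Fin n)) (s : State) : Prop :=
  ∀ v : Fin n, s.arr a v = if v ∈ C then 1 else 0

theorem IsChar.hasSet {a : ℕ} {C : Finset (Fin n)} {s : State} (h : IsChar a C s) :
    HasSet a C s := fun v => by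
  rw [h v]
  split_ifs with hv <;> simp [hv]

/-- The memory holds the input: the graph, the cliques `C` and `D` and the threshold `k`. -/
structure HoldsInput (adj : Fin n → List (Fin n)) (C D : Finset (Fin n)) (k : ℕ) (s : State) :
    Prop where
  adj : HasAdj adj s
  left : IsChar 2 C s
  right : IsChar 3 D s
  size : s.reg 0 = n
  threshold : s.reg 1 = k

variable {C D : Finset (Fin n)} {k : ℕ}

theorem HoldsInput.congr {s s' : State} (h : HoldsInput adj C D k s)
    (ha : ∀ a, a < 4 → s'.arr a = s.arr a) (h0 : s'.reg 0 = s.reg 0) (h1 : s'.reg 1 = s.reg 1) :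
    HoldsInput adj C D k s' := by
  obtain ⟨g1, g2, g3, g4, g5⟩ := h
  refine ⟨?_, ?_, ?_, by omega, by omega⟩
  · unfold HasAdj at g1 ⊢
    rwa [ha 0 (by omega), ha 1 (by omega)]
  · unfold IsChar at g2 ⊢
    rwa [ha 2 (by omega)]
  · unfold IsChar at g3 ⊢
    rwa [ha 3 (by omega)]

theorem Frame.holdsInput {p : Prog} {s s' : State} (hf : Frame p s s')
    (h : HoldsInput adj C D k s) (ha : ∀ a < 4, a ∉ p.writesArr) (hr : ∀ r < 2, r ∉ p.writesReg) :
    HoldsInput adj C D k s' :=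
  h.congr (fun a h' => hf.arr a (ha a h')) (hf.reg 0 (hr 0 (by omega)))
    (hf.reg 1 (hr 1 (by omega)))

theorem Searched.congr {s s' : State} (h : Searched G s) (h4 : s'.arr 4 = s.arr 4)
    (h5 : s'.arr 5 = s.arr 5) (h6 : s'.arr 6 = s.arr 6) (h7 : s'.arr 7 = s.arr 7) :
    Searched G s' := by
  obtain ⟨g1, g2, g3, g4, g5, g6, g7⟩ := h
  exact ⟨by rwa [h4], by rwa [h4], by rwa [h4, h7], by rwa [h4], by rwa [h4], by rwa [h4, h5],
    by rwa [h4, h6]⟩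

/-- Count in register `r` the vertices for which the expression, evaluated with the vertex in
register `4`, is nonzero. -/
def countLoop (e : Expr) (r : ℕ) : Prog :=
  forTo 4 0 (.cond e (.assign r (.add (.reg r) (.const 1))) .skip)

theorem runs_countLoop {B r : ℕ} {e : Expr} {s : State} {E : Finset (Fin n)} (hr4 : r ≠ 4)
    (hr0 : r ≠ 0) (he : e.growth ≤ 8) (hec : e.cost ≤ 10) (hnB : n ≤ B) (hn : s.reg 0 = n)
    (h0 : s.reg r = 0)
    (h : ∀ (s' : State) (v : Fin n), s'.arr = s.arr → s'.reg 4 = v → (e.eval s' ≠ 0 ↔ v ∈ E)) :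
    Runs B (countLoop e r) s (30 * n + 6) fun s' => s'.reg r = #E := by
  refine (Runs.forTo (N := n) (c := fun _ => 15)
    (I := fun i s' => s'.reg r = #(E.filter fun v => v.val < i))
    (by simp [Prog.writesReg, Ne.symm hr4]) (by simp [Prog.writesReg, Ne.symm hr0]) (by decide)
    hn ?_ ?_ ?_ ?_).mono le_rfl ?_
  · intro i s' x hI
    simpa [hr4] using hI
  · simp [h0]
  · intro i s' hi hs' hf h4 hI
    obtain ⟨v, hv⟩ : ∃ v : Fin n, (v : ℕ) = i := ⟨⟨i, hi⟩, rfl⟩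
    have ha : s'.arr = s.arr := by
      funext a
      exact hf.arr a (by simp [forTo, Prog.writesArr])
    have hev := h s' v ha (by rw [h4, hv])
    have hfilter : E.filter (fun u => u.val < i + 1) =
        if v ∈ E then insert v (E.filter fun u => u.val < i) else E.filter fun u => u.val < i := by
      ext u
      have : u = v ↔ u.val = i := by rw [Fin.ext_iff, hv]
      split_ifs with hvE
      · simp only [mem_filter, mem_insert, this]
        constructor
        · rintro ⟨h1, h2⟩
          by_cases h3 : u.val = i
          · exact Or.inl h3
          · exact Or.inr ⟨h1, by omega⟩
        · rintro (h1 | ⟨h1, h2⟩)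
          · exact ⟨this.2 h1 ▸ hvE, by omega⟩
          · exact ⟨h1, by omega⟩
      · simp only [mem_filter]
        refine and_congr_right fun h1 => ?_
        have : u.val ≠ i := fun h2 => hvE (this.2 h2 ▸ h1)
        omega
    have hcard : #(E.filter fun u => u.val < i) ≤ i := by
      have := card_le_card_of_injOn (s := E.filter fun u => u.val < i) (t := range i)
        (fun u => u.val) (fun u hu => by simpa using (mem_filter.1 hu).2)
        (fun a _ b _ hab => Fin.ext hab)
      simpa using this
    refine Runs.flat (by simp [Prog.flat, Expr.growth, he])
      (by simp only [Prog.maxCost, Expr.cost]; omega) (fun _ => ⟨fun _ => ?_, fun _ => trivial⟩)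
      (fun _ => ?_)
    · simp only [Prog.safe, Expr.storable, Expr.eval, hI]
      omega
    · rw [hfilter]
      simp only [Prog.run, hev]
      split_ifs with hvE
      · rw [card_insert_of_notMem (by simp [hv])]
        simp [Expr.eval, hI]
      · exact hI
  · simp only [sum_const, card_range, smul_eq_mul]
    omega
  · intro s' _ _ hI
    simpa using hI

/-- Decide whether `D` can be reached from `C` by token addition and removal, and if so, compute
in register `12` the smallest number of additional vertices. Registers `14` and `15` receive the
sizes of `C \ D` and `D \ C`, and register `13` is nonzero if `D` cannot be reached. -/
def core : Prog :=
  .seq search (.seq (markLoop 11 2) (.seq (markLoop 12 3) (.seq keyLoop (.seq lastLoop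
    (.seq greedyLoop (.seq (countLoop (.sub (.load 2 (.reg 4)) (.load 3 (.reg 4))) 14)
      (countLoop (.sub (.load 3 (.reg 4)) (.load 2 (.reg 4))) 15)))))))

/-- The result of `core`. -/
structure CoreResult (G : SimpleGraph (Fin n)) (C D : Finset (Fin n)) (k : ℕ) (s : State) :
    Prop where
  left : s.reg 14 = #(C \ D)
  right : s.reg 15 = #(D \ C)
  extra_le : s.reg 13 = 0 → s.reg 12 ≤ n
  infeasible : s.reg 13 ≠ 0 → ∀ l, ¬HasReconfSeq G (TARStep k) C D l
  lower : s.reg 13 = 0 → ∀ l, HasReconfSeq G (TARStep k) C D l →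
    #(C \ D) + #(D \ C) + 2 * s.reg 12 ≤ l
  upper : s.reg 13 = 0 → k ≤ #C → k ≤ #D →
    ∃ l ≤ #(C \ D) + #(D \ C) + 2 * s.reg 12, HasReconfSeq G (TARStep k) C D l

/-- The frame conditions of the phases keep the input and all intermediate results, and ensure that
each phase finds its own cells still zero. The postcondition combines the lower and upper bounds on
sequence lengths with the optimality of the greedy choice. -/
theorem runs_core {B : ℕ} {s : State} (hG : IsAdjList G adj) (hch : IsChordal G)
    (hC : G.IsClique (C : Set (Fin n))) (hD : G.IsClique (D : Set (Fin n)))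
    (hin : HoldsInput adj C D k s) (hB : degSum adj + 2 * n + 3 ≤ B)
    (hr : ∀ r, 8 ≤ r → s.reg r = 0) (ha : ∀ a, 4 ≤ a → ∀ i, s.arr a i = 0) :
    Runs B core s (360 * degSum adj + 650 * n + 200) (CoreResult G C D k) := by
  refine Runs.seq (runs_search hin.adj hG hin.size (by omega) (hr 8 (by decide))
    (hr 9 (by decide)) (hr 10 (by decide)) ha)
    (b₂ := 160 * degSum adj + 350 * n + 180) ?_ (by omega)
  intro s₁ hs₁ f₁ hS
  have i₁ := f₁.holdsInput hin (by decide) (by decide)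
  have hpeo : IsPEO G (posOf n s₁) := hS.mcs.isPEO hch hS.inj
  have z₁ : ∀ a, 11 ≤ a → a ≤ 15 → ∀ i, s₁.arr a i = 0 := fun a h1 h2 i => by
    rw [f₁.arr a (by interval_cases a <;> decide), ha a (by omega)]
  refine Runs.seq (runs_markLoop (C := C) (by decide) (by decide) i₁.size hS i₁.left.hasSet
    (z₁ 11 (by decide) (by decide))) (b₂ := 160 * degSum adj + 310 * n + 170) ?_ (by omega)
  intro s₂ hs₂ f₂ hM
  have i₂ := f₂.holdsInput i₁ (by decide) (by decide)
  have hS₂ := hS.congr (f₂.arr 4 (by decide)) (f₂.arr 5 (by decide)) (f₂.arr 6 (by decide))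
    (f₂.arr 7 (by decide))
  have hp₂ : posOf n s₂ = posOf n s₁ := by
    funext v
    rw [posOf, posOf, f₂.arr 4 (by decide)]
  refine Runs.seq (runs_markLoop (C := D) (by decide) (by decide) i₂.size hS₂ i₂.right.hasSet
    (fun i => by rw [f₂.arr 12 (by decide), z₁ 12 (by decide) (by decide)]))
    (b₂ := 160 * degSum adj + 270 * n + 160) ?_ (by omega)
  intro s₃ hs₃ f₃ hM'
  have i₃ := f₃.holdsInput i₂ (by decide) (by decide)
  have hS₃ := hS₂.congr (f₃.arr 4 (by decide)) (f₃.arr 5 (by decide)) (f₃.arr 6 (by decide))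
    (f₃.arr 7 (by decide))
  have hp₃ : posOf n s₃ = posOf n s₁ := by
    rw [← hp₂]
    funext v
    rw [posOf, posOf, f₃.arr 4 (by decide)]
  -- Positions run from one to `n`, and the key needs a strict bound on them, hence `n + 1`.
  set K := sepKey G (posOf n s₁) (n + 1) C D with hK
  have hposn : ∀ v, posOf n s₁ v < n + 1 := fun v => Nat.lt_succ_of_le (hS.pos_le v)
  rw [hp₂] at hM'
  refine Runs.seq (runs_keyLoop (C := C) (D := D) (K := K) i₃.size hS₃ (by omega) (by rw [hp₃])
    (fun v => by
      rw [hp₃, f₃.arr 11 (by decide), f₃.arr 2 (by decide)]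
      exact hM v)
    (fun v => by
      rw [hp₃]
      exact hM' v)
    (fun i => by
      rw [f₃.arr 13 (by decide), f₂.arr 13 (by decide), z₁ 13 (by decide) (by decide)])
    (fun i => by
      rw [f₃.arr 14 (by decide), f₂.arr 14 (by decide), z₁ 14 (by decide) (by decide)])
    (by rw [f₃.reg 13 (by decide), f₂.reg 13 (by decide), f₁.reg 13 (by decide),
      hr 13 (by decide)]))
    (b₂ := 160 * degSum adj + 200 * n + 150) ?_ (by omega)
  rintro s₄ hs₄ f₄ ⟨k1, k2, k3, k4⟩
  have i₄ := f₄.holdsInput i₃ (by decide) (by decide)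
  have hp₄ : posOf n s₄ = posOf n s₁ := by
    rw [← hp₃]
    funext v
    rw [posOf, posOf, f₄.arr 4 (by decide)]
  refine Runs.seq (runs_lastLoop (K := K) i₄.size hG i₄.adj k1 (fun i => by
    rw [f₄.arr 15 (by decide), f₃.arr 15 (by decide), f₂.arr 15 (by decide),
      z₁ 15 (by decide) (by decide)]))
    (b₂ := 120 * degSum adj + 170 * n + 140) ?_ (by omega)
  intro s₅ hs₅ f₅ hlast
  have i₅ := f₅.holdsInput i₄ (by decide) (by decide)
  have hp₅ : posOf n s₅ = posOf n s₁ := by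
    rw [← hp₄]
    funext v
    rw [posOf, posOf, f₅.arr 4 (by decide)]
  rw [hp₄] at hlast
  have hcons : Consecutive G (posOf n s₁) K := hpeo.consecutive hposn hC hD
  have hw : ∀ v : Fin n, s₃.arr 5 v = #(earlier G (posOf n s₁) v) := fun v => by
    have := hS₃.weight v
    rw [this]
    exact congrArg (fun p => #(earlier G p v)) hp₃
  refine Runs.seq (runs_greedyLoop (K := K) (k := k) (C := C) (D := D) hG i₅.adj (by omega)
    i₅.size i₅.threshold
    (by rw [f₅.reg 12 (by decide), f₄.reg 12 (by decide), f₃.reg 12 (by decide),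
      f₂.reg 12 (by decide), f₁.reg 12 (by decide), hr 12 (by decide)])
    (fun v => by rw [hp₅, f₅.arr 5 (by decide), f₄.arr 5 (by decide), hw v])
    (fun v => by rw [f₅.arr 13 (by decide), k1 v]) i₅.left.hasSet i₅.right.hasSet
    (by rw [f₅.arr 14 (by decide)]; exact k2) (by rw [f₅.arr 14 (by decide)]; exact k3)
    (fun u v h1 h2 => sepKey_injective hposn hS.inj h1 h2)
    (fun v => (sepKey_le hposn v).trans (by omega)) (by rwa [hp₅]) (by rwa [hp₅]))
    (b₂ := 70 * n + 30) ?_ (by omega)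
  rintro s₆ hs₆ f₆ ⟨P, A, hst, hP⟩
  rw [hp₅] at hst
  have i₆ := f₆.holdsInput i₅ (by decide) (by decide)
  have c₁ : ∀ {s₇ s' : State} {v : Fin n}, HoldsInput adj C D k s₇ → s'.arr = s₇.arr →
      s'.reg 4 = v → (Expr.eval s' (.sub (.load 2 (.reg 4)) (.load 3 (.reg 4))) ≠ 0 ↔
        v ∈ C \ D) ∧ (Expr.eval s' (.sub (.load 3 (.reg 4)) (.load 2 (.reg 4))) ≠ 0 ↔
        v ∈ D \ C) := fun {s₇ s' v} hi hs h4 => by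
    simp only [Expr.eval, h4, hs, hi.left v, hi.right v, mem_sdiff]
    by_cases h1 : v ∈ C <;> by_cases h2 : v ∈ D <;> simp [h1, h2]
  refine Runs.seq (runs_countLoop (E := C \ D) (by decide) (by decide) (by decide) (by decide)
    (by omega) i₆.size
    (by rw [f₆.reg 14 (by decide), f₅.reg 14 (by decide), f₄.reg 14 (by decide),
      f₃.reg 14 (by decide), f₂.reg 14 (by decide), f₁.reg 14 (by decide), hr 14 (by decide)])
    fun s' v hs h4 => (c₁ i₆ hs h4).1) (b₂ := 30 * n + 10) ?_ (by omega)
  intro s₇ hs₇ f₇ h14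
  have i₇ := f₇.holdsInput i₆ (by decide) (by decide)
  refine (runs_countLoop (E := D \ C) (by decide) (by decide) (by decide) (by decide)
    (by omega) i₇.size
    (by rw [f₇.reg 15 (by decide), f₆.reg 15 (by decide), f₅.reg 15 (by decide),
      f₄.reg 15 (by decide), f₃.reg 15 (by decide), f₂.reg 15 (by decide), f₁.reg 15 (by decide),
      hr 15 (by decide)])
    fun s' v hs h4 => (c₁ i₇ hs h4).2).mono (by omega) ?_
  intro s₈ hs₈ f₈ h15
  have e13 : s₈.reg 13 = s₄.reg 13 := by
    rw [f₈.reg 13 (by decide), f₇.reg 13 (by decide), f₆.reg 13 (by decide),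
      f₅.reg 13 (by decide)]
  have e12 : s₈.reg 12 = s₆.reg 12 := by
    rw [f₈.reg 12 (by decide), f₇.reg 12 (by decide)]
  have hsd : #(symmDiff C D) = #(C \ D) + #(D \ C) := by
    rw [card_symmDiff_eq, add_comm]
  rw [i₃.threshold, ← e13] at k4
  have hkey : ∀ v, K v ≠ 0 ↔ Separates G (posOf n s₁) v C D := fun v => sepKey_ne_zero hposn
  have hopt : s₈.reg 13 = 0 → ∃ U, Suffices G (posOf n s₁) k C D U ∧ #U = s₈.reg 12 ∧
      ∀ U', Suffices G (posOf n s₁) k C D U' → #U ≤ #U' := fun h => by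
    rw [e12]
    refine hst.optimal hkey (fun v hv => ?_) hlast hP
    rw [← hw v]
    by_contra hlt
    exact k4.2 ⟨v, hv, not_le.1 hlt⟩ h
  refine ⟨by rw [f₈.reg 14 (by decide), h14], h15, fun h => ?_, fun h l hl => ?_,
    fun h l hl => ?_, fun h h1 h2 => ?_⟩
  · obtain ⟨U, -, hU, -⟩ := hopt h
    rw [← hU]
    exact (card_le_univ U).trans (by simp)
  -- A sequence would put at least `k` vertices into a separator that has fewer.
  · obtain ⟨v, hv, hlt⟩ := k4.1 h
    obtain ⟨U, ⟨-, hU⟩, -⟩ := hpeo.exists_suffices hl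
    have := hU v ((hkey v).1 hv)
    have h2 := card_le_card (inter_subset_right (s₁ := U ∪ (C ∪ D))
      (s₂ := earlier G (posOf n s₁) v))
    rw [hw v] at hlt
    omega
  · obtain ⟨U, -, hU, hmin⟩ := hopt h
    obtain ⟨U', hU', hle⟩ := hpeo.exists_suffices hl
    have := hmin U' hU'
    omega
  · obtain ⟨U, hU, hc, -⟩ := hopt h
    obtain ⟨l, hl, hseq⟩ := hpeo.exists_seq hC hD h1 h2 hU
    exact ⟨l, by omega, hseq⟩

end Core

/-! ### The initial memory -/

section InitialState

variable {n : ℕ} {G : SimpleGraph (Fin n)} {adj : Fin n → List (Fin n)}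

theorem degSum_eq (hG : IsAdjList G adj) : degSum adj = 2 * G.edgeSet.ncard := by
  classical
  rw [Set.ncard_eq_toFinset_card', ← SimpleGraph.edgeFinset, ← G.sum_degrees_eq_twice_card_edges,
    degSum]
  refine sum_congr rfl fun v _ => ?_
  rw [← SimpleGraph.card_neighborFinset_eq_degree, ← List.toFinset_card_of_nodup (hG v).1]
  congr 1
  ext w
  simp [(hG v).2]

theorem sum_length_lt (adj : Fin n → List (Fin n)) (i : ℕ) (hi : i ≤ n) :
    ∑ u : Fin n with u.val < i, (adj u).length = ((List.ofFn adj).take i).flatten.length := by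
  induction i with
  | zero => simp
  | succ i ih =>
    have hf : (univ.filter fun u : Fin n => u.val < i + 1) =
        insert ⟨i, hi⟩ (univ.filter fun u : Fin n => u.val < i) := by
      ext u
      simp only [mem_filter, mem_univ, true_and, mem_insert, Fin.ext_iff]
      omega
    rw [hf, sum_insert (by simp), ih (by omega),
      List.take_succ_eq_append_getElem (by simpa using hi)]
    simp only [List.getElem_ofFn, List.flatten_append, List.flatten_singleton, List.length_append]
    exact add_comm _ _

theorem getD_flatten (adj : Fin n → List (Fin n)) (v : Fin n) (i : ℕ) (h : i < (adj v).length) :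
    ((List.ofFn adj).flatten.map Fin.val).getD
      (((List.ofFn adj).take v).flatten.length + i) 0 = ((adj v)[i] : ℕ) := by
  have hv : (v : ℕ) < (List.ofFn adj).length := by simp
  have hsplit : (List.ofFn adj).flatten = ((List.ofFn adj).take v).flatten ++
      (adj v ++ ((List.ofFn adj).drop (v + 1)).flatten) := by
    conv_lhs => rw [← List.take_append_drop v (List.ofFn adj), List.drop_eq_getElem_cons hv]
    simp
  rw [hsplit, List.map_append, List.getD_append_right _ _ _ _
    (by rw [List.length_map]; exact Nat.le_add_right _ _), List.length_map, Nat.add_sub_cancel_left,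
    List.map_append, List.getD_append _ _ _ _ (by simpa using h)]
  simp [List.getD_eq_getElem?_getD, h]

/-- The offset of `v` is the length of the concatenation of the lists before it, so the list of `v`
starts at this cell. -/
theorem hasAdj_initState (C D : Finset (Fin n)) (k : ℕ) : HasAdj adj (initState adj C D k) := by
  intro v
  have h0 : ∀ i ≤ n, (initState adj C D k).arr 0 i =
      ((List.ofFn adj).take i).flatten.length := fun i hi => by
    rw [← sum_length_lt adj i hi]
    simp [initState, hi]
  constructor
  · rw [h0 _ v.isLt, h0 _ v.isLt.le, List.take_succ_eq_append_getElem (by simp)]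
    simp
  · intro i hi
    rw [h0 _ v.isLt.le, ← getD_flatten adj v i hi]
    rfl

theorem holdsInput_initState (C D : Finset (Fin n)) (k : ℕ) :
    HoldsInput adj C D k (initState adj C D k) :=
  ⟨hasAdj_initState C D k, fun v => by simp [initState, Fin.ext_iff.symm],
    fun v => by simp [initState, Fin.ext_iff.symm], rfl, rfl⟩

theorem initState_reg_eq_zero (C D : Finset (Fin n)) (k : ℕ) {r : ℕ} (hr : 2 ≤ r) :
    (initState adj C D k).reg r = 0 := by
  simp only [initState]
  rw [if_neg (by omega), if_neg (by omega)]

theorem initState_arr_eq_zero (C D : Finset (Fin n)) (k : ℕ) {a : ℕ} (ha : 4 ≤ a) (i : ℕ) :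
    (initState adj C D k).arr a i = 0 := by
  simp only [initState]
  rw [if_neg (by omega), if_neg (by omega), if_neg (by omega), if_neg (by omega)]

theorem bounded_initState {B : ℕ} (C D : Finset (Fin n)) {k : ℕ} (hk : k ≤ n)
    (h8 : 8 ≤ B) (hn : n ≤ B) (hB : degSum adj ≤ B) : Bounded B (initState adj C D k) := by
  refine ⟨h8, fun r => ?_, fun a i => ?_⟩
  · simp only [initState]
    split_ifs <;> omega
  · simp only [initState]
    split_ifs <;> try omega
    · exact (sum_le_sum_of_subset (subset_univ _)).trans hB
    · rw [List.getD_eq_getElem?_getD]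
      rcases lt_or_ge i ((List.ofFn adj).flatten.map Fin.val).length with h | h
      · rw [List.getElem?_eq_getElem h, Option.getD_some, List.getElem_map]
        exact (Fin.is_lt _).le.trans hn
      · rw [List.getElem?_eq_none h]
        exact Nat.zero_le _

end InitialState

/-! ### The three programs -/

section Main

variable {n : ℕ} {G : SimpleGraph (Fin n)} {adj : Fin n → List (Fin n)} {C D : Finset (Fin n)}
  {k B b : ℕ}

/-- Answer that there is no sequence. -/
def answerTop : Prog := .assign 0 (.const 0)

/-- Answer with the value of an expression. -/
def answer (e : Expr) : Prog := .seq (.assign 1 e) (.assign 0 (.const 1))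

theorem runs_answerTop {s : State} {d : ℕ∞} (hd : d = ⊤) :
    Runs B answerTop s 2 fun s' => Outputs s' d :=
  Runs.flat (by decide) (by decide) (fun _ => Nat.zero_le _)
    (fun _ => Or.inl ⟨by simp [answerTop, Prog.run, Expr.eval], hd⟩)

theorem runs_answer {s : State} {e : Expr} {d : ℕ∞} (he : e.growth ≤ 8) (hec : e.cost ≤ 7)
    (hs : e.storable B s) (hd : d = (e.eval s : ℕ)) :
    Runs B (answer e) s 10 fun s' => Outputs s' d :=
  Runs.flat (by simp [answer, Prog.flat, he, Expr.growth])
    (by simp only [answer, Prog.maxCost, Expr.cost]; omega)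
    (fun hb => ⟨hs, by simp only [Prog.safe, Expr.storable]; have := hb.eight_le; omega⟩)
    (fun _ => Or.inr ⟨by simp [answer, Prog.run, Expr.eval], by simp [answer, Prog.run, hd]⟩)

/-- The program for token addition and removal. -/
def tarProg : Prog :=
  .seq core (.cond (.reg 13) answerTop
    (answer (.add (.add (.reg 14) (.reg 15)) (.add (.reg 12) (.reg 12)))))

/-- The output for rules that preserve the number of tokens. -/
def slideAnswer : Prog :=
  .cond (.reg 13) answerTop (.cond (.add (.sub (.reg 14) (.reg 15)) (.sub (.reg 15) (.reg 14)))
    answerTop (answer (.add (.reg 14) (.reg 12))))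

/-- The program for token sliding. -/
def tsProg : Prog := .seq (countLoop (.load 2 (.reg 4)) 1) (.seq core slideAnswer)

/-- The program for token jumping. -/
def tjProg : Prog :=
  .seq (.seq (countLoop (.load 2 (.reg 4)) 1) (.assign 1 (.sub (.reg 1) (.const 1))))
    (.seq core slideAnswer)

theorem card_sdiff_le_size (C D : Finset (Fin n)) : #(C \ D) ≤ n :=
  (card_le_univ _).trans (by simp)

theorem CoreResult.runs_tar {s : State} (h : CoreResult G C D k s) (hB : 4 * n ≤ B)
    (hkC : k ≤ #C) (hkD : k ≤ #D) :
    Runs B (.cond (.reg 13) answerTop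
      (answer (.add (.add (.reg 14) (.reg 15)) (.add (.reg 12) (.reg 12))))) s 12
      fun s' => Outputs s' (reconfDist G (TARStep k) C D) := by
  refine Runs.cond (b₁ := 2) (b₂ := 10) (by decide) (fun h13 => ?_) (fun h13 => ?_) (by decide)
  · exact runs_answerTop (reconfDist_eq_top (h.infeasible h13))
  · have h1 := card_sdiff_le_size C D
    have h2 := card_sdiff_le_size D C
    have h3 := h.extra_le h13
    refine runs_answer (by decide) (by decide) ?_ ?_
    · simp only [Expr.storable, Expr.eval, h.left, h.right]
      omega
    · simp only [Expr.eval, h.left, h.right]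
      rw [← two_mul]
      obtain ⟨l, hl, hseq⟩ := h.upper h13 hkC hkD
      obtain rfl := hl.antisymm (h.lower h13 l hseq)
      exact reconfDist_eq hseq (h.lower h13)

theorem card_sdiff_comm_iff : #(C \ D) = #(D \ C) ↔ #C = #D := by
  have h1 := card_sdiff_add_card_inter C D
  have h2 := card_sdiff_add_card_inter D C
  rw [inter_comm] at h2
  omega

/-- If sequences under `R` correspond to sequences under addition and removal of twice the length,
the distance is half of `|C \ D| + |D \ C| + 2 |U|`, that is `|C \ D| + |U|` for cliques of equal
size. Unequal sizes are detected by comparing the two differences. -/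
theorem CoreResult.runs_slideAnswer {s : State} {R : Finset (Fin n) → Finset (Fin n) → Prop}
    (h : CoreResult G C D k s) (hB : 4 * n ≤ B) (hkC : k ≤ #C)
    (hcard : ∀ l, HasReconfSeq G R C D l → #C = #D)
    (hto : ∀ l, HasReconfSeq G R C D l → HasReconfSeq G (TARStep k) C D (2 * l))
    (hof : #C = #D → ∀ l, HasReconfSeq G (TARStep k) C D l →
      ∃ l', 2 * l' ≤ l ∧ HasReconfSeq G R C D l') :
    Runs B slideAnswer s 20 fun s' => Outputs s' (reconfDist G R C D) := by
  refine Runs.cond (b₁ := 2) (b₂ := 18) (by decide) (fun h13 => ?_) (fun h13 => ?_) (by decide)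
  · exact runs_answerTop (reconfDist_eq_top fun l hl => h.infeasible h13 _ (hto l hl))
  have h1 := card_sdiff_le_size C D
  have h3 := h.extra_le h13
  refine Runs.cond (b₁ := 2) (b₂ := 10) (by decide) (fun hne => ?_) (fun heq => ?_) (by decide)
  · refine runs_answerTop (reconfDist_eq_top fun l hl => hne ?_)
    have := card_sdiff_comm_iff.2 (hcard l hl)
    simp only [Expr.eval, h.left, h.right]
    omega
  · simp only [Expr.eval, h.left, h.right] at heq
    have hsd : #(C \ D) = #(D \ C) := by omega
    have hCD := card_sdiff_comm_iff.1 hsd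
    refine runs_answer (by decide) (by decide) ?_ ?_
    · simp only [Expr.storable, Expr.eval, h.left]
      omega
    · simp only [Expr.eval, h.left]
      obtain ⟨l, hl, hseq⟩ := h.upper h13 hkC (hCD ▸ hkC)
      obtain ⟨l', hl', hseq'⟩ := hof hCD l hseq
      have hmin : ∀ m, HasReconfSeq G R C D m → #(C \ D) + s.reg 12 ≤ m := fun m hm => by
        have := h.lower h13 _ (hto m hm)
        omega
      have := hmin l' hseq'
      obtain rfl : l' = #(C \ D) + s.reg 12 := by omega
      exact reconfDist_eq hseq' hmin

theorem Runs.computesWithin {p : Prog} {s : State} {d : ℕ∞}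
    (h : Runs B p s b fun s' => Outputs s' d) (hs : Bounded B s) (hb : b ≤ 8 * B) :
    ComputesWithin (8 * B) p s d := by
  obtain ⟨t, s', h1, h2, -, -, h5⟩ := h hs
  exact ⟨t, s', h1, h2.trans hb, h5⟩

theorem computesWithin_of_runs {p : Prog} {d : ℕ∞} (hG : IsAdjList G adj) (hk : k ≤ n)
    (h : ∀ B, degSum adj + 4 * n + 3 ≤ B →
      Runs B p (initState adj C D k) (360 * degSum adj + 690 * n + 300)
        fun s' => Outputs s' d) :
    ComputesWithin (800 * (graphSize G + 1)) p (initState adj C D k) d := by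
  have hdeg := degSum_eq hG
  -- Memory contents are bounded by `B = 100 (n + m + 1)` and intermediate values by `8 B`. As
  -- `degSum` is `2 m`, the running time is at most `720 m + 690 n + 300`, which is below `8 B` as
  -- well.
  have hB : 800 * (graphSize G + 1) = 8 * (100 * (graphSize G + 1)) := by omega
  rw [hB]
  unfold graphSize
  exact (h _ (by omega)).computesWithin
    (bounded_initState C D hk (by omega) (by omega) (by omega)) (by omega)

theorem computesWithin_tarProg (hG : IsAdjList G adj) (hch : IsChordal G)
    (hC : G.IsClique (C : Set (Fin n))) (hD : G.IsClique (D : Set (Fin n))) (hkC : k ≤ #C)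
    (hkD : k ≤ #D) :
    ComputesWithin (800 * (graphSize G + 1)) tarProg (initState adj C D k)
      (reconfDist G (TARStep k) C D) := by
  refine computesWithin_of_runs hG (hkC.trans ((card_le_univ C).trans (by simp))) fun B hB => ?_
  exact Runs.seq (runs_core hG hch hC hD (holdsInput_initState C D k) (by omega)
    (fun r hr => initState_reg_eq_zero C D k (by omega))
    (fun a ha => initState_arr_eq_zero C D k ha))
    (fun s' _ _ h => h.runs_tar (by omega) hkC hkD) (by omega)

theorem runs_coreSlide {s : State} {R : Finset (Fin n) → Finset (Fin n) → Prop}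
    (hG : IsAdjList G adj) (hch : IsChordal G)
    (hC : G.IsClique (C : Set (Fin n))) (hD : G.IsClique (D : Set (Fin n)))
    (hin : HoldsInput adj C D k s) (hB : degSum adj + 4 * n + 3 ≤ B)
    (hr : ∀ r, 8 ≤ r → s.reg r = 0) (ha : ∀ a, 4 ≤ a → ∀ i, s.arr a i = 0) (hkC : k ≤ #C)
    (hcard : ∀ l, HasReconfSeq G R C D l → #C = #D)
    (hto : ∀ l, HasReconfSeq G R C D l → HasReconfSeq G (TARStep k) C D (2 * l))
    (hof : #C = #D → ∀ l, HasReconfSeq G (TARStep k) C D l →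
      ∃ l', 2 * l' ≤ l ∧ HasReconfSeq G R C D l') :
    Runs B (.seq core slideAnswer) s (360 * degSum adj + 650 * n + 220)
      fun s' => Outputs s' (reconfDist G R C D) :=
  Runs.seq (runs_core hG hch hC hD hin (by omega) hr ha)
    (fun s' _ _ h => h.runs_slideAnswer (by omega) hkC hcard hto hof) le_rfl

theorem runs_countLeft (hB : n ≤ B) :
    Runs B (countLoop (.load 2 (.reg 4)) 1) (initState adj C D 0) (30 * n + 6)
      fun s' => s'.reg 1 = #C :=
  runs_countLoop (by decide) (by decide) (by decide) (by decide) hB rfl rfl fun s' v hs h4 => by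
    simp only [Expr.eval, h4, hs]
    exact (holdsInput_initState (adj := adj) C D 0).left.hasSet v

theorem Frame.holdsInput_initState {p : Prog} {s : State} (hf : Frame p (initState adj C D 0) s)
    (ha : p.writesArr = []) (hr : 0 ∉ p.writesReg) (h1 : s.reg 1 = k) :
    HoldsInput adj C D k s ∧ ∀ a, 4 ≤ a → ∀ i, s.arr a i = 0 := by
  have h := CliqueReconf.holdsInput_initState (adj := adj) C D 0
  have hf' : s.arr = (initState adj C D 0).arr := by
    funext a
    exact hf.arr a (by simp [ha])
  refine ⟨⟨?_, ?_, ?_, (hf.reg 0 hr).trans h.size, h1⟩, fun a h4 i => ?_⟩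
  · unfold HasAdj
    rw [hf']
    exact h.adj
  · unfold IsChar
    rw [hf']
    exact h.left
  · unfold IsChar
    rw [hf']
    exact h.right
  · rw [hf']
    exact initState_arr_eq_zero C D 0 h4 i

/-- The threshold `#C` is not part of the input; the program counts it into register `1`, using no
array and no register that the core expects to be zero. -/
theorem computesWithin_tsProg (hG : IsAdjList G adj) (hch : IsChordal G)
    (hC : G.IsClique (C : Set (Fin n))) (hD : G.IsClique (D : Set (Fin n))) :
    ComputesWithin (800 * (graphSize G + 1)) tsProg (initState adj C D 0)
      (reconfDist G (TSStep G) C D) := by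
  refine computesWithin_of_runs hG (Nat.zero_le n) fun B hB => ?_
  refine Runs.seq (runs_countLeft (by omega)) (b₂ := 360 * degSum adj + 650 * n + 220) ?_
    (by omega)
  intro s _ hf h1
  obtain ⟨hin, ha⟩ := hf.holdsInput_initState (by decide) (by decide) h1
  refine runs_coreSlide hG hch hC hD hin hB (fun r hr => ?_) ha le_rfl
    (fun l hl => card_eq_of_seq (fun _ _ h => h.1) hl) (fun l hl => tar_of_ts hl)
    fun hCD l hl => ?_
  · rw [hf.reg r (by simp [countLoop, forTo, Prog.writesReg]; omega)]
    exact initState_reg_eq_zero C D 0 (by omega)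
  · obtain ⟨l', h, h'⟩ := ts_of_tar hl subset_rfl rfl hCD.symm
    exact ⟨l', by omega, h'⟩

theorem computesWithin_tjProg (hG : IsAdjList G adj) (hch : IsChordal G)
    (hC : G.IsClique (C : Set (Fin n))) (hD : G.IsClique (D : Set (Fin n))) :
    ComputesWithin (800 * (graphSize G + 1)) tjProg (initState adj C D 0)
      (reconfDist G TJStep C D) := by
  refine computesWithin_of_runs hG (Nat.zero_le n) fun B hB => ?_
  refine Runs.seq (Q := fun s' => s'.reg 1 = #C - 1)
    (Runs.seq (runs_countLeft (by omega)) (b₂ := 4) (fun s _ _ h1 => ?_) le_rfl)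
    (b₂ := 360 * degSum adj + 650 * n + 220) ?_ (by omega)
  · exact Runs.flat (by decide) (by decide) (fun _ => Or.inl trivial)
      (fun _ => by simp [Prog.run, Expr.eval, h1])
  intro s _ hf h1
  obtain ⟨hin, ha⟩ := hf.holdsInput_initState (by decide) (by decide) h1
  refine runs_coreSlide hG hch hC hD hin hB (fun r hr => ?_) ha (Nat.sub_le _ _)
    (fun l hl => card_eq_of_seq (fun _ _ h => h.1) hl) (fun l hl => tar_of_tj hl)
    fun hCD l hl => ?_
  · rw [hf.reg r (by simp [countLoop, forTo, Prog.writesReg]; omega)]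
    exact initState_reg_eq_zero C D 0 (by omega)
  -- For empty cliques the truncated threshold `#C - 1` is zero, and `#C` is not one more than it;
  -- the constant sequence serves instead.
  · rcases Nat.eq_zero_or_pos #C with h0 | h0
    · obtain rfl := card_eq_zero.1 h0
      obtain rfl := card_eq_zero.1 (hCD.symm.trans h0)
      exact ⟨0, by omega, HasReconfSeq.refl hC⟩
    · obtain ⟨l', h, h'⟩ := tj_of_tar hl hC (by omega) (by omega) (Or.inl ⟨by omega, subset_rfl⟩)
      exact ⟨l', by omega, h'⟩

end Main

end CliqueReconf

theorem theorem5 :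
    (∃ (p : CliqueReconf.Prog) (c : ℕ), ∀ (n : ℕ) (G : SimpleGraph (Fin n))
      (adj : Fin n → List (Fin n)) (C₀ C₁ : Finset (Fin n)) (k : ℕ),
      CliqueReconf.IsAdjList G adj → CliqueReconf.IsChordal G →
      G.IsClique (C₀ : Set (Fin n)) → G.IsClique (C₁ : Set (Fin n)) →
      k ≤ C₀.card → k ≤ C₁.card →
      CliqueReconf.ComputesWithin (c * (CliqueReconf.graphSize G + 1)) p
        (CliqueReconf.initState adj C₀ C₁ k)
        (CliqueReconf.reconfDist G (CliqueReconf.TARStep k) C₀ C₁)) ∧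
    (∃ (p : CliqueReconf.Prog) (c : ℕ), ∀ (n : ℕ) (G : SimpleGraph (Fin n))
      (adj : Fin n → List (Fin n)) (C₀ C₁ : Finset (Fin n)),
      CliqueReconf.IsAdjList G adj → CliqueReconf.IsChordal G →
      G.IsClique (C₀ : Set (Fin n)) → G.IsClique (C₁ : Set (Fin n)) →
      CliqueReconf.ComputesWithin (c * (CliqueReconf.graphSize G + 1)) p
        (CliqueReconf.initState adj C₀ C₁ 0)
        (CliqueReconf.reconfDist G (CliqueReconf.TSStep G) C₀ C₁)) ∧
    (∃ (p : CliqueReconf.Prog) (c : ℕ), ∀ (n : ℕ) (G : SimpleGraph (Fin n))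
      (adj : Fin n → List (Fin n)) (C₀ C₁ : Finset (Fin n)),
      CliqueReconf.IsAdjList G adj → CliqueReconf.IsChordal G →
      G.IsClique (C₀ : Set (Fin n)) → G.IsClique (C₁ : Set (Fin n)) →
      CliqueReconf.ComputesWithin (c * (CliqueReconf.graphSize G + 1)) p
        (CliqueReconf.initState adj C₀ C₁ 0)
        (CliqueReconf.reconfDist G CliqueReconf.TJStep C₀ C₁)) := by
  refine ⟨⟨CliqueReconf.tarProg, 800, ?_⟩, ⟨CliqueReconf.tsProg, 800, ?_⟩,
    ⟨CliqueReconf.tjProg, 800, ?_⟩⟩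
  · intro n G adj C D k hG hch hC hD hkC hkD
    exact CliqueReconf.computesWithin_tarProg hG hch hC hD hkC hkD
  · intro n G adj C D hG hch hC hD
    exact CliqueReconf.computesWithin_tsProg hG hch hC hD
  · intro n G adj C D hG hch hC hD
    exact CliqueReconf.computesWithin_tjProg hG hch hC hD
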